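/- Let $D$ be a nonsplit indefinite quaternion algebra over $\mathbb{Q}$, let $\mathcal{O}$ be a maximal order of $D$, and fix an isomorphism $\phi : D\otimes\mathbb{R}\cong M_2(\mathbb{R})$. Let $X^D$ be the set of isomorphism classes of complex abelian surfaces $A$ with an injective ring homomorphism $\mathcal{O}\hookrightarrow \operatorname{End}(A)$. For a prime $p$ let $X^D(p)$ be the set of isomorphism classes of such surfaces together with a full level $p$ structure, that is, an element $v\in A[p]$ with $\mathcal{O}v=A[p]$, taken up to scaling by $(\mathbb{Z}/p)^*$. Metric. For $z\in\mathbb{H}^{\pm}=\mathbb{C}\setminus\mathbb{R}$ let $A_z=\mathbb{C}^2/\phi(\mathcal{O})\binom{z}{1}$, with $\mathcal{O}$ acting through $\phi$. For each $h\in\mathcal{O}$ that is a unit modulo $p$ there is a map $\psi_h:\mathbb{H}^{\pm}\to X^D(p)$, $z\mapsto \bigl(A_z,\ \tfrac1p\phi(h)\binom{z}{1}\bigr)$, and $X^D(p)$ is the union of the images of these maps. It carries the hyperbolic distance (curvature $-1$) inherited from $\mathbb{H}^{\pm}$: the distance of two points is the infimum of the distances of $z$ and $w$ over all $h,z,w$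 such that the points are $\psi_h(z)$ and $\psi_h(w)$ (points of different components have infinite distance). $B(x,r)$ is the set of points of $X^D(p)$ within distance $r$ of $x$. Hecke divisors. For $k\ge 1$ coprime to $p$, $T_k\subset X^D(p)\times X^D(p)$ is the set of pairs $\bigl((A,v),(A',v')\bigr)$ for which there is an $\mathcal{O}$-linear isogeny $A\to A'$ whose kernel is isomorphic to $(\mathbb{Z}/k)^2$ as a group and which maps $v$ to a $(\mathbb{Z}/p)^*$-multiple of $v'$. Heegner CM points. A pair $\bigl((A,v),(A',v')\bigr)$ in $X^D(p)\times X^D(p)$ is a Heegner CM point if there are $g\in(\mathcal{O}/p\mathcal{O})^*$, not a scalar from $\mathbb{Z}/p$, and $\mathcal{O}$-linear automorphisms $\alpha$ of $A$ and $\beta$ of $A'$ such that $gv=\alpha v$, $gv'=\beta v'$, and $\alpha$ and $\beta$ act on the tangent spaces at $0$ of $A$ and $A'$ by the same complex scalar. Proposition. For each $r>0$ there exists $d>0$ such that for all sufficiently large primes $p$ the following holds. If $(x,y)$ and $(x',y')$ are distinct Heegner CM points of $X^D(p)\times X^D(p)$ with the same projection to $X^D\times X^D$, and $B(x,r)\cap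 B(x',r)\neq\varnothing$ and $B(y,r)\cap B(y',r)\neq\varnothing$, then one of $(x,y)$, $(x',y')$ lies on a Hecke divisor $T_k$ with $k<d$. -/

import Mathlib

open scoped TensorProduct ENNReal

noncomputable section

namespace FakeElliptic

section Orders

variable {D : Type*} [Ring D] [Algebra ℚ D]

/-- A subring of a `ℚ`-algebra `D` is an order if it is finitely generated as an abelian group and
spans `D` over `ℚ`. -/
structure IsOrder (O : Subring D) : Prop where
  fg : O.toAddSubgroup.FG
  spans : Submodule.span ℚ (O : Set D) = ⊤

/-- A maximal order. -/
structure IsMaximalOrder (O : Subring D) : Prop where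
  isOrder : IsOrder O
  maximal : ∀ O' : Subring D, IsOrder O' → O ≤ O' → O' = O

end Orders

section Surfaces

variable {D : Type*} [Ring D]

/-- A complex abelian surface with an action of `O`, presented as `ℂ² / L` for a full lattice `L`
carrying a Riemann form. An endomorphism of `ℂ² / L` is a complex `2 × 2` matrix (its action on the
tangent space at `0`) that preserves `L`; `rho` is the injective ring homomorphism from `O` to the
endomorphism ring. -/
structure QMSurface (O : Subring D) where
  lattice : Submodule ℤ (Fin 2 → ℂ)
  discrete : DiscreteTopology lattice
  full : Submodule.span ℝ (lattice : Set (Fin 2 → ℂ)) = ⊤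
  polarizable : ∃ E : (Fin 2 → ℂ) →ₗ[ℝ] (Fin 2 → ℂ) →ₗ[ℝ] ℝ,
    (∀ u, E u u = 0) ∧
    (∀ u v, E (Complex.I • u) (Complex.I • v) = E u v) ∧
    (∀ u, u ≠ 0 → 0 < E u (Complex.I • u)) ∧
    (∀ u ∈ lattice, ∀ v ∈ lattice, ∃ n : ℤ, E u v = n)
  rho : O →+* Matrix (Fin 2) (Fin 2) ℂ
  rho_injective : Function.Injective rho
  rho_mem : ∀ (a : O), ∀ v ∈ lattice, (rho a).mulVec v ∈ lattice

variable {O : Subring D}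

namespace QMSurface

/-- The group of complex points `ℂ² / L`. -/
abbrev Torus (A : QMSurface O) : Type := (Fin 2 → ℂ) ⧸ A.lattice

/-- The endomorphism of `ℂ² / L` given by `a : O`. -/
def act (A : QMSurface O) (a : O) : A.Torus →ₗ[ℤ] A.Torus :=
  A.lattice.mapQ A.lattice ((Matrix.mulVecLin (A.rho a)).restrictScalars ℤ) (A.rho_mem a)

/-- An `O`-linear homomorphism of abelian surfaces. -/
structure Hom (A B : QMSurface O) where
  mat : Matrix (Fin 2) (Fin 2) ℂ
  map_mem : ∀ v ∈ A.lattice, mat.mulVec v ∈ B.lattice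
  comm : ∀ a : O, mat * A.rho a = B.rho a * mat

namespace Hom

variable {A B C : QMSurface O}

/-- The induced homomorphism on complex points. -/
def onPoints (f : Hom A B) : A.Torus →ₗ[ℤ] B.Torus :=
  A.lattice.mapQ B.lattice ((Matrix.mulVecLin f.mat).restrictScalars ℤ) f.map_mem

/-- The identity. -/
def id (A : QMSurface O) : Hom A A where
  mat := 1
  map_mem v hv := by simpa using hv
  comm a := by simp

/-- Composition, `f` after `g`. -/
def comp (f : Hom B C) (g : Hom A B) : Hom A C where
  mat := f.mat * g.mat
  map_mem v hv := by
    rw [← Matrix.mulVec_mulVec]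
    exact f.map_mem _ (g.map_mem _ hv)
  comm a := by rw [Matrix.mul_assoc, g.comm, ← Matrix.mul_assoc, f.comm, Matrix.mul_assoc]

/-- `f` is an isogeny: surjective with finite kernel, i.e. invertible on tangent spaces. -/
def IsIsogeny (f : Hom A B) : Prop := IsUnit f.mat

/-- `f` is an isomorphism. -/
def IsIso (f : Hom A B) : Prop := ∃ g : Hom B A, f.mat * g.mat = 1 ∧ g.mat * f.mat = 1

theorem isIso_id (A : QMSurface O) : (Hom.id A).IsIso := ⟨Hom.id A, by simp [Hom.id]⟩

theorem IsIso.comp {f : Hom B C} {g : Hom A B} (hf : f.IsIso) (hg : g.IsIso) :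
    (f.comp g).IsIso := by
  obtain ⟨f', h1, h2⟩ := hf
  obtain ⟨g', h3, h4⟩ := hg
  refine ⟨g'.comp f', ?_, ?_⟩
  · calc f.mat * g.mat * (g'.mat * f'.mat) = f.mat * (g.mat * g'.mat) * f'.mat := by
          simp only [Matrix.mul_assoc]
      _ = 1 := by rw [h3, Matrix.mul_one, h1]
  · calc g'.mat * f'.mat * (f.mat * g.mat) = g'.mat * (f'.mat * f.mat) * g.mat := by
          simp only [Matrix.mul_assoc]
      _ = 1 := by rw [h2, Matrix.mul_one, h4]

theorem onPoints_id (A : QMSurface O) (v : A.Torus) : (Hom.id A).onPoints v = v := by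
  obtain ⟨v, rfl⟩ := Submodule.Quotient.mk_surjective _ v
  simp [onPoints, Hom.id]

theorem onPoints_comp (f : Hom B C) (g : Hom A B) (v : A.Torus) :
    (f.comp g).onPoints v = f.onPoints (g.onPoints v) := by
  obtain ⟨v, rfl⟩ := Submodule.Quotient.mk_surjective _ v
  change Submodule.Quotient.mk ((f.mat * g.mat).mulVec v) =
    Submodule.Quotient.mk (f.mat.mulVec (g.mat.mulVec v))
  rw [Matrix.mulVec_mulVec]

theorem onPoints_eq_self {f : Hom A A} (h : f.mat = 1) (v : A.Torus) : f.onPoints v = v := by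
  obtain ⟨v, rfl⟩ := Submodule.Quotient.mk_surjective _ v
  simp [onPoints, h]

end Hom

/-- Two surfaces with `O`-action are isomorphic. -/
instance isoSetoid (O : Subring D) : Setoid (QMSurface O) where
  r A B := ∃ f : Hom A B, f.IsIso
  iseqv :=
    { refl := fun A => ⟨Hom.id A, Hom.isIso_id A⟩
      symm := by
        rintro A B ⟨f, g, h1, h2⟩
        exact ⟨g, f, h2, h1⟩
      trans := by
        rintro A B C ⟨f, hf⟩ ⟨g, hg⟩
        exact ⟨g.comp f, hg.comp hf⟩ }

end QMSurface

/-- The complex points of the Shimura curve: isomorphism classes of abelian surfaces with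
`O`-action. -/
def ShimuraCurve (O : Subring D) : Type _ := Quotient (QMSurface.isoSetoid O)

/-- An abelian surface with `O`-action and a full level `N` structure, given as an `N`-torsion point
`gen` that generates the `N`-torsion over `O`. -/
structure LevelSurface (O : Subring D) (N : ℕ) where
  surface : QMSurface O
  gen : surface.Torus
  torsion : (N : ℤ) • gen = 0
  generates : ∀ u : surface.Torus, (N : ℤ) • u = 0 → ∃ a : O, u = surface.act a gen

namespace LevelSurface

variable {N : ℕ}

/-- `f` carries the level structure of `A` to that of `B`, up to scaling by `(ℤ / N)ˣ`. -/
def MapsLevel (A B : LevelSurface O N) (f : QMSurface.Hom A.surface B.surface) : Prop :=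
  ∃ n : ℤ, IsCoprime n (N : ℤ) ∧ f.onPoints A.gen = n • B.gen

/-- Isomorphism of surfaces with `O`-action and level structure up to scale. -/
instance isoSetoid (O : Subring D) (N : ℕ) : Setoid (LevelSurface O N) where
  r A B := ∃ f : QMSurface.Hom A.surface B.surface, f.IsIso ∧ MapsLevel A B f
  iseqv :=
    { refl := fun A => ⟨QMSurface.Hom.id _, QMSurface.Hom.isIso_id _, 1, isCoprime_one_left, by
        rw [QMSurface.Hom.onPoints_id, one_smul]⟩
      symm := by
        rintro A B ⟨f, ⟨g, h1, h2⟩, n, hn, hv⟩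
        obtain ⟨m, k, hmk⟩ := hn
        refine ⟨g, ⟨f, h2, h1⟩, m, ⟨n, k, by rw [← hmk]; ring⟩, ?_⟩
        have e1 : B.gen = m • f.onPoints A.gen := by
          rw [hv, smul_smul]
          have : m * n = 1 - k * N := by rw [← hmk]; ring
          rw [this, sub_smul, one_smul, mul_smul, B.torsion, smul_zero, sub_zero]
        rw [e1, map_smul, ← QMSurface.Hom.onPoints_comp,
          QMSurface.Hom.onPoints_eq_self (f := g.comp f) h2]
      trans := by
        rintro A B C ⟨f, hf, n, hn, hv⟩ ⟨g, hg, m, hm, hw⟩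
        refine ⟨g.comp f, hg.comp hf, n * m, hn.mul_left hm, ?_⟩
        rw [QMSurface.Hom.onPoints_comp, hv, map_smul, hw, smul_smul] }

end LevelSurface

/-- The complex points of the Shimura curve with full level `N` structure. -/
def LevelShimuraCurve (O : Subring D) (N : ℕ) : Type _ := Quotient (LevelSurface.isoSetoid O N)

namespace LevelShimuraCurve

variable {N : ℕ}

/-- The point of the curve given by a surface with level structure. -/
def mk (A : LevelSurface O N) : LevelShimuraCurve O N := Quotient.mk _ A

/-- The projection that forgets the level structure. -/
def proj (P : LevelShimuraCurve O N) : ShimuraCurve O :=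
  Quotient.map (sa := LevelSurface.isoSetoid O N) (sb := QMSurface.isoSetoid O)
    LevelSurface.surface (fun _ _ ⟨f, hf, _⟩ => ⟨f, hf⟩) P

end LevelShimuraCurve

/-- The Hecke divisor `T_k`, for `k ≥ 1` coprime to `N`: the pairs of surfaces with level structure
that are related by an `O`-isogeny whose kernel is free of rank two over `ℤ / k` and which respects
the level structures up to scale. -/
def HeckeDivisor (O : Subring D) (N k : ℕ) : Set (LevelShimuraCurve O N × LevelShimuraCurve O N) :=
  {P | 0 < k ∧ k.Coprime N ∧ ∃ A B : LevelSurface O N,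
    P = (LevelShimuraCurve.mk A, LevelShimuraCurve.mk B) ∧
    ∃ f : QMSurface.Hom A.surface B.surface, f.IsIsogeny ∧
      Nonempty (LinearMap.ker f.onPoints ≃+ ZMod k × ZMod k) ∧ LevelSurface.MapsLevel A B f}

/-- `(x, y)` is a Heegner CM point: `x` and `y` are fixed by a common non-trivial element of
`(O / N O)ˣ / (ℤ / N)ˣ`, acting on the torsion generators. This element has a lift `g` with
`g v = α v` and `g w = β w` for automorphisms `α`, `β` of the two surfaces with `O`-action, and
`α`, `β` act on the tangent spaces at `0` through the same scalar `c`. (An automorphism that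
commutes with `O` always acts on the tangent space by a scalar.) -/
def IsHeegnerCM {N : ℕ} (P : LevelShimuraCurve O N × LevelShimuraCurve O N) : Prop :=
  ∃ A B : LevelSurface O N, P = (LevelShimuraCurve.mk A, LevelShimuraCurve.mk B) ∧
    ∃ g : O,
      (∃ g' e e' : O, g * g' = 1 + (N : O) * e ∧ g' * g = 1 + (N : O) * e') ∧
      (∀ (n : ℤ) (e : O), g ≠ (n : O) + (N : O) * e) ∧
      ∃ (α : QMSurface.Hom A.surface A.surface) (β : QMSurface.Hom B.surface B.surface) (c : ℂ),
        α.IsIso ∧ β.IsIso ∧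
        A.surface.act g A.gen = α.onPoints A.gen ∧
        B.surface.act g B.gen = β.onPoints B.gen ∧
        α.mat = c • (1 : Matrix (Fin 2) (Fin 2) ℂ) ∧ β.mat = c • (1 : Matrix (Fin 2) (Fin 2) ℂ)

end Surfaces

/-- `ℍ^± = ℂ ∖ ℝ`. -/
abbrev DoubleHalfPlane : Type := {z : ℂ // z.im ≠ 0}

namespace DoubleHalfPlane

/-- The point of the upper half plane obtained from `z` by complex conjugation if necessary. -/
def toUpper (z : DoubleHalfPlane) : UpperHalfPlane :=
  ⟨⟨z.1.re, |z.1.im|⟩, abs_pos.mpr z.2⟩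

/-- The hyperbolic distance (curvature `-1`) on `ℍ^±`; points of different components have infinite
distance. -/
def hypDist (z w : DoubleHalfPlane) : ℝ≥0∞ :=
  if 0 < z.1.im * w.1.im then edist z.toUpper w.toUpper else ⊤

end DoubleHalfPlane

section Metric

variable {D : Type*} [Ring D] [Algebra ℚ D] {O : Subring D} {N : ℕ}

/-- The embedding of `O` in the complex matrices that comes from a splitting `φ` of `D ⊗ ℝ`. -/
def complexRep (φ : (ℝ ⊗[ℚ] D) ≃ₐ[ℝ] Matrix (Fin 2) (Fin 2) ℝ) (a : O) :
    Matrix (Fin 2) (Fin 2) ℂ :=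
  (φ ((1 : ℝ) ⊗ₜ[ℚ] (a : D))).map Complex.ofReal

/-- `P` is the image of `z ∈ ℍ^±` under the uniformization with label `h`: it is the class of
`ℂ² / L_z`, where `L_z = φ(O) (z, 1)ᵀ`, with the action of `O` through `φ`, and with the torsion
generator `φ(h) (z, 1)ᵀ / N`. -/
def IsUniformizedBy (φ : (ℝ ⊗[ℚ] D) ≃ₐ[ℝ] Matrix (Fin 2) (Fin 2) ℝ) (h : O)
    (z : DoubleHalfPlane) (P : LevelShimuraCurve O N) : Prop :=
  ∃ A : LevelSurface O N, P = LevelShimuraCurve.mk A ∧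
    (A.surface.lattice : Set (Fin 2 → ℂ)) =
      Set.range (fun a : O => (complexRep φ a).mulVec ![z.1, 1]) ∧
    (∀ a : O, A.surface.rho a = complexRep φ a) ∧
    A.gen = Submodule.Quotient.mk (((N : ℂ)⁻¹) • (complexRep φ h).mulVec ![z.1, 1])

/-- The distance on the level `N` Shimura curve inherited from `ℍ^±`: the infimum of the hyperbolic
distances of lifts of the two points to a common copy of `ℍ^±`. -/
def curveDist (φ : (ℝ ⊗[ℚ] D) ≃ₐ[ℝ] Matrix (Fin 2) (Fin 2) ℝ) (P Q : LevelShimuraCurve O N) :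
    ℝ≥0∞ :=
  ⨅ (h : O) (z : DoubleHalfPlane) (w : DoubleHalfPlane)
    (_ : IsUniformizedBy φ h z P) (_ : IsUniformizedBy φ h w Q), z.hypDist w

/-- The points within hyperbolic distance `r` of `P`. -/
def hypBall (φ : (ℝ ⊗[ℚ] D) ≃ₐ[ℝ] Matrix (Fin 2) (Fin 2) ℝ) (P : LevelShimuraCurve O N) (r : ℝ) :
    Set (LevelShimuraCurve O N) :=
  {Q | curveDist φ P Q ≤ ENNReal.ofReal r}

end Metric

end FakeElliptic

end

/-!
Let `(x, y)` and `(x', y')` be Heegner CM points as in the theorem. Choose uniformizations: `x` is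
given by a non-real number `z` and a label `h ∈ O`, and `y` by `w` and `k`.

*CM elements.* The common scalar `c` acts on the lattices of `x` and `y` through elements `a` and
`b` of `O` that have `(z, 1)` and `(w, 1)` as eigenvectors with eigenvalue `c`, and the common
element `g` satisfies `g h ≡ h a` and `g k ≡ k b` modulo `p`. Hence `m = conj k * h` intertwines `a`
and `b` modulo `p` (`dvd_intertwine`). Since the balls around `x` and `x'` meet, `x'` has a
uniformization at a point `z₂` near `z` whose label is a scalar multiple of `h` modulo `p`
(`exists_models_of_hypBall_inter`); in the same way for `y'` and `y`. So `m` also intertwines,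
modulo `p`, the elements `a₁` and `b₁` that belong to `(x', y')`.

*Finiteness.* The unit group of `O` acts cocompactly on `ℂ ∖ ℝ` because `D` is a division algebra
(`exists_unit_bounded`, from Minkowski's theorem). The scalars have absolute value one, so after
conjugation by units all of `a, a₁, b, b₁` lie in a finite set that depends on `r` only
(`abs_conj_le`). For fixed `a, a₁, b, b₁` the condition of being an intertwiner is linear over `ℤ`,
so for large `p` each solution modulo `p` lifts to a solution over `ℤ` (`exists_ker_lift`). Thus
there is `n₀ ∈ O` with `n₀ a = b n₀` and `n₀ a₁ = b₁ n₀`, and `m` is a multiple of `n₀` modulo `p`.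

*Dichotomy.* If `a` and `a₁` commute, then they have the same fixed point, so `z₂ = z` and
`x' = x`; since `n₀` conjugates `a, a₁` to `b, b₁`, also `y' = y`, which is excluded. If they do not
commute, then `n₀` is unique up to scalars; so it can be taken primitive, and its reduced norm is
bounded in terms of `r` (`exists_primitive_intertwiner`). It carries `z` to `w` and matches the
labels, so it defines an isogeny from `x` to `y` with kernel `O / O conj n₀`
(`IsModel.mem_heckeDivisor`).

*The kernel.* For primitive `n` with `|nrd n| = N` the group `O / O n` has order `N ^ 2` and is
killed by `N`; it is `(ℤ / N) ^ 2` as soon as two elements generate it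
(`nonempty_quotient_addEquiv`). This holds because modulo a prime no non-zero left ideal of a
maximal order is a line (`exists_mul_not_dvd_sub`), also at ramified primes; this is the step that
needs maximality.
-/

noncomputable section

namespace FakeElliptic

/-! ### The reduced norm on an order -/

section ReducedNorm

/-- Right multiplication by `A` acts on each of the two rows, hence the square. -/
theorem det_mulRight_matrix (A : Matrix (Fin 2) (Fin 2) ℝ) :
    LinearMap.det (LinearMap.mulRight ℝ A) = A.det ^ 2 := by
  have h : (LinearMap.mulRight ℝ A : Matrix (Fin 2) (Fin 2) ℝ →ₗ[ℝ] Matrix (Fin 2) (Fin 2) ℝ) =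
      (LinearMap.pi fun i : Fin 2 => (Matrix.toLin' A.transpose).comp
        (LinearMap.proj (R := ℝ) (φ := fun _ : Fin 2 => Fin 2 → ℝ) i) :
        (Fin 2 → Fin 2 → ℝ) →ₗ[ℝ] (Fin 2 → Fin 2 → ℝ)) := by
    refine LinearMap.ext fun X => ?_
    ext i j
    change (X * A) i j = (A.transpose.mulVec (X i)) j
    simp [Matrix.mul_apply, Matrix.mulVec, dotProduct, mul_comm]
  have h2 := LinearMap.det_pi (fun _ : Fin 2 => Matrix.toLin' A.transpose)
  rw [h]
  refine h2.trans ?_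
  simp [LinearMap.det_toLin', sq]

variable {D : Type*} [Ring D] [Algebra ℚ D]
  (φ : (ℝ ⊗[ℚ] D) ≃ₐ[ℝ] Matrix (Fin 2) (Fin 2) ℝ) {O : Subring D}

/-- The embedding of `D` in the real matrices that comes from a splitting of `D ⊗ ℝ`. -/
def realRep : D →ₐ[ℚ] Matrix (Fin 2) (Fin 2) ℝ :=
  (φ.toAlgHom.restrictScalars ℚ).comp Algebra.TensorProduct.includeRight

theorem realRep_apply (a : D) : realRep φ a = φ ((1 : ℝ) ⊗ₜ[ℚ] a) := rfl

theorem complexRep_eq (a : O) : complexRep φ a = (realRep φ (a : D)).map Complex.ofReal := rfl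

theorem realRep_injective : Function.Injective (realRep φ) := by
  intro a b h
  rw [realRep_apply, realRep_apply] at h
  exact Algebra.TensorProduct.includeRight_injective
    (FaithfulSMul.algebraMap_injective ℚ ℝ) (φ.injective h)

/-- A `ℤ`-basis of an order is a basis of the real matrix algebra. -/
theorem exists_basis (hO : IsOrder O) (hdim : Module.finrank ℚ D = 4) :
    ∃ (b : Module.Basis (Fin 4) ℤ O) (B : Module.Basis (Fin 4) ℝ (Matrix (Fin 2) (Fin 2) ℝ)),
      ∀ i, B i = realRep φ (b i : D) := by
  have : Module.Finite ℤ O := by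
    have := hO.fg
    rw [AddSubgroup.fg_iff_addSubmonoid_fg, ← AddMonoid.fg_iff_addSubmonoid_fg] at this
    have h2 : AddGroup.FG O := AddGroup.fg_iff_addMonoid_fg.mpr this
    exact Module.Finite.iff_addGroup_fg.mpr h2
  have : IsAddTorsionFree D := IsAddTorsionFree.of_module_rat D
  have : IsAddTorsionFree O :=
    Function.Injective.isAddTorsionFree O.subtype.toAddMonoidHom Subtype.coe_injective
  have : Module.Free ℤ O := inferInstance
  let b0 := Module.finBasis ℤ O
  set n := Module.finrank ℤ O with hn
  have hli : LinearIndependent ℤ (fun i => (b0 i : D)) := by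
    have := b0.linearIndependent.map' (O.subtype.toAddMonoidHom.toIntLinearMap)
      (LinearMap.ker_eq_bot.mpr Subtype.coe_injective)
    exact this
  have hliQ : LinearIndependent ℚ (fun i => (b0 i : D)) :=
    (LinearIndependent.iff_fractionRing ℤ ℚ).mp hli
  have hspan : ⊤ ≤ Submodule.span ℚ (Set.range fun i => (b0 i : D)) := by
    rw [← hO.spans, Submodule.span_le]
    intro x hx
    have h1 := b0.sum_repr ⟨x, hx⟩
    have h2 : x = ∑ i, ((b0.repr ⟨x, hx⟩ i : ℤ) : ℚ) • (b0 i : D) := by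
      have := congrArg (O.subtype) h1
      rw [map_sum] at this
      simp only [Subring.subtype_apply] at this
      refine this.symm.trans (Finset.sum_congr rfl fun i _ => ?_)
      rw [Int.cast_smul_eq_zsmul]
      rfl
    rw [h2]
    exact Submodule.sum_mem _ fun i _ => Submodule.smul_mem _ _ (Submodule.subset_span ⟨i, rfl⟩)
  let bQ : Module.Basis (Fin n) ℚ D := Module.Basis.mk hliQ hspan
  have h4 : n = 4 := by
    rw [← hdim, Module.finrank_eq_card_basis bQ, Fintype.card_fin]
  let B0 : Module.Basis (Fin n) ℝ (Matrix (Fin 2) (Fin 2) ℝ) :=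
    (Algebra.TensorProduct.basis ℝ bQ).map φ.toLinearEquiv
  refine ⟨b0.reindex (finCongr h4), B0.reindex (finCongr h4), fun i => ?_⟩
  simp [B0, bQ, realRep_apply]

/-- Right multiplication by `a` on an order has the same matrix as on the real matrix algebra, so its
determinant is the square of the reduced norm. -/
theorem det_mulRight_int (hO : IsOrder O) (hdim : Module.finrank ℚ D = 4) (a : O) :
    ((LinearMap.det (LinearMap.mulRight ℤ a) : ℤ) : ℝ) = (realRep φ (a : D)).det ^ 2 := by
  obtain ⟨b, B, hB⟩ := exists_basis φ hO hdim
  rw [← det_mulRight_matrix, ← LinearMap.det_toMatrix b, ← LinearMap.det_toMatrix B]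
  rw [← eq_intCast (Int.castRingHom ℝ), RingHom.map_det]
  congr 1
  ext i j
  rw [RingHom.mapMatrix_apply, Matrix.map_apply, LinearMap.toMatrix_apply, LinearMap.toMatrix_apply]
  have h1 : LinearMap.mulRight ℝ (realRep φ (a : D)) (B j) =
      ∑ i, ((b.repr (LinearMap.mulRight ℤ a (b j)) i : ℤ) : ℝ) • B i := by
    have h2 := congrArg (fun x : O => realRep φ (x : D))
      (b.sum_repr (LinearMap.mulRight ℤ a (b j)))
    simp only [LinearMap.mulRight_apply] at h2 ⊢
    rw [hB, ← map_mul, ← Subring.coe_mul, ← h2]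
    rw [AddSubmonoidClass.coe_finsetSum, map_sum]
    refine Finset.sum_congr rfl fun i _ => ?_
    rw [hB, Int.cast_smul_eq_zsmul, ← map_zsmul (realRep φ)]
    rfl
  rw [h1]
  simp [Finsupp.single_apply]

/-- An arithmetic criterion: if all values `(n + k t + k²)²` are integers then `n` and `t` are
integers. It turns integrality of the norm `det²` into integrality of reduced trace and norm. -/
theorem exists_int_of_sq_int {t n : ℝ} (h : ∀ k : ℤ, ∃ m : ℤ, (m : ℝ) = (n + k * t + k ^ 2) ^ 2) :
    (∃ m : ℤ, (m : ℝ) = t) ∧ ∃ m : ℤ, (m : ℝ) = n := by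
  obtain ⟨m0, h0⟩ := h 0
  obtain ⟨m1, h1⟩ := h 1
  obtain ⟨m2, h2⟩ := h (-1)
  obtain ⟨m3, h3⟩ := h 2
  obtain ⟨m4, h4⟩ := h (-2)
  push_cast at h0 h1 h2 h3 h4
  -- `t` and `n` are rational, by taking differences of the five values
  have ht : t = ((m3 - 2 * m1 + 2 * m2 - m4 : ℤ) / 24 : ℚ) := by
    push_cast
    linear_combination (-(h3 - 2 * h1 + 2 * h2 - h4)) / 24
  obtain ⟨T, hT⟩ : ∃ T : ℚ, t = T := ⟨_, ht⟩
  have hn : n = (((m1 + m2 - 2 * m0 - 2) / 2 - T ^ 2) / 2 : ℚ) := by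
    push_cast
    rw [← hT]
    linear_combination (-(h1 + h2 - 2 * h0)) / 4
  obtain ⟨N, hN⟩ : ∃ N : ℚ, n = N := ⟨_, hn⟩
  have key : ∀ (q : ℚ) (m : ℤ), (m : ℚ) = q ^ 2 → ∃ k : ℤ, (k : ℚ) = q := by
    intro q m hm
    have : IsIntegral ℤ q := by
      refine IsIntegral.of_pow (n := 2) (by norm_num) ?_
      rw [← hm]
      exact isIntegral_algebraMap (R := ℤ) (A := ℚ) (x := m)
    obtain ⟨k, hk⟩ := IsIntegrallyClosed.isIntegral_iff.mp this
    exact ⟨k, by simpa using hk⟩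
  obtain ⟨k0, hk0⟩ := key N m0 (by
    have : (m0 : ℝ) = (N : ℝ) ^ 2 := by rw [h0, ← hN]; ring
    exact_mod_cast this)
  obtain ⟨k1, hk1⟩ := key (N + T + 1) m1 (by
    have : (m1 : ℝ) = ((N : ℝ) + T + 1) ^ 2 := by rw [h1, ← hN, ← hT]; ring
    exact_mod_cast this)
  refine ⟨⟨k1 - k0 - 1, ?_⟩, k0, ?_⟩
  · rw [hT]
    have : ((k1 - k0 - 1 : ℤ) : ℚ) = T := by push_cast; rw [hk1, hk0]; ring
    exact_mod_cast this
  · rw [hN]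
    exact_mod_cast hk0

theorem exists_int_trace_det (hO : IsOrder O) (hdim : Module.finrank ℚ D = 4) (a : O) :
    (∃ m : ℤ, (m : ℝ) = (realRep φ (a : D)).trace) ∧
      ∃ m : ℤ, (m : ℝ) = (realRep φ (a : D)).det := by
  refine exists_int_of_sq_int fun k => ⟨_, (det_mulRight_int φ hO hdim (a + (k : O))).trans ?_⟩
  have : realRep φ ((a + (k : O) : O) : D) = realRep φ (a : D) + (k : Matrix (Fin 2) (Fin 2) ℝ) := by
    push_cast
    rw [map_add, map_intCast]
  rw [this, Matrix.det_fin_two, Matrix.det_fin_two, Matrix.trace_fin_two]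
  simp [Matrix.intCast_apply]
  ring

/-- The reduced norm of an element of an order, as the determinant in the real splitting; it is an
integer by `exists_int_trace_det`, so taking the integer part loses nothing. -/
def nrd (a : O) : ℤ := ⌊(realRep φ (a : D)).det⌋

/-- The reduced trace of an element of an order, as the trace in the real splitting; it is an integer
as well. -/
def trd (a : O) : ℤ := ⌊(realRep φ (a : D)).trace⌋

/-- The standard involution `a ↦ trd a - a` of an order. -/
def conj (a : O) : O := (trd φ a : O) - a

theorem cast_nrd (hO : IsOrder O) (hdim : Module.finrank ℚ D = 4) (a : O) :
    (nrd φ a : ℝ) = (realRep φ (a : D)).det := by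
  obtain ⟨m, hm⟩ := (exists_int_trace_det φ hO hdim a).2
  rw [nrd, ← hm, Int.floor_intCast]

theorem cast_trd (hO : IsOrder O) (hdim : Module.finrank ℚ D = 4) (a : O) :
    (trd φ a : ℝ) = (realRep φ (a : D)).trace := by
  obtain ⟨m, hm⟩ := (exists_int_trace_det φ hO hdim a).1
  rw [trd, ← hm, Int.floor_intCast]

theorem realRep_conj (hO : IsOrder O) (hdim : Module.finrank ℚ D = 4) (a : O) :
    realRep φ (conj φ a : D) = (realRep φ (a : D)).adjugate := by
  have : realRep φ (conj φ a : D) = (trd φ a : Matrix (Fin 2) (Fin 2) ℝ) - realRep φ (a : D) := by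
    rw [conj]
    push_cast
    rw [map_sub, map_intCast]
  rw [this, Matrix.adjugate_fin_two]
  ext i j
  fin_cases i <;> fin_cases j <;>
    simp [Matrix.intCast_apply, cast_trd φ hO hdim, Matrix.trace_fin_two]

theorem realRep_ext {a b : O} (h : realRep φ (a : D) = realRep φ (b : D)) : a = b :=
  Subtype.ext (realRep_injective φ h)

theorem realRep_intCast (n : ℤ) : realRep φ ((n : O) : D) = (n : Matrix (Fin 2) (Fin 2) ℝ) := by
  push_cast
  rw [map_intCast]

theorem mul_conj (hO : IsOrder O) (hdim : Module.finrank ℚ D = 4) (a : O) :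
    a * conj φ a = (nrd φ a : O) := by
  apply realRep_ext φ
  rw [Subring.coe_mul, map_mul, realRep_conj φ hO hdim, Matrix.mul_adjugate, realRep_intCast,
    ← cast_nrd φ hO hdim]
  ext i j
  simp [Matrix.intCast_apply, Matrix.one_apply]

theorem conj_mul_self (hO : IsOrder O) (hdim : Module.finrank ℚ D = 4) (a : O) :
    conj φ a * a = (nrd φ a : O) := by
  apply realRep_ext φ
  rw [Subring.coe_mul, map_mul, realRep_conj φ hO hdim, Matrix.adjugate_mul, realRep_intCast,
    ← cast_nrd φ hO hdim]
  ext i j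
  simp [Matrix.intCast_apply, Matrix.one_apply]

theorem conj_conj (hO : IsOrder O) (hdim : Module.finrank ℚ D = 4) (a : O) :
    conj φ (conj φ a) = a := by
  apply realRep_ext φ
  rw [realRep_conj φ hO hdim, realRep_conj φ hO hdim, Matrix.adjugate_adjugate _ (by simp)]
  simp

theorem conj_add (hO : IsOrder O) (hdim : Module.finrank ℚ D = 4) (a b : O) :
    conj φ (a + b) = conj φ a + conj φ b := by
  apply realRep_ext φ
  rw [Subring.coe_add, map_add, realRep_conj φ hO hdim, Subring.coe_add, map_add,
    realRep_conj φ hO hdim, realRep_conj φ hO hdim]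
  simp only [Matrix.adjugate_fin_two]
  ext i j
  fin_cases i <;> fin_cases j <;> simp [add_comm]

theorem conj_intCast_mul (hO : IsOrder O) (hdim : Module.finrank ℚ D = 4) (n : ℤ) (a : O) :
    conj φ ((n : O) * a) = (n : O) * conj φ a := by
  apply realRep_ext φ
  rw [Subring.coe_mul, map_mul, realRep_conj φ hO hdim, Subring.coe_mul, map_mul,
    realRep_conj φ hO hdim, realRep_intCast]
  simp only [Matrix.adjugate_fin_two]
  ext i j
  fin_cases i <;> fin_cases j <;>
    simp [Matrix.mul_apply, Matrix.intCast_apply]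

theorem nrd_mul (hO : IsOrder O) (hdim : Module.finrank ℚ D = 4) (a b : O) :
    nrd φ (a * b) = nrd φ a * nrd φ b := by
  have : (nrd φ (a * b) : ℝ) = nrd φ a * nrd φ b := by
    simp only [cast_nrd φ hO hdim]
    rw [Subring.coe_mul, map_mul, Matrix.det_mul]
  exact_mod_cast this

theorem nrd_intCast (hO : IsOrder O) (hdim : Module.finrank ℚ D = 4) (n : ℤ) :
    nrd φ (n : O) = n ^ 2 := by
  have : (nrd φ (n : O) : ℝ) = (n : ℝ) ^ 2 := by
    rw [cast_nrd φ hO hdim, realRep_intCast, Matrix.det_fin_two]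
    simp [Matrix.intCast_apply, sq]
  exact_mod_cast this

theorem nrd_conj (hO : IsOrder O) (hdim : Module.finrank ℚ D = 4) (a : O) :
    nrd φ (conj φ a) = nrd φ a := by
  have : (nrd φ (conj φ a) : ℝ) = nrd φ a := by
    rw [cast_nrd φ hO hdim, cast_nrd φ hO hdim, realRep_conj φ hO hdim, Matrix.det_adjugate]
    simp
  exact_mod_cast this

theorem nrd_one (hO : IsOrder O) (hdim : Module.finrank ℚ D = 4) : nrd φ (1 : O) = 1 := by
  simpa using nrd_intCast φ hO hdim 1

theorem nrd_unit (hO : IsOrder O) (hdim : Module.finrank ℚ D = 4) {a b : O} (h : a * b = 1) :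
    |nrd φ a| = 1 := by
  have : nrd φ a * nrd φ b = 1 := by rw [← nrd_mul φ hO hdim, h, nrd_one φ hO hdim]
  exact Int.isUnit_iff_abs_eq.mp (IsUnit.of_mul_eq_one _ this)

/-- A quaternion algebra over `ℚ` that is not a matrix algebra is a division algebra. -/
theorem isUnit_of_ne_zero [Algebra.IsCentral ℚ D] [IsSimpleRing D]
    (hdim : Module.finrank ℚ D = 4)
    (hnonsplit : IsEmpty (D ≃ₐ[ℚ] Matrix (Fin 2) (Fin 2) ℚ)) {a : D} (ha : a ≠ 0) :
    IsUnit a := by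
  have : Module.Finite ℚ D := Module.finite_of_finrank_pos (by omega)
  have : IsArtinianRing D := IsArtinianRing.of_finite ℚ D
  obtain ⟨n, hn, S, _, _, _, ⟨e⟩⟩ :=
    IsSimpleRing.exists_algEquiv_matrix_divisionRing_finite ℚ D
  have h1 : n * n * Module.finrank ℚ S = 4 := by
    have := e.toLinearEquiv.finrank_eq
    rw [hdim, Module.finrank_matrix] at this
    simpa using this.symm
  have hn0 := NeZero.pos n
  have hn2 : n ≤ 2 := by
    by_contra h
    push Not at h
    have hS : 0 < Module.finrank ℚ S := by
      rcases Nat.eq_zero_or_pos (Module.finrank ℚ S) with h | h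
      · rw [h] at h1; omega
      · exact h
    nlinarith
  interval_cases n
  · have h0 : e a 0 0 ≠ 0 := by
      intro h0
      apply ha
      apply e.injective
      rw [map_zero]
      ext i j
      rw [Subsingleton.elim i 0, Subsingleton.elim j 0, h0, Matrix.zero_apply]
    refine (MulEquiv.isUnit_map e).mp ⟨⟨e a, Matrix.of fun _ _ => (e a 0 0)⁻¹, ?_, ?_⟩, rfl⟩ <;>
    · ext i j
      rw [Subsingleton.elim i 0, Subsingleton.elim j 0]
      simp [Matrix.mul_apply, h0]
  · exfalso
    have hS : Module.finrank ℚ S = 1 := by omega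
    have hbij : Function.Bijective (algebraMap ℚ S) :=
      bijective_algebraMap_of_linearEquiv (LinearEquiv.ofFinrankEq ℚ S (by simp [hS]))
    let g : ℚ ≃ₐ[ℚ] S := AlgEquiv.ofBijective (Algebra.ofId ℚ S) hbij
    exact hnonsplit.false (e.trans g.symm.mapMatrix)

theorem nrd_ne_zero [Algebra.IsCentral ℚ D] [IsSimpleRing D]
    (hO : IsOrder O) (hdim : Module.finrank ℚ D = 4)
    (hnonsplit : IsEmpty (D ≃ₐ[ℚ] Matrix (Fin 2) (Fin 2) ℚ)) {a : O} (ha : a ≠ 0) :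
    nrd φ a ≠ 0 := by
  have h1 : IsUnit (a : D) := isUnit_of_ne_zero hdim hnonsplit (by simpa using ha)
  have h2 : IsUnit (realRep φ (a : D)) := h1.map _
  have h3 := ((Matrix.isUnit_iff_isUnit_det _).mp h2).ne_zero
  rw [← cast_nrd φ hO hdim] at h3
  exact_mod_cast h3

end ReducedNorm

/-! ### Divisibility by integers in an order -/

section Divisibility

variable {D : Type*} [Ring D] [Algebra ℚ D]
  (φ : (ℝ ⊗[ℚ] D) ≃ₐ[ℝ] Matrix (Fin 2) (Fin 2) ℝ) {O : Subring D}

theorem intCast_dvd_mul_left {R : Type*} [Ring R] {n : ℤ} {x : R} (h : (n : R) ∣ x) (c : R) :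
    (n : R) ∣ c * x := by
  obtain ⟨y, rfl⟩ := h
  exact ⟨c * y, by rw [← mul_assoc, ← mul_assoc, (Int.cast_commute n c).eq]⟩

theorem intCast_dvd_of_dvd_mul {R : Type*} [Ring R] {n j : ℤ} {x : R} (hj : IsCoprime j n)
    (h : (n : R) ∣ (j : R) * x) : (n : R) ∣ x := by
  obtain ⟨u, v, huv⟩ := hj
  have : x = (u : R) * ((j : R) * x) + (n : R) * ((v : R) * x) := by
    have h1 : ((u * j + v * n : ℤ) : R) = 1 := by rw [huv, Int.cast_one]
    push_cast at h1
    rw [(Int.cast_commute v (n : R)).eq] at h1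
    rw [← mul_assoc, ← mul_assoc, ← add_mul, h1, one_mul]
  rw [this]
  exact dvd_add (intCast_dvd_mul_left h _) (Dvd.intro _ rfl)

theorem intCast_mul_cancel {n : ℤ} (hn : n ≠ 0) {x y : O} (h : (n : O) * x = n * y) : x = y := by
  have : IsAddTorsionFree D := IsAddTorsionFree.of_module_rat D
  rw [← zsmul_eq_mul, ← zsmul_eq_mul] at h
  have h2 : n • (x : D) = n • (y : D) := by exact_mod_cast congrArg (Subtype.val) h
  exact Subtype.ext (zsmul_right_injective hn h2)

theorem intCast_dvd_nrd (hO : IsOrder O) (hdim : Module.finrank ℚ D = 4) {n : ℤ} {x : O}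
    (h : (n : O) ∣ x) : n ^ 2 ∣ nrd φ x := by
  obtain ⟨y, rfl⟩ := h
  rw [nrd_mul φ hO hdim, nrd_intCast φ hO hdim]
  exact Dvd.intro _ rfl

theorem intCast_dvd_intCast (φ : (ℝ ⊗[ℚ] D) ≃ₐ[ℝ] Matrix (Fin 2) (Fin 2) ℝ)
    (hO : IsOrder O) (hdim : Module.finrank ℚ D = 4) {n m : ℤ}
    (h : (n : O) ∣ (m : O)) : n ∣ m := by
  have := intCast_dvd_nrd φ hO hdim h
  rwa [nrd_intCast φ hO hdim, Int.pow_dvd_pow_iff two_ne_zero] at this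

theorem intCast_dvd_conj (hO : IsOrder O) (hdim : Module.finrank ℚ D = 4) {n : ℤ} {x : O}
    (h : (n : O) ∣ x) : (n : O) ∣ conj φ x := by
  obtain ⟨y, rfl⟩ := h
  rw [conj_intCast_mul φ hO hdim]
  exact Dvd.intro _ rfl

theorem intCast_dvd_conj_iff (hO : IsOrder O) (hdim : Module.finrank ℚ D = 4) {n : ℤ} {x : O} :
    (n : O) ∣ conj φ x ↔ (n : O) ∣ x :=
  ⟨fun h => by simpa [conj_conj φ hO hdim] using intCast_dvd_conj φ hO hdim h,
    intCast_dvd_conj φ hO hdim⟩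

theorem finite_free_of_isOrder (φ : (ℝ ⊗[ℚ] D) ≃ₐ[ℝ] Matrix (Fin 2) (Fin 2) ℝ)
    (hO : IsOrder O) (hdim : Module.finrank ℚ D = 4) :
    Module.Finite ℤ O ∧ Module.Free ℤ O ∧ Module.finrank ℤ O = 4 := by
  obtain ⟨b, -⟩ := exists_basis φ hO hdim
  exact ⟨Module.Finite.of_basis b, Module.Free.of_basis b, by
    simpa using Module.finrank_eq_card_basis b⟩

/-- The index of the left ideal generated by `n` is the square of the reduced norm. -/
theorem index_range_mulRight (hO : IsOrder O) (hdim : Module.finrank ℚ D = 4) {n : O}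
    (hn : nrd φ n ≠ 0) :
    (AddMonoidHom.mulRight n).range.index = (nrd φ n).natAbs ^ 2 := by
  obtain ⟨_, _, -⟩ := finite_free_of_isOrder φ hO hdim
  have hinj : Function.Injective (LinearMap.mulRight ℤ n) := by
    intro x y h
    simp only [LinearMap.mulRight_apply] at h
    have h2 := congrArg (· * conj φ n) h
    simp only [mul_assoc, mul_conj φ hO hdim] at h2
    rw [← (Int.cast_commute _ _).eq, ← (Int.cast_commute _ _).eq] at h2
    exact intCast_mul_cancel hn h2
  have h1 := Submodule.natAbs_det_equiv (LinearMap.range (LinearMap.mulRight ℤ n))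
    (LinearEquiv.ofInjective _ hinj)
  have h2 : (LinearMap.range (LinearMap.mulRight ℤ n)).subtype ∘ₗ
      AddMonoidHom.toIntLinearMap ((LinearEquiv.ofInjective (LinearMap.mulRight ℤ n) hinj :
        O ≃ₗ[ℤ] _) : O →+ LinearMap.range (LinearMap.mulRight ℤ n)) = LinearMap.mulRight ℤ n := by
    ext x
    rfl
  have h3 : LinearMap.det (LinearMap.mulRight ℤ n) = nrd φ n ^ 2 := by
    have := det_mulRight_int φ hO hdim n
    rw [← cast_nrd φ hO hdim] at this
    exact_mod_cast this
  rw [h2, h3, Int.natAbs_pow] at h1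
  rw [h1]
  rfl

end Divisibility

/-! ### Left ideals of a maximal order modulo a prime -/

section Maximal

variable {D : Type*} [Ring D] [Algebra ℚ D]
  (φ : (ℝ ⊗[ℚ] D) ≃ₐ[ℝ] Matrix (Fin 2) (Fin 2) ℝ) {O : Subring D}

/-- The annihilator of `n` modulo `q`: all `a` with `q ∣ a * n`. -/
def annMod (q : ℤ) (n : O) : AddSubgroup O where
  carrier := {a | (q : O) ∣ a * n}
  zero_mem' := by simp
  add_mem' {a b} ha hb := by
    change (q : O) ∣ (a + b) * n
    rw [add_mul]
    exact dvd_add ha hb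
  neg_mem' {a} ha := by simpa using ha

theorem mem_annMod {D : Type*} [Ring D] {O : Subring D} {q : ℤ} {n a : O} :
    a ∈ annMod q n ↔ (q : O) ∣ a * n := Iff.rfl

/-- The right order of a subgroup `P` of `O`: all `x : D` with `P x ⊆ P`. -/
def rightOrder (P : AddSubgroup O) : Subring D where
  carrier := {x | ∀ a ∈ P, ∃ b ∈ P, (a : D) * x = (b : D)}
  mul_mem' {x y} hx hy a ha := by
    obtain ⟨b, hb, h1⟩ := hx a ha
    obtain ⟨c, hc, h2⟩ := hy b hb
    exact ⟨c, hc, by rw [← mul_assoc, h1, h2]⟩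
  one_mem' a ha := ⟨a, ha, by simp⟩
  add_mem' {x y} hx hy a ha := by
    obtain ⟨b, hb, h1⟩ := hx a ha
    obtain ⟨c, hc, h2⟩ := hy a ha
    exact ⟨b + c, P.add_mem hb hc, by rw [mul_add, h1, h2]; rfl⟩
  zero_mem' a _ := ⟨0, P.zero_mem, by simp⟩
  neg_mem' {x} hx a ha := by
    obtain ⟨b, hb, h1⟩ := hx a ha
    exact ⟨-b, P.neg_mem hb, by rw [mul_neg, h1]; rfl⟩

/-- The right order of a right ideal of a maximal order that contains a non-zero integer is the
maximal order itself. -/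
theorem mem_of_mem_rightOrder (hM : IsMaximalOrder O) {P : AddSubgroup O}
    (hP : ∀ a ∈ P, ∀ b : O, a * b ∈ P) {q : ℤ} (hq : q ≠ 0) (hqP : (q : O) ∈ P)
    {x : D} (hx : x ∈ rightOrder P) : x ∈ O := by
  have hle : O ≤ rightOrder P := fun y hy a ha => ⟨a * ⟨y, hy⟩, hP a ha _, rfl⟩
  have hord : IsOrder (rightOrder P) := by
    refine ⟨?_, ?_⟩
    · -- multiplication by `q` embeds the right order in the finitely generated group `P ⊆ O`
      have : Module.Finite ℤ O := by
        have := hM.isOrder.fg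
        rw [AddSubgroup.fg_iff_addSubmonoid_fg, ← AddMonoid.fg_iff_addSubmonoid_fg] at this
        exact Module.Finite.iff_addGroup_fg.mpr (AddGroup.fg_iff_addMonoid_fg.mpr this)
      have hmem : ∀ y : rightOrder P, (q : D) * (y : D) ∈ O := by
        intro y
        obtain ⟨b, -, h⟩ := y.2 _ hqP
        have : (q : D) * (y : D) = (b : D) := by simpa using h
        rw [this]
        exact b.2
      let f : rightOrder P →ₗ[ℤ] O := AddMonoidHom.toIntLinearMap
        { toFun := fun y => ⟨(q : D) * y, hmem y⟩
          map_zero' := by ext; simp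
          map_add' := fun y z => by ext; simp [mul_add] }
      have hf : Function.Injective f := by
        have : IsAddTorsionFree D := IsAddTorsionFree.of_module_rat D
        intro y z h
        have h1 : (q : D) * (y : D) = q * z := congrArg Subtype.val h
        rw [← zsmul_eq_mul, ← zsmul_eq_mul] at h1
        exact Subtype.ext (zsmul_right_injective hq h1)
      have : Module.Finite ℤ (rightOrder P) := Module.Finite.of_injective f hf
      have h2 := AddGroup.fg_iff_addMonoid_fg.mp (Module.Finite.iff_addGroup_fg.mp this)
      rw [AddSubgroup.fg_iff_addSubmonoid_fg, ← AddMonoid.fg_iff_addSubmonoid_fg]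
      exact h2
    · exact top_le_iff.mp (hM.isOrder.spans.symm.le.trans (Submodule.span_mono hle))
  rw [← hM.maximal _ hord hle]
  exact hx

/-- If left multiplication acts on the line of `n` modulo `q`, then `q²` divides the reduced norm
of `n`: right multiplication by `n` has rank one modulo `q`, so that its determinant, the square of
the reduced norm, is divisible by `q³`. -/
theorem sq_dvd_nrd_of_line (hO : IsOrder O) (hdim : Module.finrank ℚ D = 4) {q : ℕ}
    (hq : q.Prime) {n : O} (h : ∀ a : O, ∃ j : ℤ, ((q : ℤ) : O) ∣ a * n - j * n) :
    (q : ℤ) ^ 2 ∣ nrd φ n := by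
  by_cases hn : nrd φ n = 0
  · rw [hn]; exact dvd_zero _
  obtain ⟨_, _, h4⟩ := finite_free_of_isOrder φ hO hdim
  let Q : AddSubgroup O := (nsmulAddMonoidHom (α := O) q).range
  have hQ : ∀ x : O, x ∈ Q ↔ ((q : ℤ) : O) ∣ x := by
    intro x
    constructor
    · rintro ⟨y, rfl⟩
      exact ⟨y, by simp⟩
    · rintro ⟨y, rfl⟩
      exact ⟨y, by simp⟩
  have hQi : Q.index = q ^ 4 := by rw [← h4]; exact AddSubgroup.index_range_nsmul O q
  have hPi : (annMod (q : ℤ) n).index ∣ q := by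
    let f : O →+ O ⧸ Q := (QuotientAddGroup.mk' Q).comp (AddMonoidHom.mulRight n)
    have hker : annMod (q : ℤ) n = f.ker := by
      ext x
      rw [AddMonoidHom.mem_ker, mem_annMod, ← hQ]
      exact (QuotientAddGroup.eq_zero_iff _).symm
    rw [hker, AddSubgroup.index_ker]
    have hle : f.range ≤ AddSubgroup.zmultiples (QuotientAddGroup.mk' Q n) := by
      rintro _ ⟨a, rfl⟩
      obtain ⟨j, hj⟩ := h a
      refine ⟨j, ?_⟩
      rw [← hQ, ← QuotientAddGroup.eq_zero_iff, QuotientAddGroup.mk_sub, sub_eq_zero] at hj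
      change j • QuotientAddGroup.mk' Q n = QuotientAddGroup.mk (a * n)
      rw [hj, ← zsmul_eq_mul]
      rfl
    refine (AddSubgroup.card_dvd_of_le hle).trans ?_
    rw [Nat.card_zmultiples]
    apply addOrderOf_dvd_of_nsmul_eq_zero
    rw [← map_nsmul]
    exact (QuotientAddGroup.eq_zero_iff _).mpr ⟨n, rfl⟩
  have hmap : (annMod (q : ℤ) n).map (AddMonoidHom.mulRight n) ≤ Q := by
    rintro _ ⟨a, ha, rfl⟩
    exact (hQ _).mpr ha
  have hker : (AddMonoidHom.mulRight n).ker ≤ annMod (q : ℤ) n := by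
    intro x hx
    have : x * n = 0 := hx
    rw [mem_annMod, this]
    exact dvd_zero _
  have hd := AddSubgroup.index_dvd_of_le hmap
  rw [hQi, AddSubgroup.index_map, sup_of_le_left hker, index_range_mulRight φ hO hdim hn] at hd
  have hd2 : q * q ^ 3 ∣ q * (nrd φ n).natAbs ^ 2 := by
    have := hd.trans (mul_dvd_mul_right hPi _)
    rwa [show q ^ 4 = q * q ^ 3 by ring] at this
  have hd3 : q ^ 3 ∣ (nrd φ n).natAbs ^ 2 := Nat.dvd_of_mul_dvd_mul_left hq.pos hd2
  have hd4 : q ∣ (nrd φ n).natAbs :=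
    hq.dvd_of_dvd_pow ((dvd_pow_self q (by norm_num)).trans hd3)
  obtain ⟨m, hm⟩ := hd4
  have hd5 : q ∣ m := by
    rw [hm, mul_pow, show q ^ 3 = q ^ 2 * q by ring] at hd3
    exact hq.dvd_of_dvd_pow (Nat.dvd_of_mul_dvd_mul_left (pow_pos hq.pos 2) hd3)
  obtain ⟨m', rfl⟩ := hd5
  rw [← Int.natCast_pow, Int.natCast_dvd, hm]
  exact ⟨m', by ring⟩

/-- Modulo a prime `q`, no left ideal of a maximal order is a line: if `n` is not divisible by `q`
then `O n` is not contained in `ℤ n + q O`. Otherwise the annihilator `P` of `n` modulo `q` would be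
a two-sided ideal of prime index; as its right order is `O`, the element `t = n / q` carries `P`
into `O` but not into `P`, and comparing the `q`-adic valuations of reduced norms of `u`, `t` and
`u t` for a suitable `u ∈ P` gives a contradiction. -/
theorem exists_mul_not_dvd_sub (φ : (ℝ ⊗[ℚ] D) ≃ₐ[ℝ] Matrix (Fin 2) (Fin 2) ℝ)
    (hM : IsMaximalOrder O) (hdim : Module.finrank ℚ D = 4) {q : ℕ}
    (hq : q.Prime) {n : O} (hn : ¬ ((q : ℤ) : O) ∣ n) :
    ∃ a : O, ∀ j : ℤ, ¬ ((q : ℤ) : O) ∣ a * n - j * n := by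
  by_contra! H
  have hO := hM.isOrder
  have hqp : Prime (q : ℤ) := Nat.prime_iff_prime_int.mp hq
  have hq0 : (q : ℤ) ≠ 0 := hqp.ne_zero
  have hcop : ∀ j : ℤ, ¬ (q : ℤ) ∣ j → IsCoprime j (q : ℤ) := fun j hj =>
    ((Prime.coprime_iff_not_dvd hqp).mpr hj).symm
  set P := annMod (q : ℤ) n with hP
  have hint : ∀ j : ℤ, ((q : ℤ) : O) ∣ j * n → (q : ℤ) ∣ j := by
    intro j hj
    by_contra hj'
    exact hn (intCast_dvd_of_dvd_mul (hcop j hj') hj)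
  have hPright : ∀ a ∈ P, ∀ b : O, a * b ∈ P := by
    intro a ha b
    obtain ⟨j, hj⟩ := H b
    have h1 : a * b * n = a * (b * n - j * n) + j * (a * n) := by
      rw [mul_sub, ← mul_assoc, ← mul_assoc, ← mul_assoc, (Int.cast_commute j a).eq]
      abel
    rw [hP, mem_annMod, h1]
    exact dvd_add (intCast_dvd_mul_left hj _) (intCast_dvd_mul_left ha _)
  have hqP : ((q : ℤ) : O) ∈ P := Dvd.intro _ rfl
  have hPnrd : ∀ a ∈ P, (q : ℤ) ∣ nrd φ a := by
    intro a ha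
    apply hint
    rw [← conj_mul_self φ hO hdim, mul_assoc]
    exact intCast_dvd_mul_left ha _
  -- the reduced norm modulo `q` vanishes only on `P` and its conjugate
  have hnrdP : ∀ a : O, (q : ℤ) ∣ nrd φ a → a ∈ P ∨ conj φ a ∈ P := by
    intro a ha
    obtain ⟨j, hj⟩ := H (conj φ a)
    by_cases hqj : (q : ℤ) ∣ j
    · right
      rw [hP, mem_annMod]
      obtain ⟨k, rfl⟩ := hqj
      have : conj φ a * n = (conj φ a * n - ((q : ℤ) * k : ℤ) * n) + (q : ℤ) * (k * n) := by
        push_cast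
        rw [mul_assoc]
        abel
      rw [this]
      exact dvd_add hj (Dvd.intro _ rfl)
    · left
      refine intCast_dvd_of_dvd_mul (hcop j hqj) ?_
      have h1 : (j : O) * (a * n) = (nrd φ a : O) * n - a * (conj φ a * n - j * n) := by
        rw [← mul_conj φ hO hdim, mul_sub, ← mul_assoc, ← mul_assoc, ← mul_assoc,
          (Int.cast_commute j a).eq]
        abel
      rw [h1]
      refine dvd_sub ?_ (intCast_dvd_mul_left hj _)
      obtain ⟨k, hk⟩ := ha
      rw [hk]
      push_cast
      rw [mul_assoc]
      exact Dvd.intro _ rfl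
  -- `u w` stands for `u (n / q)`
  have hdiv : ∀ u ∈ P, ∃ w : O, u * n = (q : ℤ) * w := fun u hu => hu
  obtain ⟨u₁, hu₁, w₁, hw₁, hw₁P⟩ : ∃ u ∈ P, ∃ w : O, u * n = (q : ℤ) * w ∧ w ∉ P := by
    by_contra! hcon
    have hmem : ((q : ℚ)⁻¹ • (n : D)) ∈ rightOrder P := by
      intro a ha
      obtain ⟨w, hw⟩ := hdiv a ha
      refine ⟨w, hcon a ha w hw, ?_⟩
      have h1 : (a : D) * (n : D) = (q : ℤ) * (w : D) := by exact_mod_cast congrArg Subtype.val hw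
      rw [mul_smul_comm, h1, inv_smul_eq_iff₀ (by exact_mod_cast hq0), Algebra.smul_def]
      simp
    have hmemO := mem_of_mem_rightOrder hM hPright hq0 hqP hmem
    apply hn
    refine ⟨⟨_, hmemO⟩, Subtype.ext ?_⟩
    push_cast
    rw [← nsmul_eq_mul, ← Nat.cast_smul_eq_nsmul ℚ, smul_inv_smul₀ (by exact_mod_cast hq0)]
  -- the final comparison of valuations, for `t = n' / q` with `n' ≡ n` modulo `q`
  have final : ∀ n' : O, (∃ e : O, n' = n + (q : ℤ) * e) →
      (∃ u ∈ P, ∃ w, u * n' = (q : ℤ) * w ∧ w ∉ P) →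
      (∃ u ∈ P, ∃ w, u * n' = (q : ℤ) * w ∧ conj φ w ∉ P) → False := by
    rintro n' ⟨e, he⟩ ⟨u, hu, w, hw, hwP⟩ ⟨v, hv, x, hx, hxP⟩
    have hnn : (q : ℤ) ^ 2 ∣ nrd φ n' := by
      apply sq_dvd_nrd_of_line φ hO hdim hq
      intro a
      obtain ⟨j, hj⟩ := H a
      refine ⟨j, ?_⟩
      have : a * n' - j * n' = (a * n - j * n) + (a * ((q : ℤ) * e) - (q : ℤ) * (j * e)) := by
        rw [he, mul_add, mul_add, ← mul_assoc (j : O) ((q : ℤ) : O),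
          (Int.cast_commute j (((q : ℤ) : O))).eq, mul_assoc]
        abel
      rw [this]
      exact dvd_add hj (dvd_sub (intCast_dvd_mul_left (Dvd.intro _ rfl) _) (Dvd.intro _ rfl))
    obtain ⟨s, hs, y, hy, hyP, hyP'⟩ :
        ∃ s ∈ P, ∃ y, s * n' = (q : ℤ) * y ∧ y ∉ P ∧ conj φ y ∉ P := by
      by_cases h1 : conj φ w ∈ P
      · by_cases h2 : x ∈ P
        · refine ⟨u + v, P.add_mem hu hv, w + x, by rw [add_mul, hw, hx, mul_add], ?_, ?_⟩
          · intro h3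
            exact hwP (by simpa using P.sub_mem h3 h2)
          · intro h3
            rw [conj_add φ hO hdim] at h3
            exact hxP (by simpa using P.sub_mem h3 h1)
        · exact ⟨v, hv, x, hx, h2, hxP⟩
      · exact ⟨u, hu, w, hw, hwP, h1⟩
    have hy3 : ¬ (q : ℤ) ∣ nrd φ y := fun h => (hnrdP y h).elim hyP hyP'
    have h5 := congrArg (nrd φ) hy
    rw [nrd_mul φ hO hdim, nrd_mul φ hO hdim, nrd_intCast φ hO hdim] at h5
    have h6 : (q : ℤ) ^ 2 * q ∣ (q : ℤ) ^ 2 * nrd φ y := by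
      rw [← h5, mul_comm ((q : ℤ) ^ 2)]
      exact mul_dvd_mul (hPnrd s hs) hnn
    exact hy3 (Int.dvd_of_mul_dvd_mul_left (pow_ne_zero 2 hq0) h6)
  by_cases hbar : ∃ u ∈ P, ∃ w : O, u * n = (q : ℤ) * w ∧ conj φ w ∉ P
  · exact final n ⟨0, by simp⟩ ⟨u₁, hu₁, w₁, hw₁, hw₁P⟩ hbar
  push Not at hbar
  have h1 := hbar u₁ hu₁ w₁ hw₁
  -- now `P` is not stable under conjugation, and `t` may be replaced by `t + 1`
  refine final (n + (q : ℤ)) ⟨1, by simp⟩ ⟨u₁, hu₁, w₁ + u₁, ?_, ?_⟩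
    ⟨conj φ w₁, h1, ?_⟩
  · rw [mul_add, mul_add, hw₁, (Int.cast_commute (q : ℤ) u₁).eq]
  · intro h3
    exact hw₁P (by simpa using P.sub_mem h3 hu₁)
  · obtain ⟨w₂, hw₂⟩ := hdiv _ h1
    refine ⟨w₂ + conj φ w₁, by rw [mul_add, mul_add, hw₂,
      (Int.cast_commute (q : ℤ) (conj φ w₁)).eq], ?_⟩
    intro h3
    rw [conj_add φ hO hdim, conj_conj φ hO hdim] at h3
    exact hw₁P (by simpa using P.sub_mem h3 (hbar _ h1 _ hw₂))

end Maximal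

/-! ### The quotient of a maximal order by a primitive left ideal -/

section TwoGenerators

theorem nonempty_addEquiv_zmod_prod {G : Type*} [AddCommGroup G] {N : ℕ} (hN : 0 < N)
    (hkill : ∀ x : G, N • x = 0) (hcard : Nat.card G = N ^ 2)
    (hgen : ∃ e f : G, ∀ x, ∃ i j : ℤ, x = i • e + j • f) :
    Nonempty (G ≃+ ZMod N × ZMod N) := by
  have : NeZero N := ⟨hN.ne'⟩
  have : Finite G := Nat.finite_of_card_ne_zero (by rw [hcard]; positivity)
  obtain ⟨e, f, hgen⟩ := hgen
  have hz : ∀ x : G, zmultiplesHom G x N = 0 := fun x => by simp [hkill]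
  let F : ZMod N × ZMod N →+ G :=
    (ZMod.lift N ⟨zmultiplesHom G e, hz e⟩).coprod (ZMod.lift N ⟨zmultiplesHom G f, hz f⟩)
  have hF : Function.Surjective F := by
    intro x
    obtain ⟨i, j, rfl⟩ := hgen x
    exact ⟨((i : ZMod N), (j : ZMod N)), by simp [F]⟩
  have hb : Function.Bijective F :=
    (Nat.bijective_iff_surjective_and_card F).mpr ⟨hF, by simp [hcard, sq]⟩
  exact ⟨(AddEquiv.ofBijective F hb).symm⟩

theorem exists_two_generators_of_finrank_le {G : Type*} [AddCommGroup G] {q : ℕ} [Fact q.Prime]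
    [Module (ZMod q) G] [Module.Finite (ZMod q) G] (hr : Module.finrank (ZMod q) G ≤ 2) :
    ∃ e f : G, ∀ x, ∃ i j : ℤ, x = i • e + j • f := by
  have hsmul : ∀ (c : ZMod q) (x : G), ∃ i : ℤ, c • x = i • x := fun c x => by
    obtain ⟨i, rfl⟩ := ZMod.intCast_surjective c
    exact ⟨i, Int.cast_smul_eq_zsmul _ _ _⟩
  have hcases : Module.finrank (ZMod q) G = 0 ∨ Module.finrank (ZMod q) G = 1 ∨
      Module.finrank (ZMod q) G = 2 := by omega
  rcases hcases with h | h | h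
  · have b := Module.finBasisOfFinrankEq (ZMod q) G h
    refine ⟨0, 0, fun x => ⟨0, 0, ?_⟩⟩
    have := b.sum_repr x
    simpa using this.symm
  · have b := Module.finBasisOfFinrankEq (ZMod q) G h
    refine ⟨b 0, 0, fun x => ?_⟩
    obtain ⟨i, hi⟩ := hsmul (b.repr x 0) (b 0)
    have := b.sum_repr x
    rw [Fin.sum_univ_one, hi] at this
    exact ⟨i, 0, by simp [this]⟩
  · have b := Module.finBasisOfFinrankEq (ZMod q) G h
    refine ⟨b 0, b 1, fun x => ?_⟩
    obtain ⟨i, hi⟩ := hsmul (b.repr x 0) (b 0)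
    obtain ⟨j, hj⟩ := hsmul (b.repr x 1) (b 1)
    have := b.sum_repr x
    rw [Fin.sum_univ_two, hi, hj] at this
    exact ⟨i, j, this.symm⟩

theorem exists_two_generators_of_prime {G : Type*} [AddCommGroup G] [Finite G] {q : ℕ}
    (hq : q.Prime) (hkill : ∀ x : G, q • x = 0) (hcard : Nat.card G ≤ q ^ 2) :
    ∃ e f : G, ∀ x, ∃ i j : ℤ, x = i • e + j • f := by
  have : Fact q.Prime := ⟨hq⟩
  let M : Module (ZMod q) G := AddCommGroup.zmodModule hkill
  have hfin : Module.Finite (ZMod q) G := Module.Finite.of_finite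
  have hr : Module.finrank (ZMod q) G ≤ 2 := by
    rw [← FiniteField.pow_finrank_eq_natCard q G] at hcard
    exact (Nat.pow_le_pow_iff_right hq.one_lt).mp hcard
  exact @exists_two_generators_of_finrank_le G _ q _ M hfin hr

/-- A group killed by `N` that needs at most two generators modulo each prime divisor of `N` is
generated by two elements: by the Chinese remainder theorem the generators can be chosen
independently of the prime. -/
theorem exists_two_generators {G : Type*} [AddCommGroup G] {N : ℕ} (hN : 0 < N)
    (hkill : ∀ x : G, N • x = 0)
    (hgen : ∀ q : ℕ, q.Prime → q ∣ N →
      ∃ e f : G, ∀ x, ∃ (i j : ℤ) (y : G), x = i • e + j • f + q • y) :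
    ∃ e f : G, ∀ x, ∃ i j : ℤ, x = i • e + j • f := by
  classical
  choose! e f hef using hgen
  let S := N.primeFactors
  let c : ℕ → ℕ := fun q => ∏ q' ∈ S.erase q, q'
  have hc : ∀ q ∈ S, IsCoprime (c q : ℤ) (q : ℤ) := by
    intro q hq
    rw [Nat.isCoprime_iff_coprime]
    refine Nat.Coprime.prod_left fun q' hq' => ?_
    rw [Finset.mem_erase] at hq'
    exact (Nat.coprime_primes (Nat.prime_of_mem_primeFactors hq'.2)
      (Nat.prime_of_mem_primeFactors hq)).mpr hq'.1
  have hcong : ∀ (g : ℕ → G), ∀ q ∈ S, ∃ (u : ℤ) (y : G),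
      g q = u • (∑ q' ∈ S, c q' • g q') + q • y := by
    intro g q hq
    obtain ⟨u, v, huv⟩ := hc q hq
    have h1 : ∃ z : G, ∑ q' ∈ S.erase q, c q' • g q' = q • z := by
      have : ∀ q' ∈ S.erase q, ∃ z : G, c q' • g q' = q • z := by
        intro q' hq'
        have hmem : q ∈ S.erase q' := by
          rw [Finset.mem_erase] at hq' ⊢
          exact ⟨hq'.1.symm, hq⟩
        obtain ⟨k, hk⟩ := Finset.dvd_prod_of_mem (fun x : ℕ => x) hmem
        refine ⟨k • g q', ?_⟩
        rw [smul_smul]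
        exact congrArg (· • g q') hk
      choose! z hz using this
      exact ⟨∑ q' ∈ S.erase q, z q', by rw [Finset.smul_sum]; exact Finset.sum_congr rfl hz⟩
    obtain ⟨z, hz⟩ := h1
    refine ⟨u, v • g q - u • z, ?_⟩
    rw [← Finset.add_sum_erase S _ hq, hz]
    have h2 : g q = (u * c q + v * q : ℤ) • g q := by rw [huv, one_smul]
    conv_lhs => rw [h2]
    rw [add_smul, mul_smul, mul_smul, smul_add, smul_sub, natCast_zsmul, natCast_zsmul,
      smul_comm u q z, smul_comm v q (g q)]
    abel
  set E := ∑ q' ∈ S, c q' • e q'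
  set F := ∑ q' ∈ S, c q' • f q'
  have hprime : ∀ q ∈ S, ∀ x, ∃ (i j : ℤ) (y : G), x = i • E + j • F + q • y := by
    intro q hq x
    obtain ⟨i, j, y, hx⟩ := hef q (Nat.prime_of_mem_primeFactors hq)
      (Nat.dvd_of_mem_primeFactors hq) x
    obtain ⟨u, y1, h1⟩ := hcong e q hq
    obtain ⟨v, y2, h2⟩ := hcong f q hq
    refine ⟨i * u, j * v, i • y1 + j • y2 + y, ?_⟩
    rw [hx, h1, h2, smul_add, smul_add, smul_add, smul_add, mul_smul, mul_smul,
      smul_comm i q y1, smul_comm j q y2]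
    abel
  have hall : ∀ k : ℕ, k ∣ N → ∀ x, ∃ (i j : ℤ) (y : G), x = i • E + j • F + k • y := by
    intro k
    induction k using induction_on_primes with
    | zero => intro h; exact absurd (zero_dvd_iff.mp h) hN.ne'
    | one => intro _ x; exact ⟨0, 0, x, by simp⟩
    | prime_mul q k hq ih =>
      intro h x
      obtain ⟨i, j, y, hx⟩ := ih ((dvd_mul_left k q).trans h) x
      obtain ⟨i', j', y', hy⟩ := hprime q
        (Nat.mem_primeFactors.mpr ⟨hq, (dvd_mul_right q k).trans h, hN.ne'⟩) y
      refine ⟨i + k * i', j + k * j', y', ?_⟩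
      rw [hx, hy, smul_add, smul_add, add_smul, add_smul, mul_smul, mul_smul, natCast_zsmul,
        natCast_zsmul, smul_smul k q y', mul_comm k q]
      abel
  refine ⟨E, F, fun x => ?_⟩
  obtain ⟨i, j, y, hx⟩ := hall N dvd_rfl x
  exact ⟨i, j, by rw [hx, hkill, add_zero]⟩

end TwoGenerators

section Primitive

variable {D : Type*} [Ring D] [Algebra ℚ D]
  (φ : (ℝ ⊗[ℚ] D) ≃ₐ[ℝ] Matrix (Fin 2) (Fin 2) ℝ) {O : Subring D}

/-- An element of an order that is not divisible by any prime number. -/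
def IsPrimitive (n : O) : Prop := ∀ q : ℕ, q.Prime → ¬ ((q : ℤ) : O) ∣ n

theorem IsPrimitive.conj (hO : IsOrder O) (hdim : Module.finrank ℚ D = 4) {n : O}
    (hn : IsPrimitive n) : IsPrimitive (conj φ n) := fun q hq h =>
  hn q hq ((intCast_dvd_conj_iff φ hO hdim).mp h)

/-- `O n + q O` has index at most `q²` in `O`, since modulo `q` it is not a line. -/
theorem exists_two_generators_mod (hM : IsMaximalOrder O) (hdim : Module.finrank ℚ D = 4)
    (φ : (ℝ ⊗[ℚ] D) ≃ₐ[ℝ] Matrix (Fin 2) (Fin 2) ℝ) {q : ℕ}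
    (hq : q.Prime) {n : O} (hn : ¬ ((q : ℤ) : O) ∣ n) :
    ∃ e f : O, ∀ x, ∃ (i j : ℤ) (y z : O), x = i • e + j • f + q • y + z * n := by
  obtain ⟨_, _, h4⟩ := finite_free_of_isOrder φ hM.isOrder hdim
  let Q : AddSubgroup O := (nsmulAddMonoidHom (α := O) q).range
  have hQ : ∀ x : O, x ∈ Q ↔ ((q : ℤ) : O) ∣ x := by
    intro x
    constructor
    · rintro ⟨y, rfl⟩
      exact ⟨y, by simp⟩
    · rintro ⟨y, rfl⟩
      exact ⟨y, by simp⟩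
  have hQi : Q.index = q ^ 4 := by rw [← h4]; exact AddSubgroup.index_range_nsmul O q
  let H : AddSubgroup O := Q ⊔ (AddMonoidHom.mulRight n).range
  have hQH : Q ≤ H := le_sup_left
  have hnH : ∀ a, a * n ∈ H := fun a => le_sup_right (a := Q) ⟨a, rfl⟩
  let L : AddSubgroup O := Q ⊔ AddSubgroup.zmultiples n
  have hQL : Q ≤ L := le_sup_left
  have hLH : L ≤ H := sup_le hQH (by
    rw [AddSubgroup.zmultiples_le]
    simpa using hnH 1)
  have hmul : Q.relIndex L * (L.relIndex H * H.index) = q ^ 4 := by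
    rw [AddSubgroup.relIndex_mul_index hLH, AddSubgroup.relIndex_mul_index hQL, hQi]
  have h1 : Q.relIndex L ≠ 1 := by
    rw [Ne, AddSubgroup.relIndex_eq_one]
    intro h
    exact hn ((hQ n).mp (h (le_sup_right (a := Q) (AddSubgroup.mem_zmultiples n))))
  have h2 : L.relIndex H ≠ 1 := by
    rw [Ne, AddSubgroup.relIndex_eq_one]
    intro h
    obtain ⟨a, ha⟩ := exists_mul_not_dvd_sub φ hM hdim hq hn
    obtain ⟨x, hx, y, hy, hxy⟩ := AddSubgroup.mem_sup.mp (h (hnH a))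
    obtain ⟨j, rfl⟩ := AddSubgroup.mem_zmultiples_iff.mp hy
    apply ha j
    rw [← hQ, ← hxy, zsmul_eq_mul, add_sub_cancel_right]
    exact hx
  have hdvd1 : q ∣ Q.relIndex L := by
    obtain ⟨k, -, hk⟩ := (Nat.dvd_prime_pow hq).mp (Dvd.intro _ hmul)
    rw [hk]
    refine dvd_pow_self q ?_
    rintro rfl
    exact h1 hk
  have hdvd2 : q ∣ L.relIndex H := by
    obtain ⟨k, -, hk⟩ := (Nat.dvd_prime_pow hq).mp
      ((Dvd.intro _ rfl).trans (Dvd.intro_left _ hmul))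
    rw [hk]
    refine dvd_pow_self q ?_
    rintro rfl
    exact h2 hk
  have hHi : H.index ∣ q ^ 2 := by
    have : q ^ 2 * H.index ∣ q ^ 2 * q ^ 2 := by
      rw [show q ^ 2 * q ^ 2 = q ^ 4 by ring, ← hmul, ← mul_assoc, sq]
      exact mul_dvd_mul_right (mul_dvd_mul hdvd1 hdvd2) _
    exact Nat.dvd_of_mul_dvd_mul_left (pow_pos hq.pos 2) this
  have hHi' : H.index ≤ q ^ 2 := Nat.le_of_dvd (pow_pos hq.pos 2) hHi
  have hH0 : H.index ≠ 0 := fun h => by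
    rw [h, zero_dvd_iff] at hHi
    exact pow_ne_zero 2 hq.ne_zero hHi
  have : Finite (O ⧸ H) := Nat.finite_of_card_ne_zero hH0
  have hkill : ∀ x : O ⧸ H, q • x = 0 := by
    intro x
    obtain ⟨x, rfl⟩ := QuotientAddGroup.mk_surjective x
    rw [← QuotientAddGroup.mk_nsmul]
    exact (QuotientAddGroup.eq_zero_iff _).mpr (hQH ⟨x, rfl⟩)
  obtain ⟨e, f, hef⟩ := exists_two_generators_of_prime hq hkill hHi'
  obtain ⟨e, rfl⟩ := QuotientAddGroup.mk_surjective e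
  obtain ⟨f, rfl⟩ := QuotientAddGroup.mk_surjective f
  refine ⟨e, f, fun x => ?_⟩
  obtain ⟨i, j, hx⟩ := hef x
  rw [← QuotientAddGroup.mk_zsmul, ← QuotientAddGroup.mk_zsmul, ← QuotientAddGroup.mk_add,
    ← sub_eq_zero, ← QuotientAddGroup.mk_sub, QuotientAddGroup.eq_zero_iff] at hx
  obtain ⟨_, ⟨y, rfl⟩, _, ⟨z, rfl⟩, hyz⟩ := AddSubgroup.mem_sup.mp hx
  refine ⟨i, j, y, z, ?_⟩
  have h3 : q • y + z * n = x - (i • e + j • f) := hyz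
  rw [add_assoc, h3]
  abel

/-- For primitive `n` of reduced norm `± N` in a maximal order, `O / O n` is free of rank two over
`ℤ / N`. -/
theorem nonempty_quotient_addEquiv (hM : IsMaximalOrder O) (hdim : Module.finrank ℚ D = 4)
    {n : O} (hn : IsPrimitive n) (hn0 : nrd φ n ≠ 0) :
    Nonempty ((O ⧸ (AddMonoidHom.mulRight n).range) ≃+
      ZMod (nrd φ n).natAbs × ZMod (nrd φ n).natAbs) := by
  have hN : 0 < (nrd φ n).natAbs := Int.natAbs_pos.mpr hn0
  have hkill : ∀ x : O ⧸ (AddMonoidHom.mulRight n).range, (nrd φ n).natAbs • x = 0 := by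
    intro x
    obtain ⟨x, rfl⟩ := QuotientAddGroup.mk_surjective x
    rw [← QuotientAddGroup.mk_nsmul, QuotientAddGroup.eq_zero_iff]
    have h1 : nrd φ n • x ∈ (AddMonoidHom.mulRight n).range := by
      refine ⟨x * conj φ n, ?_⟩
      change x * conj φ n * n = _
      rw [mul_assoc, conj_mul_self φ hM.isOrder hdim, ← (Int.cast_commute _ x).eq, zsmul_eq_mul]
    rcases Int.natAbs_eq (nrd φ n) with h | h
    · rw [h, natCast_zsmul] at h1
      exact h1
    · rw [h, neg_smul, natCast_zsmul] at h1
      exact neg_mem_iff.mp h1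
  refine nonempty_addEquiv_zmod_prod hN hkill (index_range_mulRight φ hM.isOrder hdim hn0) ?_
  refine exists_two_generators hN hkill fun q hq _ => ?_
  obtain ⟨e, f, hef⟩ := exists_two_generators_mod hM hdim φ hq (hn q hq)
  refine ⟨e, f, fun x => ?_⟩
  obtain ⟨x, rfl⟩ := QuotientAddGroup.mk_surjective x
  obtain ⟨i, j, y, z, hx⟩ := hef x
  refine ⟨i, j, y, ?_⟩
  have hz : z * n ∈ (AddMonoidHom.mulRight n).range := ⟨z, rfl⟩
  rw [hx, QuotientAddGroup.mk_add, (QuotientAddGroup.eq_zero_iff (z * n)).mpr hz, add_zero]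
  rfl

end Primitive

/-! ### Lifting intertwiners modulo a large prime -/

section Intertwiners

/-- For all integers prime to the torsion of the cokernel of `T`, the kernel of `T` modulo `p` is
the reduction of the kernel of `T`. -/
theorem exists_ker_lift {M M' : Type*} [AddCommGroup M] [AddCommGroup M'] [Module.Finite ℤ M']
    (T : M →ₗ[ℤ] M') :
    ∃ e : ℤ, e ≠ 0 ∧ ∀ p : ℤ, IsCoprime e p → ∀ (m : M) (y : M'), T m = p • y →
      ∃ n x : M, T n = 0 ∧ m = n + p • x := by
  let Q := M' ⧸ LinearMap.range T
  have htors : Module.IsTorsion ℤ (Submodule.torsion ℤ Q) := Submodule.torsion_isTorsion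
  obtain ⟨e, he, he0⟩ := Submodule.annihilator_top_inter_nonZeroDivisors htors
  refine ⟨e, nonZeroDivisors.ne_zero he0, fun p hp m y hm => ?_⟩
  by_cases hp0 : p = 0
  · exact ⟨m, 0, by rw [hm, hp0, zero_smul], by simp⟩
  let y' : Q := (LinearMap.range T).mkQ y
  have h1 : p • y' = 0 := by
    change p • (LinearMap.range T).mkQ y = 0
    rw [← map_smul, ← hm, Submodule.mkQ_apply, Submodule.Quotient.mk_eq_zero]
    exact ⟨m, rfl⟩
  have h2 : y' ∈ Submodule.torsion ℤ Q := ⟨⟨p, mem_nonZeroDivisors_of_ne_zero hp0⟩, h1⟩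
  have h3 : e • (⟨y', h2⟩ : Submodule.torsion ℤ Q) = 0 :=
    Submodule.mem_annihilator.mp he _ Submodule.mem_top
  have h4 : e • y' = 0 := congrArg Subtype.val h3
  have h5 : e • y ∈ LinearMap.range T := by
    rw [← Submodule.Quotient.mk_eq_zero]
    exact h4
  obtain ⟨x, hx⟩ := h5
  obtain ⟨u, v, huv⟩ := hp
  refine ⟨u • (e • m - p • x), u • x + v • m, ?_, ?_⟩
  · rw [map_smul, map_sub, map_smul, map_smul, hx, hm, smul_comm e p y, sub_self, smul_zero]
  · have h6 : m = (u * e + v * p) • m := by rw [huv, one_smul]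
    conv_lhs => rw [h6]
    rw [add_smul, mul_smul, mul_smul, smul_sub, smul_add, smul_comm p u x, smul_comm p v m]
    abel

/-- A real `2 × 2` matrix that commutes with two matrices that do not commute is scalar. -/
theorem eq_scalar_of_commute {X A B : Matrix (Fin 2) (Fin 2) ℝ} (hA : X * A = A * X)
    (hB : X * B = B * X) (hAB : A * B ≠ B * A) : X 0 1 = 0 ∧ X 1 0 = 0 ∧ X 0 0 = X 1 1 := by
  have key : ∀ Y Z : Matrix (Fin 2) (Fin 2) ℝ, Y * Z = Z * Y ↔ Y 0 1 * Z 1 0 = Z 0 1 * Y 1 0 ∧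
      (Y 0 0 - Y 1 1) * Z 0 1 = Y 0 1 * (Z 0 0 - Z 1 1) ∧
      (Y 0 0 - Y 1 1) * Z 1 0 = Y 1 0 * (Z 0 0 - Z 1 1) := by
    intro Y Z
    rw [← Matrix.ext_iff]
    simp only [Fin.forall_fin_two, Matrix.mul_apply, Fin.sum_univ_two]
    constructor
    · rintro ⟨⟨h1, h2⟩, h3, h4⟩
      refine ⟨?_, ?_, ?_⟩ <;> linarith
    · rintro ⟨h1, h2, h3⟩
      refine ⟨⟨?_, ?_⟩, ?_, ?_⟩ <;> linarith
  rw [Ne, key] at hAB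
  obtain ⟨a1, a2, a3⟩ := (key X A).mp hA
  obtain ⟨b1, b2, b3⟩ := (key X B).mp hB
  have hcancel : ∀ x s t : ℝ, x ≠ 0 → x * s = x * t → s = t := fun x s t hx h =>
    mul_left_cancel₀ hx h
  refine ⟨?_, ?_, ?_⟩
  · by_contra h
    exact hAB ⟨hcancel _ _ _ h (by linear_combination A 0 1 * b1 - B 0 1 * a1),
      hcancel _ _ _ h (by linear_combination A 0 1 * b2 - B 0 1 * a2),
      hcancel _ _ _ h (by
        linear_combination A 0 1 * b3 - B 1 0 * a2 - (B 0 0 - B 1 1) * a1)⟩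
  · by_contra h
    exact hAB ⟨hcancel _ _ _ h (by linear_combination A 1 0 * b1 - B 1 0 * a1),
      hcancel _ _ _ h (by
        linear_combination A 1 0 * b2 - B 0 1 * a3 + (B 0 0 - B 1 1) * a1),
      hcancel _ _ _ h (by linear_combination A 1 0 * b3 - B 1 0 * a3)⟩
  · by_contra h'
    have h : X 0 0 - X 1 1 ≠ 0 := fun h0 => h' (by linarith)
    exact hAB ⟨hcancel _ _ _ h (by
        linear_combination B 1 0 * a2 - B 0 1 * a3 + (A 0 0 - A 1 1) * b1),
      hcancel _ _ _ h (by linear_combination (A 0 0 - A 1 1) * b2 - (B 0 0 - B 1 1) * a2),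
      hcancel _ _ _ h (by linear_combination (A 0 0 - A 1 1) * b3 - (B 0 0 - B 1 1) * a3)⟩

variable {D : Type*} [Ring D] [Algebra ℚ D]
  (φ : (ℝ ⊗[ℚ] D) ≃ₐ[ℝ] Matrix (Fin 2) (Fin 2) ℝ) {O : Subring D}

/-- The commutant of two elements of an order that do not commute consists of integers: a scalar
element has `trd² = 4 nrd`, so that its trace is even. -/
theorem eq_intCast_of_commute (φ : (ℝ ⊗[ℚ] D) ≃ₐ[ℝ] Matrix (Fin 2) (Fin 2) ℝ)
    (hO : IsOrder O) (hdim : Module.finrank ℚ D = 4) {x a b : O}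
    (ha : x * a = a * x) (hb : x * b = b * x) (hab : a * b ≠ b * a) : ∃ j : ℤ, x = j := by
  have hmul : ∀ u v : O, realRep φ ((u * v : O) : D) = realRep φ (u : D) * realRep φ (v : D) :=
    fun u v => by rw [Subring.coe_mul, map_mul]
  obtain ⟨h1, h2, h3⟩ := eq_scalar_of_commute (X := realRep φ (x : D)) (A := realRep φ (a : D))
    (B := realRep φ (b : D)) (by rw [← hmul, ha, hmul]) (by rw [← hmul, hb, hmul])
    (fun h => hab (realRep_ext φ (by rw [hmul, h, hmul])))
  have ht := cast_trd φ hO hdim x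
  have hn := cast_nrd φ hO hdim x
  rw [Matrix.trace_fin_two, h3] at ht
  rw [Matrix.det_fin_two, h1, h3] at hn
  have h4 : (trd φ x) ^ 2 = 4 * nrd φ x := by
    have : (trd φ x : ℝ) ^ 2 = 4 * nrd φ x := by rw [ht, hn]; ring
    exact_mod_cast this
  have h5 : (2 : ℤ) ∣ trd φ x :=
    Int.prime_two.dvd_of_dvd_pow (n := 2) ⟨2 * nrd φ x, by rw [h4]; ring⟩
  obtain ⟨j, hj⟩ := h5
  have h6 : realRep φ (x : D) 1 1 = j := by
    rw [hj] at ht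
    push_cast at ht
    linarith
  refine ⟨j, realRep_ext φ ?_⟩
  rw [realRep_intCast]
  ext i k
  fin_cases i <;> fin_cases k <;> simp [Matrix.intCast_apply, h1, h2, h3, h6]

theorem exists_primitive_factor
    (hO : IsOrder O) (hdim : Module.finrank ℚ D = 4) {n : O} (hn : nrd φ n ≠ 0) :
    ∃ (k : ℤ) (n₀ : O), n = k * n₀ ∧ IsPrimitive n₀ := by
  obtain ⟨N, hN⟩ : ∃ N, (nrd φ n).natAbs = N := ⟨_, rfl⟩
  induction N using Nat.strong_induction_on generalizing n with
  | _ N ih =>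
    by_cases hp : IsPrimitive n
    · exact ⟨1, n, by simp, hp⟩
    · rw [IsPrimitive] at hp
      push Not at hp
      obtain ⟨q, hq, n', rfl⟩ := hp
      have h1 : nrd φ (((q : ℤ) : O) * n') = (q : ℤ) ^ 2 * nrd φ n' := by
        rw [nrd_mul φ hO hdim, nrd_intCast φ hO hdim]
      have h2 : nrd φ n' ≠ 0 := fun h => hn (by rw [h1, h, mul_zero])
      have h3 : (nrd φ n').natAbs < N := by
        rw [← hN, h1, Int.natAbs_mul, Int.natAbs_pow, Int.natAbs_natCast]
        have := Int.natAbs_pos.mpr h2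
        have := Nat.pow_le_pow_left hq.two_le 2
        nlinarith
      obtain ⟨k, n₀, h4, h5⟩ := ih _ h3 h2 rfl
      exact ⟨q * k, n₀, by rw [h4]; push_cast; rw [mul_assoc], h5⟩

/-- Two elements that intertwine a non-commuting pair `a, a₁` with a pair `b, b₁` are proportional;
so the primitive one has the smaller reduced norm. -/
theorem natAbs_nrd_le_of_intertwine [Algebra.IsCentral ℚ D] [IsSimpleRing D]
    (hO : IsOrder O) (hdim : Module.finrank ℚ D = 4)
    (hnonsplit : IsEmpty (D ≃ₐ[ℚ] Matrix (Fin 2) (Fin 2) ℚ)) {a a₁ b b₁ n₀ n₁ : O}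
    (hcomm : a * a₁ ≠ a₁ * a) (h₀ : n₀ * a = b * n₀) (h₀' : n₀ * a₁ = b₁ * n₀)
    (h₁ : n₁ * a = b * n₁) (h₁' : n₁ * a₁ = b₁ * n₁) (hp : IsPrimitive n₀) (hn₁ : n₁ ≠ 0) :
    (nrd φ n₀).natAbs ≤ (nrd φ n₁).natAbs := by
  have hn₀ : n₀ ≠ 0 := fun h => hp 2 Nat.prime_two (by rw [h]; exact dvd_zero _)
  have hν := nrd_ne_zero φ hO hdim hnonsplit hn₀
  have hstep : ∀ s t : O, n₀ * s = t * n₀ → n₁ * s = t * n₁ →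
      (conj φ n₀ * n₁) * s = s * (conj φ n₀ * n₁) := by
    intro s t hs ht
    have h1 : conj φ n₀ * t = s * conj φ n₀ := by
      apply intCast_mul_cancel hν
      rw [(Int.cast_commute _ (conj φ n₀ * t)).eq, ← mul_conj φ hO hdim, ← mul_assoc,
        mul_assoc (conj φ n₀) t, ← hs, ← mul_assoc, conj_mul_self φ hO hdim,
        mul_conj φ hO hdim, mul_assoc]
    rw [mul_assoc, ht, ← mul_assoc, h1, mul_assoc]
  obtain ⟨j, hj⟩ := eq_intCast_of_commute φ hO hdim (hstep a b h₀ h₁) (hstep a₁ b₁ h₀' h₁') hcomm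
  have h2 : (nrd φ n₀ : O) * n₁ = j * n₀ := by
    rw [← mul_conj φ hO hdim, mul_assoc, hj, (Int.cast_commute j n₀).eq]
  set ν := nrd φ n₀ with hνdef
  obtain ⟨g, ν', j', hg, hco, hν', hj'⟩ : ∃ g ν' j' : ℤ, g ≠ 0 ∧ IsCoprime ν' j' ∧ ν = g * ν' ∧
      j = g * j' := by
    refine ⟨Int.gcd ν j, ν / Int.gcd ν j, j / Int.gcd ν j, ?_, ?_, ?_, ?_⟩
    · exact_mod_cast (Int.gcd_pos_of_ne_zero_left j hν).ne'
    · rw [Int.isCoprime_iff_gcd_eq_one]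
      exact Int.gcd_ediv_gcd_ediv_gcd (Int.gcd_pos_of_ne_zero_left j hν)
    · exact (Int.mul_ediv_cancel' (Int.gcd_dvd_left ν j)).symm
    · exact (Int.mul_ediv_cancel' (Int.gcd_dvd_right ν j)).symm
  have h3 : (ν' : O) * n₁ = j' * n₀ := by
    apply intCast_mul_cancel hg
    rw [← mul_assoc, ← mul_assoc, ← Int.cast_mul, ← Int.cast_mul, ← hν', ← hj', h2]
  have h4 : ν'.natAbs = 1 := by
    by_contra h
    obtain ⟨q, hq, hqd⟩ := Nat.exists_prime_and_dvd h
    have hqd' : (q : ℤ) ∣ ν' := Int.natCast_dvd.mpr hqd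
    obtain ⟨c, hc⟩ := hqd'
    refine hp q hq (intCast_dvd_of_dvd_mul (j := j') ?_ ?_)
    · rw [hc] at hco
      exact (IsCoprime.of_mul_left_left hco).symm
    · rw [← h3, hc]
      push_cast
      rw [mul_assoc]
      exact Dvd.intro _ rfl
  have h5 := congrArg (fun x => (nrd φ x).natAbs) h3
  simp only [nrd_mul φ hO hdim, nrd_intCast φ hO hdim, Int.natAbs_mul, Int.natAbs_pow, h4, one_pow,
    one_mul] at h5
  rw [h5]
  refine Nat.le_mul_of_pos_left _ (pow_pos (Int.natAbs_pos.mpr ?_) 2)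
  rintro rfl
  have h6 := nrd_ne_zero φ hO hdim hnonsplit hn₁
  rw [← Int.natAbs_ne_zero, h5] at h6
  simp at h6

/-- An element that intertwines two given pairs modulo a large prime is congruent to a multiple of
a primitive element that intertwines them exactly, and whose reduced norm is bounded in terms of
the pairs alone. -/
theorem exists_primitive_intertwiner [Algebra.IsCentral ℚ D] [IsSimpleRing D]
    (hO : IsOrder O) (hdim : Module.finrank ℚ D = 4)
    (hnonsplit : IsEmpty (D ≃ₐ[ℚ] Matrix (Fin 2) (Fin 2) ℚ)) (a a₁ b b₁ : O) :
    ∃ K : ℕ, ∀ p : ℕ, p.Prime → K ≤ p → ∀ m : O, ¬ ((p : ℤ) : O) ∣ m →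
      ((p : ℤ) : O) ∣ m * a - b * m → ((p : ℤ) : O) ∣ m * a₁ - b₁ * m →
      ∃ (n₀ : O) (k : ℤ), n₀ * a = b * n₀ ∧ n₀ * a₁ = b₁ * n₀ ∧ n₀ ≠ 0 ∧
        IsCoprime k (p : ℤ) ∧ ((p : ℤ) : O) ∣ m - k * n₀ ∧
        (a * a₁ ≠ a₁ * a → IsPrimitive n₀ ∧ (nrd φ n₀).natAbs < K) := by
  obtain ⟨_, _, -⟩ := finite_free_of_isOrder φ hO hdim
  let T : O →ₗ[ℤ] O × O := (LinearMap.mulRight ℤ a - LinearMap.mulLeft ℤ b).prod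
    (LinearMap.mulRight ℤ a₁ - LinearMap.mulLeft ℤ b₁)
  have hT : ∀ m, T m = (m * a - b * m, m * a₁ - b₁ * m) := fun m => rfl
  obtain ⟨e, he0, he⟩ := exists_ker_lift T
  obtain ⟨K₁, hK₁⟩ : ∃ K₁ : ℕ, a * a₁ ≠ a₁ * a → ∀ n₀ : O, IsPrimitive n₀ → T n₀ = 0 →
      (nrd φ n₀).natAbs < K₁ := by
    by_cases h : ∃ n₁ : O, n₁ ≠ 0 ∧ T n₁ = 0
    · obtain ⟨n₁, hn₁, hTn₁⟩ := h
      refine ⟨(nrd φ n₁).natAbs + 1, fun hcomm n₀ hp hTn₀ => Nat.lt_succ_of_le ?_⟩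
      rw [hT, Prod.mk_eq_zero, sub_eq_zero, sub_eq_zero] at hTn₀ hTn₁
      exact natAbs_nrd_le_of_intertwine φ hO hdim hnonsplit hcomm hTn₀.1 hTn₀.2 hTn₁.1 hTn₁.2
        hp hn₁
    · refine ⟨0, fun _ n₀ hp hTn₀ => absurd ⟨n₀, ?_, hTn₀⟩ h⟩
      rintro rfl
      exact hp 2 Nat.prime_two (dvd_zero _)
  refine ⟨max K₁ (e.natAbs + 1), fun p hp hKp m hm h1 h2 => ?_⟩
  have hpp : Prime (p : ℤ) := Nat.prime_iff_prime_int.mp hp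
  have hep : IsCoprime e (p : ℤ) := by
    refine ((Prime.coprime_iff_not_dvd hpp).mpr fun hd => ?_).symm
    have h3 := Nat.le_of_dvd (Int.natAbs_pos.mpr he0) (Int.natCast_dvd.mp hd)
    have h4 := (le_max_right K₁ _).trans hKp
    omega
  obtain ⟨y₁, hy₁⟩ := h1
  obtain ⟨y₂, hy₂⟩ := h2
  obtain ⟨n, x, hn, hmx⟩ := he p hep m (y₁, y₂) (by
    rw [hT, hy₁, hy₂, Prod.smul_mk, zsmul_eq_mul, zsmul_eq_mul])
  have hnp : ¬ ((p : ℤ) : O) ∣ n := by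
    intro h
    apply hm
    rw [hmx, zsmul_eq_mul]
    exact dvd_add h (Dvd.intro _ rfl)
  have hn0 : n ≠ 0 := by
    rintro rfl
    exact hnp (dvd_zero _)
  obtain ⟨k, n₀, hk, hprim⟩ :=
    exists_primitive_factor φ hO hdim (nrd_ne_zero φ hO hdim hnonsplit hn0)
  have hk0 : k ≠ 0 := by
    rintro rfl
    exact hn0 (by simpa using hk)
  have hTn₀ : T n₀ = 0 := by
    have h5 : k • T n₀ = 0 := by rw [← map_smul, zsmul_eq_mul, ← hk, hn]
    rw [hT, Prod.smul_mk, Prod.mk_eq_zero, zsmul_eq_mul, zsmul_eq_mul] at h5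
    rw [hT, Prod.mk_eq_zero]
    exact ⟨intCast_mul_cancel hk0 (by rw [h5.1, mul_zero]),
      intCast_mul_cancel hk0 (by rw [h5.2, mul_zero])⟩
  have hTn₀' := hTn₀
  rw [hT, Prod.mk_eq_zero, sub_eq_zero, sub_eq_zero] at hTn₀'
  refine ⟨n₀, k, hTn₀'.1, hTn₀'.2, ?_, ?_, ?_, fun hcomm => ⟨hprim, ?_⟩⟩
  · rintro rfl
    exact hn0 (by rw [hk, mul_zero])
  · refine ((Prime.coprime_iff_not_dvd hpp).mpr fun ⟨c, hc⟩ => hnp ?_).symm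
    rw [hk, hc]
    push_cast
    rw [mul_assoc]
    exact Dvd.intro _ rfl
  · rw [hmx, ← hk, add_sub_cancel_left, zsmul_eq_mul]
    exact Dvd.intro _ rfl
  · exact (hK₁ hcomm n₀ hprim hTn₀).trans_le (le_max_left _ _)

end Intertwiners

/-! ### Reduction theory for the unit group of an order -/

section Reduction

variable {D : Type*} [Ring D] [Algebra ℚ D]
  (φ : (ℝ ⊗[ℚ] D) ≃ₐ[ℝ] Matrix (Fin 2) (Fin 2) ℝ) {O : Subring D}

/-- Minkowski's theorem for `ℤ⁴` and the preimage of a cube under a linear map. -/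
theorem exists_int_vec_of_linearMap (f : (Fin 4 → ℝ) →ₗ[ℝ] (Fin 4 → ℝ)) {y : ℝ} (hy : y ≠ 0)
    (hf : LinearMap.det f = y ^ 2) :
    ∃ v : Fin 4 → ℤ, v ≠ 0 ∧ ∀ i, |f (fun j => (v j : ℝ)) i| ≤ 2 * √|y| := by
  have hy' : 0 < √|y| := Real.sqrt_pos.mpr (abs_pos.mpr hy)
  let b := Pi.basisFun ℝ (Fin 4)
  let L : AddSubgroup (Fin 4 → ℝ) := (Submodule.span ℤ (Set.range b)).toAddSubgroup
  have fund : MeasureTheory.IsAddFundamentalDomain L (ZSpan.fundamentalDomain b)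
      MeasureTheory.volume := ZSpan.isAddFundamentalDomain b _
  have : Countable L := inferInstanceAs (Countable (Submodule.span ℤ (Set.range b)))
  let s : Set (Fin 4 → ℝ) := f ⁻¹' Metric.ball 0 (2 * √|y|)
  have hvol : MeasureTheory.volume (ZSpan.fundamentalDomain b) = 1 := by
    rw [ZSpan.fundamentalDomain_pi_basisFun, MeasureTheory.volume_pi_pi]
    simp
  have hs : MeasureTheory.volume s = ENNReal.ofReal 256 := by
    have h1 := MeasureTheory.Measure.addHaar_preimage_linearMap
      (MeasureTheory.volume : MeasureTheory.Measure (Fin 4 → ℝ)) (f := f)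
      (by rw [hf]; exact pow_ne_zero 2 hy) (Metric.ball 0 (2 * √|y|))
    rw [hf, Real.volume_pi_ball _ (by positivity), ← ENNReal.ofReal_mul (abs_nonneg _)] at h1
    rw [h1]
    congr 1
    have h2 : √|y| ^ 4 = y ^ 2 := by
      rw [show √|y| ^ 4 = (√|y| ^ 2) ^ 2 by ring, Real.sq_sqrt (abs_nonneg y), sq_abs]
    rw [Fintype.card_fin, mul_pow, mul_pow, h2, abs_inv, abs_of_nonneg (sq_nonneg y)]
    field_simp
    norm_num
  obtain ⟨⟨x, hx⟩, hx0, hxs⟩ :=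
    MeasureTheory.exists_ne_zero_mem_lattice_of_measure_mul_two_pow_lt_measure (s := s) fund
    (fun x hx => by
      simp only [s, Set.mem_preimage, map_neg, mem_ball_zero_iff, norm_neg] at hx ⊢
      exact hx)
    ((convex_ball 0 _).linear_preimage f)
    (by
      rw [hvol, hs, Module.finrank_fin_fun, one_mul, show (2 : ℝ≥0∞) ^ 4 = ENNReal.ofReal 16 by
        norm_num]
      exact (ENNReal.ofReal_lt_ofReal_iff (by norm_num)).mpr (by norm_num))
  have hint := (b.mem_span_iff_repr_mem ℤ x).mp hx
  choose v hv using hint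
  have hxv : x = fun j => (v j : ℝ) := by
    funext j
    have := hv j
    simpa [b] using this.symm
  refine ⟨v, ?_, fun i => ?_⟩
  · rintro rfl
    apply hx0
    ext j
    simp [hxv]
  · rw [← hxv]
    have h1 : ‖f x‖ < 2 * √|y| := by simpa [s] using hxs
    exact (norm_le_pi_norm (f x) i).trans h1.le

theorem abs_mul_apply_le {X Y : Matrix (Fin 2) (Fin 2) ℝ} {C C' : ℝ} (hX : ∀ i j, |X i j| ≤ C)
    (hY : ∀ i j, |Y i j| ≤ C') (i j : Fin 2) : |(X * Y) i j| ≤ 2 * (C * C') := by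
  have hC : 0 ≤ C := (abs_nonneg _).trans (hX 0 0)
  rw [Matrix.mul_apply, Fin.sum_univ_two]
  refine (abs_add_le _ _).trans ?_
  rw [abs_mul, abs_mul, two_mul]
  exact add_le_add (mul_le_mul (hX _ _) (hY _ _) (abs_nonneg _) hC)
    (mul_le_mul (hX _ _) (hY _ _) (abs_nonneg _) hC)

theorem abs_det_le {X : Matrix (Fin 2) (Fin 2) ℝ} {C : ℝ} (hX : ∀ i j, |X i j| ≤ C) :
    |X.det| ≤ 2 * (C * C) := by
  have hC : 0 ≤ C := (abs_nonneg _).trans (hX 0 0)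
  rw [Matrix.det_fin_two]
  refine (abs_sub _ _).trans ?_
  rw [abs_mul, abs_mul, two_mul]
  exact add_le_add (mul_le_mul (hX _ _) (hX _ _) (abs_nonneg _) hC)
    (mul_le_mul (hX _ _) (hX _ _) (abs_nonneg _) hC)

/-- The matrix that carries `i` to `x + i y`. -/
def upperMat (x y : ℝ) : Matrix (Fin 2) (Fin 2) ℝ := !![y, x; 0, 1]

theorem det_upperMat (x y : ℝ) : (upperMat x y).det = y := by simp [upperMat]

/-- In the real matrices, the lattice `O * upperMat x y`, of covolume proportional to `y²`, contains
a non-zero element with entries of size `√|y|`. -/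
theorem exists_short_vector (hO : IsOrder O) (hdim : Module.finrank ℚ D = 4) :
    ∃ C : ℝ, ∀ x y : ℝ, y ≠ 0 → ∃ s : O, s ≠ 0 ∧
      ∀ i j, |(realRep φ (s : D) * upperMat x y) i j| ≤ C * √|y| := by
  obtain ⟨b, B, hB⟩ := exists_basis φ hO hdim
  refine ⟨∑ k, 2 * (|B k 0 0| + |B k 0 1| + |B k 1 0| + |B k 1 1|), fun x y hy => ?_⟩
  let m : Matrix (Fin 2) (Fin 2) ℝ →ₗ[ℝ] Matrix (Fin 2) (Fin 2) ℝ :=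
    LinearMap.mulRight ℝ (upperMat x y)
  let f : (Fin 4 → ℝ) →ₗ[ℝ] (Fin 4 → ℝ) :=
    (B.equivFun : Matrix (Fin 2) (Fin 2) ℝ →ₗ[ℝ] (Fin 4 → ℝ)) ∘ₗ m ∘ₗ
      (B.equivFun.symm : (Fin 4 → ℝ) →ₗ[ℝ] Matrix (Fin 2) (Fin 2) ℝ)
  have hf : LinearMap.det f = y ^ 2 := by
    rw [LinearMap.det_conj, det_mulRight_matrix, det_upperMat]
  obtain ⟨v, hv0, hv⟩ := exists_int_vec_of_linearMap f hy hf
  have hsum : realRep φ ((∑ k, v k • b k : O) : D) = B.equivFun.symm (fun j => (v j : ℝ)) := by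
    rw [AddSubmonoidClass.coe_finsetSum, map_sum, Module.Basis.equivFun_symm_apply]
    refine Finset.sum_congr rfl fun k _ => ?_
    rw [hB, Int.cast_smul_eq_zsmul, ← map_zsmul (realRep φ)]
    rfl
  refine ⟨∑ k, v k • b k, ?_, fun i j => ?_⟩
  · intro h
    apply hv0
    funext k
    exact (Fintype.linearIndependent_iff.mp b.linearIndependent) v h k
  · rw [hsum]
    set X := B.equivFun.symm (fun j => (v j : ℝ)) * upperMat x y
    have hX : X = ∑ k, f (fun j => (v j : ℝ)) k • B k := by
      rw [← Module.Basis.equivFun_symm_apply]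
      change X = B.equivFun.symm (B.equivFun (m (B.equivFun.symm fun j => (v j : ℝ))))
      rw [LinearEquiv.symm_apply_apply]
      rfl
    rw [hX, Matrix.sum_apply, Finset.sum_mul]
    refine (Finset.abs_sum_le_sum_abs _ _).trans (Finset.sum_le_sum fun k _ => ?_)
    rw [Matrix.smul_apply, smul_eq_mul, abs_mul]
    have hBk : |B k i j| ≤ |B k 0 0| + |B k 0 1| + |B k 1 0| + |B k 1 1| := by
      have := abs_nonneg (B k 0 0)
      have := abs_nonneg (B k 0 1)
      have := abs_nonneg (B k 1 0)
      have := abs_nonneg (B k 1 1)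
      fin_cases i <;> fin_cases j <;> simp <;> linarith
    calc |f (fun j => (v j : ℝ)) k| * |B k i j|
        ≤ (2 * √|y|) * (|B k 0 0| + |B k 0 1| + |B k 1 0| + |B k 1 1|) :=
          mul_le_mul (hv k) hBk (abs_nonneg _) (by positivity)
      _ = 2 * (|B k 0 0| + |B k 0 1| + |B k 1 0| + |B k 1 1|) * √|y| := by ring

/-- Up to units on the right, there are finitely many elements of bounded reduced norm: elements of
equal reduced norm `N` that are congruent modulo `N` differ by a unit. -/
theorem exists_finite_reps [Algebra.IsCentral ℚ D] [IsSimpleRing D]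
    (hO : IsOrder O) (hdim : Module.finrank ℚ D = 4)
    (hnonsplit : IsEmpty (D ≃ₐ[ℚ] Matrix (Fin 2) (Fin 2) ℚ)) (K : ℤ) :
    ∃ S : Set O, S.Finite ∧ ∀ s : O, s ≠ 0 → |nrd φ s| ≤ K →
      ∃ s₀ ∈ S, s₀ ≠ 0 ∧ ∃ γ γ' : O, γ * γ' = 1 ∧ γ' * γ = 1 ∧ s = s₀ * γ := by
  obtain ⟨b, -⟩ := exists_basis φ hO hdim
  let κ : O → ℤ × (Fin 4 → ℤ) := fun s => (nrd φ s, fun i => b.repr s i % nrd φ s)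
  let T : Set O := {s | s ≠ 0 ∧ |nrd φ s| ≤ K}
  obtain ⟨S, hST, hS⟩ := Set.exists_subset_bijOn T κ
  have hfin : (κ '' T).Finite := by
    refine ((Set.finite_Icc (-K) K).prod
      (Set.finite_Icc (fun _ => 0) (fun _ : Fin 4 => K))).subset ?_
    rintro _ ⟨s, ⟨hs0, hsK⟩, rfl⟩
    have hN := nrd_ne_zero φ hO hdim hnonsplit hs0
    exact ⟨abs_le.mp hsK, fun i => Int.emod_nonneg _ hN,
      fun i => (Int.emod_lt_abs _ hN).le.trans hsK⟩
  refine ⟨S, Set.Finite.of_finite_image (hS.image_eq.symm ▸ hfin) hS.injOn, fun s hs0 hsK => ?_⟩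
  obtain ⟨s₀, hs₀, hκ⟩ := hS.surjOn ⟨s, ⟨hs0, hsK⟩, rfl⟩
  have hs₀0 : s₀ ≠ 0 := (hST hs₀).1
  have h1 : nrd φ s₀ = nrd φ s := congrArg Prod.fst hκ
  have h2 : ∀ i, b.repr s₀ i % nrd φ s₀ = b.repr s i % nrd φ s := congrFun (congrArg Prod.snd hκ)
  obtain ⟨e, he⟩ : ∃ e : O, s = s₀ + (nrd φ s : O) * e := by
    have h3 : ∀ i, ∃ c : ℤ, b.repr s i - b.repr s₀ i = nrd φ s * c := fun i => by
      have := h2 i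
      rw [h1] at this
      exact Int.ModEq.dvd this
    choose c hc using h3
    refine ⟨∑ i, c i • b i, ?_⟩
    apply b.repr.injective
    ext i
    rw [← zsmul_eq_mul]
    have h4 : b.repr (∑ i, c i • b i) i = c i := by
      rw [b.repr_sum_self]
    rw [map_add, map_smul, Finsupp.add_apply, Finsupp.smul_apply, h4, smul_eq_mul, ← hc i]
    ring
  have hN := nrd_ne_zero φ hO hdim hnonsplit hs0
  have hcancel : ∀ t u : O, t ≠ 0 → t * u = t → u = 1 := fun t u ht h => by
    have h5 := congrArg (conj φ t * ·) h
    simp only [← mul_assoc, conj_mul_self φ hO hdim] at h5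
    exact intCast_mul_cancel (nrd_ne_zero φ hO hdim hnonsplit ht) (by rw [h5, mul_one])
  have h6 : s = s₀ * (1 + conj φ s₀ * e) := by
    rw [mul_add, mul_one, ← mul_assoc, mul_conj φ hO hdim, h1, ← he]
  have h7 : s₀ = s * (1 - conj φ s * e) := by
    rw [mul_sub, mul_one, ← mul_assoc, mul_conj φ hO hdim]
    exact eq_sub_of_add_eq he.symm
  refine ⟨s₀, hs₀, hs₀0, _, 1 - conj φ s * e, ?_, ?_, h6⟩
  · exact hcancel s₀ _ hs₀0 (by rw [← mul_assoc, ← h6, ← h7])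
  · exact hcancel s _ hs0 (by rw [← mul_assoc, ← h7, ← h6])

/-- The unit group of an order in a quaternion division algebra acts cocompactly on `ℂ ∖ ℝ`: for
each `x + i y` there is a unit `γ` such that `γ * upperMat x y`, scaled to determinant `± 1`, lies in
a fixed compact set of matrices. -/
theorem exists_unit_bounded [Algebra.IsCentral ℚ D] [IsSimpleRing D]
    (hO : IsOrder O) (hdim : Module.finrank ℚ D = 4)
    (hnonsplit : IsEmpty (D ≃ₐ[ℚ] Matrix (Fin 2) (Fin 2) ℚ)) :
    ∃ C : ℝ, ∀ x y : ℝ, y ≠ 0 → ∃ γ γ' : O, γ * γ' = 1 ∧ γ' * γ = 1 ∧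
      ∀ i j, |(realRep φ (γ : D) * upperMat x y) i j| ≤ C * √|y| := by
  obtain ⟨C, hC⟩ := exists_short_vector φ hO hdim
  obtain ⟨S, hSfin, hS⟩ := exists_finite_reps φ hO hdim hnonsplit ⌈2 * (C * C)⌉
  obtain ⟨C', hC'⟩ : ∃ C' : ℝ, ∀ s ∈ S, ∀ i j, |realRep φ (conj φ s : D) i j| ≤ C' := by
    let F : O → ℝ := fun s => ∑ i, ∑ j, |realRep φ (conj φ s : D) i j|
    obtain ⟨C', hC'⟩ := (hSfin.image F).bddAbove
    refine ⟨C', fun s hs i j => le_trans ?_ (hC' ⟨s, hs, rfl⟩)⟩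
    refine le_trans ?_ (Finset.single_le_sum (f := fun i => ∑ j, |realRep φ (conj φ s : D) i j|)
      (fun _ _ => Finset.sum_nonneg fun _ _ => abs_nonneg _) (Finset.mem_univ i))
    exact Finset.single_le_sum (f := fun j => |realRep φ (conj φ s : D) i j|)
      (fun _ _ => abs_nonneg _) (Finset.mem_univ j)
  refine ⟨2 * (C' * C), fun x y hy => ?_⟩
  obtain ⟨s, hs0, hs⟩ := hC x y hy
  have hnrd : |nrd φ s| ≤ ⌈2 * (C * C)⌉ := by
    have h1 := abs_det_le hs
    rw [Matrix.det_mul, det_upperMat, ← cast_nrd φ hO hdim, abs_mul] at h1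
    have h2 : 2 * (C * √|y| * (C * √|y|)) = 2 * (C * C) * |y| := by
      rw [show 2 * (C * √|y| * (C * √|y|)) = 2 * (C * C) * (√|y| * √|y|) by ring,
        Real.mul_self_sqrt (abs_nonneg y)]
    rw [h2] at h1
    have h3 := le_of_mul_le_mul_right h1 (abs_pos.mpr hy)
    have h4 := h3.trans (Int.le_ceil _)
    exact_mod_cast h4
  obtain ⟨s₀, hs₀, hs₀0, γ, γ', h1, h2, h3⟩ := hS s hs0 hnrd
  refine ⟨γ, γ', h1, h2, fun i j => ?_⟩
  have hN : (1 : ℝ) ≤ |(nrd φ s₀ : ℝ)| := by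
    have := Int.one_le_abs (nrd_ne_zero φ hO hdim hnonsplit hs₀0)
    exact_mod_cast this
  have h4 : (nrd φ s₀ : ℝ) • (realRep φ (γ : D) * upperMat x y) =
      realRep φ (conj φ s₀ : D) * (realRep φ (s : D) * upperMat x y) := by
    rw [← mul_assoc, ← map_mul, ← Subring.coe_mul, h3, ← mul_assoc, conj_mul_self φ hO hdim,
      Subring.coe_mul, map_mul, realRep_intCast, ← Matrix.smul_mul]
    congr 1
    rw [← zsmul_eq_mul, Int.cast_smul_eq_zsmul]
  have h5 := abs_mul_apply_le (hC' s₀ hs₀) hs i j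
  rw [← h4, Matrix.smul_apply, smul_eq_mul, abs_mul] at h5
  have h6 : |(realRep φ (γ : D) * upperMat x y) i j| ≤
      |(nrd φ s₀ : ℝ)| * |(realRep φ (γ : D) * upperMat x y) i j| :=
    le_mul_of_one_le_left (abs_nonneg _) hN
  calc _ ≤ _ := h6.trans h5
    _ = _ := by ring

/-- An order is a lattice in the real matrices. -/
theorem finite_setOf_abs_le (hO : IsOrder O) (hdim : Module.finrank ℚ D = 4) (C : ℝ) :
    {a : O | ∀ i j, |realRep φ (a : D) i j| ≤ C}.Finite := by
  obtain ⟨b, B, hB⟩ := exists_basis φ hO hdim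
  have hrepr : ∀ (a : O) k, B.repr (realRep φ (a : D)) k = (b.repr a k : ℝ) := by
    intro a k
    have h1 : realRep φ (a : D) = ∑ k, (b.repr a k : ℝ) • B k := by
      conv_lhs => rw [← b.sum_repr a]
      rw [AddSubmonoidClass.coe_finsetSum, map_sum]
      refine Finset.sum_congr rfl fun k _ => ?_
      rw [hB, Int.cast_smul_eq_zsmul, ← map_zsmul (realRep φ)]
      rfl
    rw [h1]
    simp [Finsupp.single_apply]
  let M : ℤ := ⌈∑ k, ∑ i, ∑ j, |C| * |B.repr (Matrix.single i j 1) k|⌉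
  refine Set.Finite.of_finite_image (f := fun a => (fun k => b.repr a k : Fin 4 → ℤ))
    ((Set.finite_Icc (fun _ => -M) (fun _ => M)).subset ?_) ?_
  · rintro _ ⟨a, ha, rfl⟩
    have hk : ∀ k, |b.repr a k| ≤ M := by
      intro k
      have h2 : |(b.repr a k : ℝ)| ≤ ∑ k, ∑ i, ∑ j, |C| * |B.repr (Matrix.single i j 1) k| := by
        refine le_trans ?_ (Finset.single_le_sum
          (f := fun k => ∑ i, ∑ j, |C| * |B.repr (Matrix.single i j (1 : ℝ)) k|)
          (fun _ _ => Finset.sum_nonneg fun _ _ => Finset.sum_nonneg fun _ _ => by positivity)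
          (Finset.mem_univ k))
        rw [← hrepr]
        conv_lhs => rw [Matrix.matrix_eq_sum_single (realRep φ (a : D))]
        simp only [map_sum, Finsupp.finsetSum_apply]
        refine (Finset.abs_sum_le_sum_abs _ _).trans (Finset.sum_le_sum fun i _ => ?_)
        refine (Finset.abs_sum_le_sum_abs _ _).trans (Finset.sum_le_sum fun j _ => ?_)
        have h3 : Matrix.single i j (realRep φ (a : D) i j) =
            realRep φ (a : D) i j • Matrix.single i j (1 : ℝ) := by
          rw [Matrix.smul_single, smul_eq_mul, mul_one]
        rw [h3, map_smul, Finsupp.smul_apply, smul_eq_mul, abs_mul]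
        exact mul_le_mul_of_nonneg_right ((ha i j).trans (le_abs_self C)) (abs_nonneg _)
      have h4 := h2.trans (Int.le_ceil _)
      exact_mod_cast h4
    exact ⟨fun k => (abs_le.mp (hk k)).1, fun k => (abs_le.mp (hk k)).2⟩
  · intro a _ a' _ h
    apply b.repr.injective
    ext k
    exact congrFun h k

end Reduction

/-! ### Real matrices and points of `ℂ ∖ ℝ` -/

section ComplexStructure

/-- The real matrix with eigenvector `(z, 1)` of eigenvalue `i`, for non-real `z`. -/
def complexStructure (z : ℂ) : Matrix (Fin 2) (Fin 2) ℝ :=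
  !![z.re / z.im, -(z.re ^ 2 + z.im ^ 2) / z.im; 1 / z.im, -z.re / z.im]

theorem map_mulVec (X : Matrix (Fin 2) (Fin 2) ℝ) (α β : ℂ) :
    (X.map Complex.ofReal).mulVec ![α, β] =
      ![X 0 0 * α + X 0 1 * β, X 1 0 * α + X 1 1 * β] := by
  ext i
  fin_cases i <;> simp [Matrix.mulVec, dotProduct, Fin.sum_univ_two]

/-- A real matrix is determined by its value at `(z, 1)` for a non-real `z`. -/
theorem eq_of_mulVec_eq {X Y : Matrix (Fin 2) (Fin 2) ℝ} {z : ℂ} (hz : z.im ≠ 0)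
    (h : (X.map Complex.ofReal).mulVec ![z, 1] = (Y.map Complex.ofReal).mulVec ![z, 1]) :
    X = Y := by
  rw [map_mulVec, map_mulVec] at h
  have h0 := congrFun h 0
  have h1 := congrFun h 1
  simp only [Matrix.cons_val_zero, Matrix.cons_val_one, mul_one, Complex.ext_iff, Complex.add_re,
    Complex.add_im, Complex.re_ofReal_mul, Complex.im_ofReal_mul, Complex.ofReal_re,
    Complex.ofReal_im, add_zero] at h0 h1
  have e00 := mul_right_cancel₀ hz h0.2
  have e10 := mul_right_cancel₀ hz h1.2
  have e01 : X 0 1 = Y 0 1 := by have := h0.1; rw [e00] at this; linarith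
  have e11 : X 1 1 = Y 1 1 := by have := h1.1; rw [e10] at this; linarith
  ext i j
  fin_cases i <;> fin_cases j <;> assumption

theorem complexStructure_mulVec {z : ℂ} (hz : z.im ≠ 0) :
    ((complexStructure z).map Complex.ofReal).mulVec ![z, 1] = Complex.I • ![z, 1] := by
  rw [map_mulVec]
  ext i
  fin_cases i
  · apply Complex.ext <;> simp [complexStructure, sq] <;> field_simp <;> ring
  · apply Complex.ext <;> simp [complexStructure] <;> field_simp <;> ring

/-- A real matrix that fixes the non-real point `z` is determined by its eigenvalue. -/
theorem eq_of_eigenvector {X : Matrix (Fin 2) (Fin 2) ℝ} {z c : ℂ} (hz : z.im ≠ 0)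
    (h : (X.map Complex.ofReal).mulVec ![z, 1] = c • ![z, 1]) :
    X = c.re • (1 : Matrix (Fin 2) (Fin 2) ℝ) + c.im • complexStructure z := by
  apply eq_of_mulVec_eq hz
  have h1 : ((c.re • (1 : Matrix (Fin 2) (Fin 2) ℝ) + c.im • complexStructure z).map
      Complex.ofReal) = (c.re : ℂ) • (1 : Matrix (Fin 2) (Fin 2) ℂ) +
        (c.im : ℂ) • (complexStructure z).map Complex.ofReal := by
    ext i j
    by_cases hij : i = j <;> simp [hij]
  rw [h, h1, Matrix.add_mulVec, Matrix.smul_mulVec, Matrix.smul_mulVec, Matrix.one_mulVec,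
    complexStructure_mulVec hz, smul_smul, ← add_smul, Complex.re_add_im]

theorem det_of_eigenvector {X : Matrix (Fin 2) (Fin 2) ℝ} {z c : ℂ} (hz : z.im ≠ 0)
    (h : (X.map Complex.ofReal).mulVec ![z, 1] = c • ![z, 1]) :
    X.det = c.re ^ 2 + c.im ^ 2 := by
  rw [eq_of_eigenvector hz h, Matrix.det_fin_two]
  simp [complexStructure]
  field_simp
  ring

/-- The eigenspaces of a real matrix with a non-real eigenvalue are lines. -/
theorem eq_mul_of_eigenvector {X : Matrix (Fin 2) (Fin 2) ℝ} {w c α β : ℂ} (hw : w.im ≠ 0)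
    (hc : c.im ≠ 0) (h : (X.map Complex.ofReal).mulVec ![w, 1] = c • ![w, 1])
    (h' : (X.map Complex.ofReal).mulVec ![α, β] = c • ![α, β]) : ![α, β] = β • ![w, 1] := by
  have hX := eq_of_eigenvector hw h
  have h1 := congrFun h 1
  have h2 := congrFun h' 1
  rw [map_mulVec] at h1 h2
  simp only [Matrix.cons_val_one, Matrix.cons_val_fin_one, Pi.smul_apply, smul_eq_mul,
    mul_one] at h1 h2
  have h10 : ((X 1 0 : ℝ) : ℂ) ≠ 0 := by
    rw [hX]
    simp [complexStructure, hc, hw]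
  have h3 : α = β * w := by
    apply mul_left_cancel₀ h10
    linear_combination h2 - β * h1
  ext i
  fin_cases i <;> simp [h3]

/-- Commuting real matrices that fix points of the same half plane, and are not scalar, fix the same
point. -/
theorem eq_of_commute {X Y : Matrix (Fin 2) (Fin 2) ℝ} {z w c d : ℂ} (hzw : 0 < z.im * w.im)
    (hc : c.im ≠ 0) (hd : d.im ≠ 0)
    (hX : (X.map Complex.ofReal).mulVec ![z, 1] = c • ![z, 1])
    (hY : (Y.map Complex.ofReal).mulVec ![w, 1] = d • ![w, 1]) (h : X * Y = Y * X) : z = w := by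
  have hz : z.im ≠ 0 := fun h => by simp [h] at hzw
  have hw : w.im ≠ 0 := fun h => by simp [h] at hzw
  have h1 : complexStructure z * complexStructure w =
      complexStructure w * complexStructure z := by
    rw [eq_of_eigenvector hz hX, eq_of_eigenvector hw hY] at h
    have h2 : (c.im * d.im) • (complexStructure z * complexStructure w) =
        (c.im * d.im) • (complexStructure w * complexStructure z) := by
      simp only [Matrix.add_mul, Matrix.mul_add, Matrix.smul_mul, Matrix.mul_smul, Matrix.one_mul,
        Matrix.mul_one, smul_add, smul_smul] at h ⊢
      have h3 : d.re * c.re = c.re * d.re := mul_comm _ _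
      have h4 : d.im * c.re = c.re * d.im := mul_comm _ _
      have h5 : d.re * c.im = c.im * d.re := mul_comm _ _
      have h6 : d.im * c.im = c.im * d.im := mul_comm _ _
      rw [h3, h4, h5, h6] at h
      ext i j
      have := congrFun (congrFun h i) j
      simp only [Matrix.add_apply] at this
      linarith
    exact smul_right_injective _ (mul_ne_zero hc hd) h2
  have e1 := congrFun (congrFun h1 0) 0
  have e2 := congrFun (congrFun h1 1) 0
  simp [complexStructure, Matrix.mul_apply, Fin.sum_univ_two] at e1 e2
  field_simp at e1 e2
  have e3 : z.re = w.re := by linarith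
  have e4 : (z.im - w.im) * (z.im + w.im) = 0 := by rw [e3] at e1; linarith
  have e5 : z.im + w.im ≠ 0 := by
    intro h
    have : w.im = - z.im := by linarith
    rw [this] at hzw
    nlinarith [sq_nonneg z.im]
  exact Complex.ext e3 (by have := (mul_eq_zero.mp e4).resolve_right e5; linarith)

/-- The hyperbolic cosine of the distance, for two points in the same component; see
`cosh_dist_toUpper`. -/
def coshDist (z w : ℂ) : ℝ := ((z.re - w.re) ^ 2 + z.im ^ 2 + w.im ^ 2) / (2 * (z.im * w.im))

/-- The distance of two points in terms of their complex structures, which makes its invariance under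
Möbius transformations plain. -/
theorem trace_complexStructure {z w : ℂ} (hz : z.im ≠ 0) (hw : w.im ≠ 0) :
    (complexStructure z * complexStructure w).trace = -2 * coshDist z w := by
  rw [Matrix.trace_fin_two, coshDist]
  simp [complexStructure, Matrix.mul_apply, Fin.sum_univ_two]
  field_simp
  ring

theorem cosh_dist_toUpper {z w : DoubleHalfPlane} (h : 0 < z.1.im * w.1.im) :
    Real.cosh (dist z.toUpper w.toUpper) = coshDist z.1 w.1 := by
  have h1 : |z.1.im| * |w.1.im| = z.1.im * w.1.im := by rw [← abs_mul, abs_of_pos h]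
  have hz : z.1.im ≠ 0 := z.2
  have hw : w.1.im ≠ 0 := w.2
  have e1 : z.toUpper.im = |z.1.im| := rfl
  have e2 : w.toUpper.im = |w.1.im| := rfl
  have e3 : z.toUpper.re = z.1.re := rfl
  have e4 : w.toUpper.re = w.1.re := rfl
  rw [UpperHalfPlane.cosh_dist', e1, e2, e3, e4, coshDist, sq_abs, sq_abs, mul_assoc, h1]

/-- A real matrix that carries `z` to `z₂` as a Möbius transformation intertwines the complex
structures. -/
theorem complexStructure_mul {X : Matrix (Fin 2) (Fin 2) ℝ} {z z₂ j : ℂ} (hz : z.im ≠ 0)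
    (hz₂ : z₂.im ≠ 0) (h : (X.map Complex.ofReal).mulVec ![z, 1] = j • ![z₂, 1]) :
    complexStructure z₂ * X = X * complexStructure z := by
  have hmap : ∀ A B : Matrix (Fin 2) (Fin 2) ℝ,
      (A * B).map Complex.ofReal = A.map Complex.ofReal * B.map Complex.ofReal := fun A B =>
    Matrix.map_mul (f := Complex.ofRealHom)
  apply eq_of_mulVec_eq hz
  rw [hmap, hmap, ← Matrix.mulVec_mulVec, ← Matrix.mulVec_mulVec, h, complexStructure_mulVec hz,
    Matrix.mulVec_smul, complexStructure_mulVec hz₂, Matrix.mulVec_smul, h, smul_comm]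

theorem coshDist_mobius {X : Matrix (Fin 2) (Fin 2) ℝ} (hX : X.det ≠ 0) {z z₂ j w w₂ i : ℂ}
    (hz : z.im ≠ 0) (hz₂ : z₂.im ≠ 0) (hw : w.im ≠ 0) (hw₂ : w₂.im ≠ 0)
    (h : (X.map Complex.ofReal).mulVec ![z, 1] = j • ![z₂, 1])
    (h' : (X.map Complex.ofReal).mulVec ![w, 1] = i • ![w₂, 1]) :
    coshDist z₂ w₂ = coshDist z w := by
  have h1 := complexStructure_mul hz hz₂ h
  have h2 := complexStructure_mul hw hw₂ h'
  have hu : IsUnit X.det := hX.isUnit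
  have h3 : complexStructure z₂ * complexStructure w₂ =
      X * (complexStructure z * complexStructure w) * X⁻¹ := by
    rw [← mul_assoc, ← h1, mul_assoc _ X, ← h2, ← mul_assoc,
      Matrix.mul_nonsing_inv_cancel_right _ _ hu]
  have h4 := congrArg Matrix.trace h3
  rw [Matrix.trace_mul_cycle, Matrix.nonsing_inv_mul _ hu, one_mul,
    trace_complexStructure hz hw, trace_complexStructure hz₂ hw₂] at h4
  linarith

/-- The Möbius action on `ℂ ∖ ℝ`: an invertible real matrix carries `(z, 1)` to a multiple of
some `(z₂, 1)`. -/
theorem exists_mobius {X : Matrix (Fin 2) (Fin 2) ℝ} (hX : X.det ≠ 0) {z : ℂ} (hz : z.im ≠ 0) :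
    ∃ z₂ j : ℂ, z₂.im ≠ 0 ∧ j ≠ 0 ∧ (X.map Complex.ofReal).mulVec ![z, 1] = j • ![z₂, 1] := by
  rw [map_mulVec]
  rw [Matrix.det_fin_two] at hX
  set β : ℂ := X 1 0 * z + X 1 1 * 1 with hβ
  set α : ℂ := X 0 0 * z + X 0 1 * 1 with hα
  have hβ0 : β ≠ 0 := by
    intro h
    rw [hβ, Complex.ext_iff] at h
    simp at h
    have h10 : X 1 0 = 0 := h.2.resolve_right hz
    have h11 : X 1 1 = 0 := by simpa [h10] using h.1
    exact hX (by rw [h10, h11]; ring)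
  refine ⟨α / β, β, ?_, hβ0, ?_⟩
  · have h1 : (α / β).im * Complex.normSq β =
        (X 0 0 * X 1 1 - X 0 1 * X 1 0) * z.im := by
      have hn : Complex.normSq β ≠ 0 := by simpa using hβ0
      rw [Complex.div_im]
      field_simp
      simp [hα, hβ]
      ring
    intro h
    rw [h, zero_mul] at h1
    exact (mul_ne_zero hX hz) h1.symm
  · ext i
    fin_cases i
    · simp [mul_div_cancel₀, hβ0]
    · simp

theorem im_mul_normSq_of_mobius {X : Matrix (Fin 2) (Fin 2) ℝ} {z z₂ j : ℂ}
    (h : (X.map Complex.ofReal).mulVec ![z, 1] = j • ![z₂, 1]) :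
    z₂.im * Complex.normSq j = X.det * z.im := by
  rw [map_mulVec] at h
  have h0 := congrFun h 0
  have h1 := congrFun h 1
  simp at h0 h1
  have hz : z₂.im * Complex.normSq j = ((j * z₂) * (starRingEnd ℂ) j).im := by
    rw [mul_right_comm, Complex.mul_conj, Complex.im_ofReal_mul, mul_comm]
  rw [hz, ← h0, ← h1, Matrix.det_fin_two]
  simp
  ring

/-- In the coordinates of the matrix that carries `i` to `z`, a matrix that fixes a point near `z`
with an eigenvalue of absolute value one has bounded entries. -/
theorem exists_bounded_conj {X : Matrix (Fin 2) (Fin 2) ℝ} {z w c : ℂ} {C : ℝ}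
    (hzw : 0 < z.im * w.im) (hC : coshDist z w ≤ C) (hc : c.re ^ 2 + c.im ^ 2 = 1)
    (h : (X.map Complex.ofReal).mulVec ![w, 1] = c • ![w, 1]) :
    ∃ E : Matrix (Fin 2) (Fin 2) ℝ, X * upperMat z.re z.im = upperMat z.re z.im * E ∧
      ∀ i j, |E i j| ≤ 1 + 2 * C := by
  have hz : z.im ≠ 0 := fun h => by simp [h] at hzw
  have hw : w.im ≠ 0 := fun h => by simp [h] at hzw
  -- `t` is the point `w` in the coordinates in which `z` becomes `i`
  set t : ℂ := ⟨(w.re - z.re) / z.im, w.im / z.im⟩ with ht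
  have htp : 0 < t.im := by
    have : t.im = (z.im * w.im) / z.im ^ 2 := by simp only [ht]; field_simp
    rw [this]
    positivity
  have htC : (t.re ^ 2 + t.im ^ 2 + 1) / t.im ≤ 2 * C := by
    have : (t.re ^ 2 + t.im ^ 2 + 1) / t.im = 2 * coshDist z w := by
      simp only [ht, coshDist]
      field_simp
      ring
    rw [this]
    linarith
  refine ⟨c.re • (1 : Matrix (Fin 2) (Fin 2) ℝ) + c.im • complexStructure t, ?_, ?_⟩
  · rw [eq_of_eigenvector hw h, Matrix.add_mul, Matrix.mul_add, Matrix.smul_mul, Matrix.smul_mul,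
      Matrix.mul_smul, Matrix.mul_smul, Matrix.one_mul, Matrix.mul_one]
    congr 2
    ext i j
    fin_cases i <;> fin_cases j <;>
      simp [complexStructure, upperMat, Matrix.mul_apply, Fin.sum_univ_two, ht] <;> field_simp <;>
      ring
  · have hcre : |c.re| ≤ 1 := abs_le_one_iff_mul_self_le_one.mpr (by nlinarith [sq_nonneg c.im])
    have hcim : |c.im| ≤ 1 := abs_le_one_iff_mul_self_le_one.mpr (by nlinarith [sq_nonneg c.re])
    have hdiv : ∀ s : ℝ, |s| ≤ t.re ^ 2 + t.im ^ 2 + 1 → |s / t.im| ≤ 2 * C := by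
      intro s hs
      rw [abs_div, abs_of_pos htp]
      exact (div_le_div_of_nonneg_right hs htp.le).trans htC
    have hre : |t.re| ≤ t.re ^ 2 + t.im ^ 2 + 1 := by
      rw [abs_le]
      constructor <;> nlinarith [sq_nonneg (t.re + 1), sq_nonneg (t.re - 1), sq_nonneg t.im]
    have hJ : ∀ i j, |complexStructure t i j| ≤ 2 * C := by
      intro i j
      fin_cases i <;> fin_cases j
      · exact hdiv _ hre
      · refine hdiv _ ?_
        rw [abs_neg, abs_of_nonneg (by positivity)]
        linarith
      · refine hdiv _ ?_
        rw [abs_one]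
        nlinarith [sq_nonneg t.re, sq_nonneg t.im]
      · exact hdiv _ (by rwa [abs_neg])
    intro i j
    rw [Matrix.add_apply, Matrix.smul_apply, Matrix.smul_apply, smul_eq_mul, smul_eq_mul]
    refine (abs_add_le _ _).trans (add_le_add ?_ ?_)
    · rw [abs_mul]
      refine mul_le_one₀ hcre (abs_nonneg _) ?_
      by_cases hij : i = j <;> simp [hij, Matrix.one_apply]
    · rw [abs_mul]
      calc |c.im| * |complexStructure t i j| ≤ 1 * (2 * C) :=
            mul_le_mul hcim (hJ i j) (abs_nonneg _) zero_le_one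
        _ = 2 * C := one_mul _

end ComplexStructure

/-! ### Uniformized surfaces -/

section Models

variable {D : Type*} [Ring D] [Algebra ℚ D]
  {φ : (ℝ ⊗[ℚ] D) ≃ₐ[ℝ] Matrix (Fin 2) (Fin 2) ℝ} {O : Subring D} {N : ℕ}

theorem complexRep_mul (a b : O) : complexRep φ (a * b) = complexRep φ a * complexRep φ b := by
  rw [complexRep_eq, complexRep_eq, complexRep_eq, Subring.coe_mul, map_mul]
  exact Matrix.map_mul (f := Complex.ofRealHom)

theorem complexRep_add (a b : O) : complexRep φ (a + b) = complexRep φ a + complexRep φ b := by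
  rw [complexRep_eq, complexRep_eq, complexRep_eq, Subring.coe_add, map_add]
  exact Matrix.map_add _ (fun _ _ => Complex.ofReal_add _ _) _ _

theorem complexRep_sub (a b : O) : complexRep φ (a - b) = complexRep φ a - complexRep φ b := by
  rw [eq_sub_iff_add_eq, ← complexRep_add, sub_add_cancel]

theorem complexRep_intCast (n : ℤ) :
    complexRep φ (n : O) = (n : ℂ) • (1 : Matrix (Fin 2) (Fin 2) ℂ) := by
  rw [complexRep_eq, realRep_intCast]
  ext i j
  by_cases h : i = j <;> simp [h, Matrix.intCast_apply]

theorem complexRep_one : complexRep φ (1 : O) = 1 := by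
  simpa using complexRep_intCast (φ := φ) (O := O) 1

theorem eq_of_complexRep_mulVec {z : ℂ} (hz : z.im ≠ 0) {a b : O}
    (h : (complexRep φ a).mulVec ![z, 1] = (complexRep φ b).mulVec ![z, 1]) : a = b :=
  realRep_ext φ (eq_of_mulVec_eq hz h)

variable (φ) in
/-- `A` is literally the uniformized surface `ℂ² / φ(O) (z, 1)ᵀ`, with the torsion generator of
label `h`. -/
structure IsModel (h : O) (z : ℂ) (A : LevelSurface O N) : Prop where
  lattice : (A.surface.lattice : Set (Fin 2 → ℂ)) =
    Set.range (fun a : O => (complexRep φ a).mulVec ![z, 1])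
  rho : ∀ a : O, A.surface.rho a = complexRep φ a
  gen : A.gen = Submodule.Quotient.mk (((N : ℂ)⁻¹) • (complexRep φ h).mulVec ![z, 1])

theorem isUniformizedBy_iff {h : O} {z : DoubleHalfPlane} {P : LevelShimuraCurve O N} :
    IsUniformizedBy φ h z P ↔ ∃ A : LevelSurface O N, P = LevelShimuraCurve.mk A ∧
      IsModel φ h z.1 A :=
  ⟨fun ⟨A, h1, h2, h3, h4⟩ => ⟨A, h1, h2, h3, h4⟩, fun ⟨A, h1, h2, h3, h4⟩ => ⟨A, h1, h2, h3, h4⟩⟩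

variable (φ) in
/-- The torsion point of label `a`, the class of `φ(a) (z, 1)ᵀ / N`. -/
def torsPoint (A : LevelSurface O N) (z : ℂ) (a : O) : A.surface.Torus :=
  Submodule.Quotient.mk (((N : ℂ)⁻¹) • (complexRep φ a).mulVec ![z, 1])

namespace IsModel

variable {h k : O} {z w : ℂ} {A B : LevelSurface O N}

theorem mem_lattice (hA : IsModel φ h z A) {v : Fin 2 → ℂ} :
    v ∈ A.surface.lattice ↔ ∃ a : O, (complexRep φ a).mulVec ![z, 1] = v := by
  rw [← SetLike.mem_coe, hA.lattice]
  rfl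

theorem gen_eq (hA : IsModel φ h z A) : A.gen = torsPoint φ A z h := hA.gen

theorem torsPoint_eq_iff (hA : IsModel φ h z A) (hz : z.im ≠ 0) (hN : N ≠ 0) {a b : O} :
    torsPoint φ A z a = torsPoint φ A z b ↔ ((N : ℤ) : O) ∣ a - b := by
  have hN' : (N : ℂ) ≠ 0 := by exact_mod_cast hN
  rw [torsPoint, torsPoint, Submodule.Quotient.eq, ← smul_sub, ← Matrix.sub_mulVec,
    ← complexRep_sub, hA.mem_lattice]
  refine exists_congr fun e => ?_
  constructor
  · intro h
    apply eq_of_complexRep_mulVec hz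
    rw [complexRep_mul, complexRep_intCast, Matrix.smul_mul, one_mul, Matrix.smul_mulVec, h,
      smul_smul]
    simp [hN']
  · rintro h
    rw [h, complexRep_mul, complexRep_intCast, Matrix.smul_mul, one_mul, Matrix.smul_mulVec,
      smul_smul]
    simp [hN']

theorem act_torsPoint (hA : IsModel φ h z A) (g a : O) :
    A.surface.act g (torsPoint φ A z a) = torsPoint φ A z (g * a) := by
  change Submodule.Quotient.mk ((A.surface.rho g).mulVec _) = _
  rw [torsPoint, hA.rho, Matrix.mulVec_smul, Matrix.mulVec_mulVec, complexRep_mul]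

theorem onPoints_torsPoint (hA : IsModel φ h z A) (hB : IsModel φ k w B)
    (f : QMSurface.Hom A.surface B.surface) {c : O}
    (hf : f.mat.mulVec ![z, 1] = (complexRep φ c).mulVec ![w, 1]) (a : O) :
    f.onPoints (torsPoint φ A z a) = torsPoint φ B w (a * c) := by
  change Submodule.Quotient.mk (f.mat.mulVec _) = _
  rw [torsPoint, Matrix.mulVec_smul, Matrix.mulVec_mulVec, ← hA.rho, f.comm, hB.rho,
    ← Matrix.mulVec_mulVec, hf, Matrix.mulVec_mulVec, complexRep_mul]

end IsModel

theorem zsmul_torsPoint (A : LevelSurface O N) (z : ℂ) (n : ℤ) (a : O) :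
    n • torsPoint φ A z a = torsPoint φ A z (n * a) := by
  rw [torsPoint, torsPoint, ← Submodule.Quotient.mk_smul, complexRep_mul, complexRep_intCast,
    Matrix.smul_mul, one_mul, Matrix.smul_mulVec, smul_comm, Int.cast_smul_eq_zsmul]

namespace IsModel

variable {h k : O} {z w : ℂ} {A B : LevelSurface O N}

/-- The vector `(z, 1)` lies in the lattice. -/
theorem vec_mem (hA : IsModel φ h z A) : ![z, 1] ∈ A.surface.lattice :=
  hA.mem_lattice.mpr ⟨1, by rw [complexRep_one, Matrix.one_mulVec]⟩

theorem exists_map_vec (hA : IsModel φ h z A) (hB : IsModel φ k w B)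
    (f : QMSurface.Hom A.surface B.surface) :
    ∃ c : O, f.mat.mulVec ![z, 1] = (complexRep φ c).mulVec ![w, 1] := by
  obtain ⟨c, hc⟩ := hB.mem_lattice.mp (f.map_mem _ hA.vec_mem)
  exact ⟨c, hc.symm⟩

/-- The homomorphism given by a scalar that carries `(z, 1)` into the lattice of `B`. -/
def scalarHom (hA : IsModel φ h z A) (hB : IsModel φ k w B) (σ : ℂ) (c : O)
    (hσ : σ • ![z, 1] = (complexRep φ c).mulVec ![w, 1]) :
    QMSurface.Hom A.surface B.surface where
  mat := σ • (1 : Matrix (Fin 2) (Fin 2) ℂ)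
  map_mem v hv := by
    obtain ⟨a, rfl⟩ := hA.mem_lattice.mp hv
    refine hB.mem_lattice.mpr ⟨a * c, ?_⟩
    rw [complexRep_mul, ← Matrix.mulVec_mulVec, ← hσ, Matrix.smul_mulVec, Matrix.one_mulVec,
      Matrix.mulVec_smul]
  comm a := by
    rw [hA.rho, hB.rho, Matrix.smul_mul, Matrix.mul_smul, one_mul, mul_one]

theorem scalarHom_mulVec (hA : IsModel φ h z A) (hB : IsModel φ k w B) (σ : ℂ) (c : O)
    (hσ : σ • ![z, 1] = (complexRep φ c).mulVec ![w, 1]) :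
    (scalarHom hA hB σ c hσ).mat.mulVec ![z, 1] = (complexRep φ c).mulVec ![w, 1] := by
  rw [← hσ]
  simp only [scalarHom, Matrix.smul_mulVec, Matrix.one_mulVec]

/-- The label of a level structure is invertible modulo a prime level. -/
theorem not_dvd_nrd (hO : IsOrder O) (hdim : Module.finrank ℚ D = 4) (hN : N.Prime)
    (hz : z.im ≠ 0) (hA : IsModel φ h z A) : ¬ (N : ℤ) ∣ nrd φ h := by
  have hN1 : ¬ ((N : ℤ) : O) ∣ 1 := fun hd => by
    have h1 : ((N : ℤ) : O) ∣ ((1 : ℤ) : O) := by simpa using hd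
    have h2 := intCast_dvd_intCast φ hO hdim h1
    exact (Nat.prime_iff_prime_int.mp hN).not_dvd_one h2
  obtain ⟨a, ha⟩ : ∃ a : O, ((N : ℤ) : O) ∣ 1 - a * h := by
    obtain ⟨a, ha⟩ := A.generates (torsPoint φ A z 1) (by
      rw [zsmul_torsPoint]
      have h0 : torsPoint φ A z 0 = 0 := by
        have := zsmul_torsPoint (φ := φ) A z 0 0
        simpa using this.symm
      rw [← h0, hA.torsPoint_eq_iff hz hN.ne_zero]
      simp)
    rw [hA.gen_eq, hA.act_torsPoint, hA.torsPoint_eq_iff hz hN.ne_zero] at ha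
    exact ⟨a, ha⟩
  rintro ⟨ν, hν⟩
  have h1 : ((N : ℤ) : O) ∣ conj φ h := by
    have h2 : conj φ h = (1 - a * h) * conj φ h + a * (nrd φ h : O) := by
      rw [sub_mul, mul_assoc, mul_conj φ hO hdim, one_mul, sub_add_cancel]
    rw [h2, hν]
    refine dvd_add (ha.mul_right _) (intCast_dvd_mul_left ?_ _)
    push_cast
    exact Dvd.intro _ rfl
  have h3 := intCast_dvd_mul_left ((intCast_dvd_conj_iff φ hO hdim).mp h1) a
  exact hN1 (by simpa using dvd_add ha h3)

end IsModel

/-- A Heegner CM point in uniformized form: the common scalar `c` acts on the lattices through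
`a` and `b`, and its action on the labels agrees with a common element `g` modulo `N`. -/
theorem IsHeegnerCM.exists_eigenvectors (hO : IsOrder O) (hdim : Module.finrank ℚ D = 4)
    (hN : N.Prime) {h k : O} {z w : ℂ} (hz : z.im ≠ 0) (hw : w.im ≠ 0) {A B : LevelSurface O N}
    (hA : IsModel φ h z A) (hB : IsModel φ k w B)
    (H : IsHeegnerCM (LevelShimuraCurve.mk A, LevelShimuraCurve.mk B)) :
    ∃ (g a b : O) (c : ℂ), c.im ≠ 0 ∧ c.re ^ 2 + c.im ^ 2 = 1 ∧
      (complexRep φ a).mulVec ![z, 1] = c • ![z, 1] ∧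
      (complexRep φ b).mulVec ![w, 1] = c • ![w, 1] ∧
      ((N : ℤ) : O) ∣ g * h - h * a ∧ ((N : ℤ) : O) ∣ g * k - k * b := by
  obtain ⟨A₀, B₀, hAB, g, -, hg, α, β, c, ⟨α', hα'⟩, ⟨β', hβ'⟩, hαg, hβg, hα, hβ⟩ := H
  have hNp := Nat.prime_iff_prime_int.mp hN
  -- a scalar automorphism is transported along an isomorphism of level surfaces
  have transport : ∀ {A₀ A : LevelSurface O N} {h : O} {z : ℂ}, z.im ≠ 0 → IsModel φ h z A →
      LevelShimuraCurve.mk A = LevelShimuraCurve.mk A₀ →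
      ∀ (α α' : QMSurface.Hom A₀.surface A₀.surface), α.mat * α'.mat = 1 →
      A₀.surface.act g A₀.gen = α.onPoints A₀.gen → α.mat = c • (1 : Matrix (Fin 2) (Fin 2) ℂ) →
      ∃ a a' : O, a * a' = 1 ∧ (complexRep φ a).mulVec ![z, 1] = c • ![z, 1] ∧
        ((N : ℤ) : O) ∣ g * h - h * a := by
    intro A₀ A h z hz hA hAA α α' hαα hαg hα
    obtain ⟨f, ⟨f', hff', hf'f⟩, n, hn, hlev⟩ := Quotient.exact hAA.symm
    have hcα : c • α'.mat = 1 := by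
      rw [hα, Matrix.smul_mul, one_mul] at hαα
      exact hαα
    have hc0 : c ≠ 0 := by
      rintro rfl
      rw [zero_smul] at hcα
      exact zero_ne_one hcα
    have hmat : (f.comp (α.comp f')).mat = c • (1 : Matrix (Fin 2) (Fin 2) ℂ) := by
      change f.mat * (α.mat * f'.mat) = _
      rw [hα, Matrix.smul_mul, one_mul, Matrix.mul_smul, hff']
    have hmat' : (f.comp (α'.comp f')).mat = c⁻¹ • (1 : Matrix (Fin 2) (Fin 2) ℂ) := by
      change f.mat * (α'.mat * f'.mat) = _
      have : α'.mat = c⁻¹ • (1 : Matrix (Fin 2) (Fin 2) ℂ) := by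
        rw [← hcα, smul_smul, inv_mul_cancel₀ hc0, one_smul]
      rw [this, Matrix.smul_mul, one_mul, Matrix.mul_smul, hff']
    obtain ⟨a, ha⟩ := hA.exists_map_vec hA (f.comp (α.comp f'))
    obtain ⟨a', ha'⟩ := hA.exists_map_vec hA (f.comp (α'.comp f'))
    have ha2 : (complexRep φ a).mulVec ![z, 1] = c • ![z, 1] := by
      rw [← ha, hmat, Matrix.smul_mulVec, Matrix.one_mulVec]
    have ha2' : (complexRep φ a').mulVec ![z, 1] = c⁻¹ • ![z, 1] := by
      rw [← ha', hmat', Matrix.smul_mulVec, Matrix.one_mulVec]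
    refine ⟨a, a', ?_, ha2, ?_⟩
    · apply eq_of_complexRep_mulVec (φ := φ) hz
      rw [complexRep_mul, ← Matrix.mulVec_mulVec, ha2', Matrix.mulVec_smul, ha2, smul_smul,
        inv_mul_cancel₀ hc0, one_smul, complexRep_one, Matrix.one_mulVec]
    · have h1 : f.onPoints (A₀.surface.act g A₀.gen) = A.surface.act g (f.onPoints A₀.gen) := by
        obtain ⟨v, hv⟩ := Submodule.Quotient.mk_surjective _ A₀.gen
        rw [← hv]
        change Submodule.Quotient.mk (f.mat.mulVec ((A₀.surface.rho g).mulVec v)) =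
          Submodule.Quotient.mk ((A.surface.rho g).mulVec (f.mat.mulVec v))
        rw [Matrix.mulVec_mulVec, Matrix.mulVec_mulVec, f.comm]
      have h2 : f.onPoints (α.onPoints A₀.gen) =
          (f.comp (α.comp f')).onPoints (f.onPoints A₀.gen) := by
        rw [QMSurface.Hom.onPoints_comp, QMSurface.Hom.onPoints_comp,
          ← QMSurface.Hom.onPoints_comp f' f,
          QMSurface.Hom.onPoints_eq_self (f := f'.comp f) hf'f]
      rw [← hαg, h1, hlev, map_zsmul, map_zsmul, hA.gen_eq, hA.act_torsPoint,
        hA.onPoints_torsPoint hA _ ha, zsmul_torsPoint, zsmul_torsPoint,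
        hA.torsPoint_eq_iff hz hN.ne_zero, ← mul_sub] at h2
      exact intCast_dvd_of_dvd_mul hn h2
  obtain ⟨hA₀, hB₀⟩ := Prod.mk.inj hAB
  obtain ⟨a, a', haa', ha, hga⟩ := transport hz hA hA₀ α α' hα'.1 hαg hα
  obtain ⟨b, b', -, hb, hgb⟩ := transport hw hB hB₀ β β' hβ'.1 hβg hβ
  have hnorm : c.re ^ 2 + c.im ^ 2 = 1 := by
    have h1 := det_of_eigenvector hz (X := realRep φ (a : D)) ha
    have h2 := nrd_unit φ hO hdim haa'
    have h3 : |(nrd φ a : ℝ)| = 1 := by exact_mod_cast h2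
    rwa [cast_nrd φ hO hdim, h1, abs_of_nonneg (by positivity)] at h3
  refine ⟨g, a, b, c, ?_, hnorm, ha, hb, hga, hgb⟩
  -- a real scalar is `± 1`, and then `g` would be a scalar modulo `N`
  intro him
  obtain ⟨ε, hε⟩ : ∃ ε : ℤ, c = ε := by
    rw [him] at hnorm
    have h1 : c.re = 1 ∨ c.re = -1 := mul_self_eq_one_iff.mp (by linarith)
    rcases h1 with h1 | h1
    · exact ⟨1, Complex.ext (by simp [h1]) (by simp [him])⟩
    · exact ⟨-1, Complex.ext (by simp [h1]) (by simp [him])⟩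
  have haε : a = (ε : O) := by
    apply eq_of_complexRep_mulVec (φ := φ) hz
    rw [ha, complexRep_intCast, Matrix.smul_mulVec, Matrix.one_mulVec, hε]
  have h1 : ((N : ℤ) : O) ∣ (nrd φ h : O) * (g - ε) := by
    have h2 : (nrd φ h : O) * (g - ε) = (g * h - h * a) * conj φ h := by
      rw [haε, ← (Int.cast_commute ε h).eq, ← sub_mul, mul_assoc, mul_conj φ hO hdim,
        (Int.cast_commute _ _).eq]
    rw [h2]
    exact hga.mul_right _
  have hcop : IsCoprime (nrd φ h) (N : ℤ) :=
    ((Prime.coprime_iff_not_dvd hNp).mpr (hA.not_dvd_nrd hO hdim hN hz)).symm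
  obtain ⟨e, he⟩ := intCast_dvd_of_dvd_mul hcop h1
  refine hg ε e ?_
  rw [Int.cast_natCast] at he
  rw [← he]
  abel

/-- Two uniformizations of one point differ by a unit of the order. -/
theorem IsModel.exists_unit_of_eq (hO : IsOrder O) (hdim : Module.finrank ℚ D = 4)
    (hN : N ≠ 0) {h k : O} {z w : ℂ} (hz : z.im ≠ 0) (hw : w.im ≠ 0) {A B : LevelSurface O N}
    (hA : IsModel φ h z A) (hB : IsModel φ k w B)
    (H : LevelShimuraCurve.mk A = LevelShimuraCurve.mk B) :
    ∃ (γ γ' : O) (n : ℤ) (μ : ℂ), γ * γ' = 1 ∧ γ' * γ = 1 ∧ IsCoprime n (N : ℤ) ∧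
      (complexRep φ γ).mulVec ![w, 1] = μ • ![z, 1] ∧ ((N : ℤ) : O) ∣ h * γ - n * k := by
  obtain ⟨f, ⟨f', hff', hf'f⟩, n, hn, hlev⟩ := Quotient.exact H
  obtain ⟨γ, hγ⟩ := hA.exists_map_vec hB f
  obtain ⟨γ', hγ'⟩ := hB.exists_map_vec hA f'
  have hfa : ∀ a, f.mat * complexRep φ a = complexRep φ a * f.mat := fun a => by
    have := f.comm a
    rwa [hA.rho, hB.rho] at this
  have hfa' : ∀ a, f'.mat * complexRep φ a = complexRep φ a * f'.mat := fun a => by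
    have := f'.comm a
    rwa [hA.rho, hB.rho] at this
  have h1 : γ' * γ = 1 := by
    apply eq_of_complexRep_mulVec (φ := φ) hw
    rw [complexRep_mul, ← Matrix.mulVec_mulVec, ← hγ, Matrix.mulVec_mulVec, ← hfa,
      ← Matrix.mulVec_mulVec, ← hγ', Matrix.mulVec_mulVec, hff', complexRep_one]
  have h2 : γ * γ' = 1 := by
    apply eq_of_complexRep_mulVec (φ := φ) hz
    rw [complexRep_mul, ← Matrix.mulVec_mulVec, ← hγ', Matrix.mulVec_mulVec, ← hfa',
      ← Matrix.mulVec_mulVec, ← hγ, Matrix.mulVec_mulVec, hf'f, complexRep_one]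
  -- commuting with `φ(O)`, which spans all matrices, `f` is a scalar
  have hall : ∀ M : Matrix (Fin 2) (Fin 2) ℝ,
      f.mat * M.map Complex.ofReal = M.map Complex.ofReal * f.mat := by
    obtain ⟨b, B', hB'⟩ := exists_basis φ hO hdim
    intro M
    have hM : M.map Complex.ofReal = ∑ i, (B'.repr M i : ℂ) • complexRep φ (b i) := by
      conv_lhs => rw [← B'.sum_repr M]
      ext i j
      simp [Matrix.sum_apply, complexRep_eq, hB']
    rw [hM, Finset.mul_sum, Finset.sum_mul]
    refine Finset.sum_congr rfl fun i _ => ?_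
    rw [Matrix.mul_smul, Matrix.smul_mul, hfa]
  have hscalar : f.mat = f.mat 0 0 • (1 : Matrix (Fin 2) (Fin 2) ℂ) := by
    have e1 := hall !![1, 0; 0, 0]
    have e2 := hall !![0, 1; 0, 0]
    rw [← Matrix.ext_iff] at e1 e2
    have e3 := e1 0 1
    have e4 := e1 1 0
    have e5 := e2 0 1
    simp [Matrix.mul_apply, Fin.sum_univ_two] at e3 e4 e5
    ext i j
    fin_cases i <;> fin_cases j <;> simp [← e3, e4, e5]
  refine ⟨γ, γ', n, f.mat 0 0, h2, h1, hn, ?_, ?_⟩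
  · rw [← hγ]
    conv_lhs => rw [hscalar]
    rw [Matrix.smul_mulVec, Matrix.one_mulVec]
  · rw [hA.gen_eq, hA.onPoints_torsPoint hB f hγ, hB.gen_eq, zsmul_torsPoint,
      hB.torsPoint_eq_iff hw hN] at hlev
    exact hlev

/-- Conversely, points whose uniformizations differ by a unit coincide. -/
theorem IsModel.mk_eq_of_unit (hN : N ≠ 0) {h k : O} {z w : ℂ} (hw : w.im ≠ 0)
    {A B : LevelSurface O N} (hA : IsModel φ h z A) (hB : IsModel φ k w B)
    {γ γ' : O} {n : ℤ} {μ : ℂ} (hγ' : γ' * γ = 1) (hn : IsCoprime n (N : ℤ))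
    (hμ : (complexRep φ γ).mulVec ![w, 1] = μ • ![z, 1]) (hk : ((N : ℤ) : O) ∣ h * γ - n * k) :
    LevelShimuraCurve.mk A = LevelShimuraCurve.mk B := by
  have h1 : μ • (complexRep φ γ').mulVec ![z, 1] = ![w, 1] := by
    rw [← Matrix.mulVec_smul, ← hμ, Matrix.mulVec_mulVec, ← complexRep_mul, hγ', complexRep_one,
      Matrix.one_mulVec]
  have hμ0 : μ ≠ 0 := by
    rintro rfl
    rw [zero_smul] at h1
    simpa using congrFun h1 1
  have h2 : μ⁻¹ • ![w, 1] = (complexRep φ γ').mulVec ![z, 1] := by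
    rw [← h1, smul_smul, inv_mul_cancel₀ hμ0, one_smul]
  refine Quotient.sound ⟨IsModel.scalarHom hA hB μ γ hμ.symm,
    ⟨IsModel.scalarHom hB hA μ⁻¹ γ' h2, ?_, ?_⟩, n, hn, ?_⟩
  · simp [IsModel.scalarHom, hμ0]
  · simp [IsModel.scalarHom, hμ0]
  · rw [hA.gen_eq, hA.onPoints_torsPoint hB _ (IsModel.scalarHom_mulVec hA hB μ γ hμ.symm),
      hB.gen_eq, zsmul_torsPoint, hB.torsPoint_eq_iff hw hN]
    exact hk

end Models

/-! ### Nearby points -/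

section Nearby

variable {D : Type*} [Ring D] [Algebra ℚ D]
  {φ : (ℝ ⊗[ℚ] D) ≃ₐ[ℝ] Matrix (Fin 2) (Fin 2) ℝ} {O : Subring D} {N : ℕ}

/-- The infimum in the distance need not be attained by lifts, whence the bound `r + 1`. -/
theorem exists_model_of_curveDist_le {P Q : LevelShimuraCurve O N} {r : ℝ} (hr : 0 < r)
    (H : curveDist φ P Q ≤ ENNReal.ofReal r) :
    ∃ (h : O) (z w : DoubleHalfPlane) (A B : LevelSurface O N), P = LevelShimuraCurve.mk A ∧
      Q = LevelShimuraCurve.mk B ∧ IsModel φ h z.1 A ∧ IsModel φ h w.1 B ∧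
      0 < z.1.im * w.1.im ∧ dist z.toUpper w.toUpper ≤ r + 1 := by
  have hlt : curveDist φ P Q < ENNReal.ofReal (r + 1) :=
    H.trans_lt ((ENNReal.ofReal_lt_ofReal_iff (by linarith)).mpr (by linarith))
  simp only [curveDist, iInf_lt_iff] at hlt
  obtain ⟨h, z, w, hz, hw, hd⟩ := hlt
  obtain ⟨A, hA, hA'⟩ := isUniformizedBy_iff.mp hz
  obtain ⟨B, hB, hB'⟩ := isUniformizedBy_iff.mp hw
  have hpos : 0 < z.1.im * w.1.im := by
    by_contra hneg
    rw [DoubleHalfPlane.hypDist, if_neg hneg] at hd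
    exact not_top_lt hd
  refine ⟨h, z, w, A, B, hA, hB, hA', hB', hpos, ?_⟩
  rw [DoubleHalfPlane.hypDist, if_pos hpos, edist_dist,
    ENNReal.ofReal_lt_ofReal_iff (by linarith)] at hd
  exact hd.le

/-- Two points whose balls meet have uniformizations that differ by a unit of the order and by a
bounded hyperbolic distance. -/
theorem exists_models_of_hypBall_inter (hO : IsOrder O) (hdim : Module.finrank ℚ D = 4)
    (hN : N ≠ 0) {P P' : LevelShimuraCurve O N} {r : ℝ} (hr : 0 < r)
    (H : (hypBall φ P r ∩ hypBall φ P' r).Nonempty) :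
    ∃ (h h' : O) (z z' z₂ : ℂ) (A A' : LevelSurface O N) (γ γ' : O) (n : ℤ) (j : ℂ),
      P = LevelShimuraCurve.mk A ∧ P' = LevelShimuraCurve.mk A' ∧ IsModel φ h z A ∧
      IsModel φ h' z' A' ∧ z'.im ≠ 0 ∧ γ * γ' = 1 ∧ γ' * γ = 1 ∧ IsCoprime n (N : ℤ) ∧
      ((N : ℤ) : O) ∣ h * γ - n * h' ∧ j ≠ 0 ∧
      (complexRep φ γ).mulVec ![z', 1] = j • ![z₂, 1] ∧ 0 < z.im * z₂.im ∧
      coshDist z z₂ ≤ Real.cosh (2 * (r + 1)) := by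
  obtain ⟨Q, hQ, hQ'⟩ := H
  obtain ⟨h, z, w, A, B, hPA, hQB, hA, hB, hzw, hd⟩ := exists_model_of_curveDist_le hr hQ
  obtain ⟨h', z', w', A', B', hPA', hQB', hA', hB', hzw', hd'⟩ :=
    exists_model_of_curveDist_le hr hQ'
  obtain ⟨γ, γ', n, μ, h1, h2, hn, hγ, hdvd⟩ :=
    hB.exists_unit_of_eq hO hdim hN w.2 w'.2 hB' (hQB.symm.trans hQB')
  have hdet : (realRep φ (γ : D)).det ≠ 0 := by
    rw [← cast_nrd φ hO hdim]
    have := nrd_unit φ hO hdim h1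
    intro h0
    rw [Int.cast_eq_zero.mp h0] at this
    simp at this
  obtain ⟨z₂, j, hz₂, hj, hγz⟩ := exists_mobius hdet z'.2
  have i1 := im_mul_normSq_of_mobius hγz
  have i2 := im_mul_normSq_of_mobius (X := realRep φ (γ : D)) hγ
  have hjn : 0 < Complex.normSq j := Complex.normSq_pos.mpr hj
  have hμ : μ ≠ 0 := by
    rintro rfl
    rw [map_zero, mul_zero] at i2
    exact mul_ne_zero hdet w'.2 i2.symm
  have hμn : 0 < Complex.normSq μ := Complex.normSq_pos.mpr hμ
  have hwz₂ : 0 < w.1.im * z₂.im := by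
    have e1 : (w.1.im * z₂.im) * (Complex.normSq μ * Complex.normSq j) =
        (realRep φ (γ : D)).det ^ 2 * (z'.1.im * w'.1.im) := by
      calc _ = (w.1.im * Complex.normSq μ) * (z₂.im * Complex.normSq j) := by ring
        _ = _ := by rw [i1, i2]; ring
    have e2 : 0 < (w.1.im * z₂.im) * (Complex.normSq μ * Complex.normSq j) := by
      rw [e1]
      exact mul_pos (by positivity) hzw'
    exact pos_of_mul_pos_left e2 (by positivity)
  have hzz₂ : 0 < z.1.im * z₂.im := by
    have e1 : 0 < (z.1.im * z₂.im) * w.1.im ^ 2 := by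
      have := mul_pos hzw hwz₂
      nlinarith
    exact pos_of_mul_pos_left e1 (sq_nonneg _)
  refine ⟨h, h', z.1, z'.1, z₂, A, A', γ, γ', n, j, hPA, hPA', hA, hA', z'.2, h1, h2, hn, hdvd, hj,
    hγz, hzz₂, ?_⟩
  let Z₂ : DoubleHalfPlane := ⟨z₂, hz₂⟩
  have e1 := cosh_dist_toUpper (z := w) (w := Z₂) hwz₂
  have e2 := cosh_dist_toUpper (z := w') (w := z') (by rwa [mul_comm])
  have e3 := coshDist_mobius hdet w'.2 w.2 z'.2 hz₂ hγ hγz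
  have e4 : dist w.toUpper Z₂.toUpper = dist w'.toUpper z'.toUpper := by
    have h5 : Real.cosh (dist w.toUpper Z₂.toUpper) = Real.cosh (dist w'.toUpper z'.toUpper) := by
      rw [e1, e2, ← e3]
    exact Real.cosh_strictMonoOn.injOn dist_nonneg dist_nonneg h5
  have e5 := cosh_dist_toUpper (z := z) (w := Z₂) hzz₂
  have e6 : dist z.toUpper Z₂.toUpper ≤ 2 * (r + 1) := by
    have := dist_triangle z.toUpper w.toUpper Z₂.toUpper
    rw [e4, dist_comm w'.toUpper] at this
    linarith
  change coshDist z.1 Z₂.1 ≤ _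
  rw [← e5, Real.cosh_le_cosh, abs_of_nonneg dist_nonneg, abs_of_nonneg (by linarith)]
  exact e6

/-- Conjugating by a unit adapted to `z` moves the elements of norm one that fix a point near `z`
into a fixed bounded set. -/
theorem abs_conj_le (hO : IsOrder O) (hdim : Module.finrank ℚ D = 4) {C R : ℝ}
    {z z₂ c : ℂ} {a γ γ' : O} (hγ : γ * γ' = 1)
    (hb : ∀ i j, |(realRep φ (γ : D) * upperMat z.re z.im) i j| ≤ C * √|z.im|)
    (hz : 0 < z.im * z₂.im) (hR : coshDist z z₂ ≤ R) (hc : c.re ^ 2 + c.im ^ 2 = 1)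
    (ha : (complexRep φ a).mulVec ![z₂, 1] = c • ![z₂, 1]) (i j : Fin 2) :
    |realRep φ ((γ * a * γ' : O) : D) i j| ≤ 4 * (C * C * (1 + 2 * R)) := by
  obtain ⟨E, hE, hEb⟩ := exists_bounded_conj (X := realRep φ (a : D)) hz hR hc ha
  have hy : z.im ≠ 0 := fun h => by simp [h] at hz
  set G := realRep φ (γ : D) * upperMat z.re z.im with hG
  have hadj : ∀ i j, |G.adjugate i j| ≤ C * √|z.im| := by
    intro i j
    rw [Matrix.adjugate_fin_two]
    fin_cases i <;> fin_cases j <;> simp <;> exact hb _ _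
  have h1 := abs_mul_apply_le (abs_mul_apply_le hb hEb) hadj i j
  have hconj : conj φ γ = (nrd φ γ : O) * γ' := by
    calc conj φ γ = conj φ γ * (γ * γ') := by rw [hγ, mul_one]
      _ = _ := by rw [← mul_assoc, conj_mul_self φ hO hdim]
  have h2 : G * E * G.adjugate =
      (z.im * (nrd φ γ : ℝ)) • realRep φ ((γ * a * γ' : O) : D) := by
    have h3 : (realRep φ (γ : D)).adjugate = (nrd φ γ : ℝ) • realRep φ (γ' : D) := by
      rw [← realRep_conj φ hO hdim, hconj, Subring.coe_mul, map_mul, realRep_intCast,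
        ← zsmul_eq_mul, Int.cast_smul_eq_zsmul]
    rw [hG, Matrix.adjugate_mul_distrib, h3, mul_assoc (realRep φ (γ : D)), ← hE,
      Subring.coe_mul, Subring.coe_mul, map_mul, map_mul]
    calc realRep φ (γ : D) * (realRep φ (a : D) * upperMat z.re z.im) *
          ((upperMat z.re z.im).adjugate * (nrd φ γ : ℝ) • realRep φ (γ' : D)) =
        realRep φ (γ : D) * (realRep φ (a : D) *
          ((upperMat z.re z.im) * (upperMat z.re z.im).adjugate)) *
          ((nrd φ γ : ℝ) • realRep φ (γ' : D)) := by simp only [mul_assoc]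
      _ = _ := by
        rw [Matrix.mul_adjugate, det_upperMat]
        simp only [Matrix.mul_smul, Matrix.smul_mul, mul_one, smul_smul]
        rw [mul_comm]
  rw [h2, Matrix.smul_apply, smul_eq_mul, abs_mul, abs_mul] at h1
  have h4 : |(nrd φ γ : ℝ)| = 1 := by exact_mod_cast nrd_unit φ hO hdim hγ
  rw [h4, mul_one] at h1
  have h5 : 2 * (2 * (C * √|z.im| * (1 + 2 * R)) * (C * √|z.im|)) =
      |z.im| * (4 * (C * C * (1 + 2 * R))) := by
    calc _ = (√|z.im| * √|z.im|) * (4 * (C * C * (1 + 2 * R))) := by ring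
      _ = _ := by rw [Real.mul_self_sqrt (abs_nonneg _)]
  rw [h5] at h1
  exact le_of_mul_le_mul_left h1 (abs_pos.mpr hy)

end Nearby

/-! ### Points on Hecke divisors -/

section Hecke

variable {D : Type*} [Ring D] [Algebra ℚ D]
  {φ : (ℝ ⊗[ℚ] D) ≃ₐ[ℝ] Matrix (Fin 2) (Fin 2) ℝ} {O : Subring D} {N : ℕ}

/-- Two label relations with a common `g` make `conj k * h` an intertwiner modulo `p`. -/
theorem dvd_intertwine (hO : IsOrder O) (hdim : Module.finrank ℚ D = 4) {p : ℤ} {g h k a b : O}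
    (hp : IsCoprime (nrd φ k) p) (ha : (p : O) ∣ g * h - h * a) (hb : (p : O) ∣ g * k - k * b) :
    (p : O) ∣ (conj φ k * h) * a - b * (conj φ k * h) := by
  have h1 : (p : O) ∣ (nrd φ k : O) * (conj φ k * g - b * conj φ k) := by
    have h2 : (nrd φ k : O) * (conj φ k * g - b * conj φ k) =
        conj φ k * (g * k - k * b) * conj φ k := by
      rw [mul_sub (conj φ k), sub_mul, mul_sub (nrd φ k : O), (Int.cast_commute _ _).eq]
      congr 1
      · rw [← mul_conj φ hO hdim]
        simp only [mul_assoc]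
      · rw [← conj_mul_self φ hO hdim]
        simp only [mul_assoc]
    rw [h2]
    exact (intCast_dvd_mul_left hb _).mul_right _
  have h3 := (intCast_dvd_of_dvd_mul hp h1).mul_right h
  have h4 : (conj φ k * h) * a - b * (conj φ k * h) =
      (conj φ k * g - b * conj φ k) * h - conj φ k * (g * h - h * a) := by
    simp only [mul_sub, sub_mul, mul_assoc]
    abel
  rw [h4]
  exact dvd_sub h3 (intCast_dvd_mul_left ha _)

/-- A primitive `n₀ ∈ O` that carries `z` to `w` and matches the labels modulo `N` defines a point
on the Hecke divisor of index `|nrd n₀|`. The isogeny is multiplication by the scalar that carries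
`(z, 1)` to `conj n₀ (w, 1)`, and its kernel is `O / O conj n₀`. -/
theorem IsModel.mem_heckeDivisor (hM : IsMaximalOrder O) (hdim : Module.finrank ℚ D = 4)
    (hN : N.Prime) {h k n₀ : O} {z w s : ℂ} (hw : w.im ≠ 0)
    {A B : LevelSurface O N} (hA : IsModel φ h z A) (hB : IsModel φ k w B)
    (hs : (complexRep φ n₀).mulVec ![z, 1] = s • ![w, 1]) (hprim : IsPrimitive n₀)
    (hn₀ : nrd φ n₀ ≠ 0) (hcop : (nrd φ n₀).natAbs.Coprime N)
    (hk : IsCoprime (nrd φ k) (N : ℤ)) {l : ℤ} (hl : IsCoprime l (N : ℤ))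
    (hlab : ((N : ℤ) : O) ∣ conj φ k * h - l * n₀) :
    (LevelShimuraCurve.mk A, LevelShimuraCurve.mk B) ∈ HeckeDivisor O N (nrd φ n₀).natAbs := by
  have hO := hM.isOrder
  have hconj : s • (complexRep φ (conj φ n₀)).mulVec ![w, 1] = (nrd φ n₀ : ℂ) • ![z, 1] := by
    rw [← Matrix.mulVec_smul, ← hs, Matrix.mulVec_mulVec, ← complexRep_mul,
      conj_mul_self φ hO hdim, complexRep_intCast, Matrix.smul_mulVec, Matrix.one_mulVec]
  have hν : (nrd φ n₀ : ℂ) ≠ 0 := by exact_mod_cast hn₀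
  have hs0 : s ≠ 0 := by
    rintro rfl
    rw [zero_smul] at hconj
    have := congrFun hconj 1
    simp at this
    exact hν this.symm
  set σ : ℂ := nrd φ n₀ / s with hσdef
  have hσ0 : σ ≠ 0 := div_ne_zero hν hs0
  have hσ : σ • ![z, 1] = (complexRep φ (conj φ n₀)).mulVec ![w, 1] := by
    rw [hσdef, div_eq_inv_mul, mul_smul, ← hconj, smul_smul, inv_mul_cancel₀ hs0, one_smul]
  let f := IsModel.scalarHom hA hB σ (conj φ n₀) hσ
  have hfmat : f.mat = σ • (1 : Matrix (Fin 2) (Fin 2) ℂ) := rfl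
  have hfv : f.mat.mulVec ![z, 1] = (complexRep φ (conj φ n₀)).mulVec ![w, 1] :=
    IsModel.scalarHom_mulVec hA hB σ _ hσ
  refine ⟨Int.natAbs_pos.mpr hn₀, hcop, A, B, rfl, f, ?_, ?_, ?_⟩
  · exact IsUnit.of_mul_eq_one (σ⁻¹ • 1) (by
      rw [hfmat, Matrix.smul_mul, one_mul, smul_smul, mul_inv_cancel₀ hσ0, one_smul])
  · -- the kernel is the image of `a ↦ σ⁻¹ a (w, 1)`
    let θ : O →+ A.surface.Torus :=
      { toFun := fun a => Submodule.Quotient.mk (σ⁻¹ • (complexRep φ a).mulVec ![w, 1])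
        map_zero' := by
          have : complexRep φ (0 : O) = 0 := by
            simpa using complexRep_intCast (φ := φ) (O := O) 0
          rw [this, Matrix.zero_mulVec, smul_zero, Submodule.Quotient.mk_zero]
        map_add' := fun a b => by
          rw [complexRep_add, Matrix.add_mulVec, smul_add, Submodule.Quotient.mk_add] }
    have hker : θ.ker = (AddMonoidHom.mulRight (conj φ n₀)).range := by
      ext a
      rw [AddMonoidHom.mem_ker, AddMonoidHom.mem_range]
      change Submodule.Quotient.mk (σ⁻¹ • (complexRep φ a).mulVec ![w, 1]) = 0 ↔ _
      rw [Submodule.Quotient.mk_eq_zero, hA.mem_lattice]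
      refine exists_congr fun e => ?_
      change _ ↔ e * conj φ n₀ = a
      constructor
      · intro he
        apply eq_of_complexRep_mulVec (φ := φ) hw
        rw [complexRep_mul, ← Matrix.mulVec_mulVec, ← hσ, Matrix.mulVec_smul, he, smul_smul,
          mul_inv_cancel₀ hσ0, one_smul]
      · rintro rfl
        rw [complexRep_mul, ← Matrix.mulVec_mulVec, ← hσ, Matrix.mulVec_smul, smul_smul,
          inv_mul_cancel₀ hσ0, one_smul]
    have hrange : θ.range = (LinearMap.ker f.onPoints).toAddSubgroup := by
      ext u
      obtain ⟨v, rfl⟩ := Submodule.Quotient.mk_surjective _ u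
      rw [AddMonoidHom.mem_range, Submodule.mem_toAddSubgroup, LinearMap.mem_ker]
      change (∃ a, Submodule.Quotient.mk (σ⁻¹ • (complexRep φ a).mulVec ![w, 1]) =
        (Submodule.Quotient.mk v : A.surface.Torus)) ↔
          (Submodule.Quotient.mk (f.mat.mulVec v) : B.surface.Torus) = 0
      rw [Submodule.Quotient.mk_eq_zero, hfmat, Matrix.smul_mulVec, Matrix.one_mulVec]
      constructor
      · rintro ⟨a, ha⟩
        rw [Submodule.Quotient.eq] at ha
        have h1 := f.map_mem _ ha
        rw [hfmat, Matrix.smul_mulVec, Matrix.one_mulVec, smul_sub, smul_smul,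
          mul_inv_cancel₀ hσ0, one_smul] at h1
        have h2 : (complexRep φ a).mulVec ![w, 1] ∈ B.surface.lattice :=
          hB.mem_lattice.mpr ⟨a, rfl⟩
        have h3 := B.surface.lattice.sub_mem h2 h1
        rwa [sub_sub_cancel] at h3
      · intro hv
        obtain ⟨a, ha⟩ := hB.mem_lattice.mp hv
        exact ⟨a, by rw [ha, smul_smul, inv_mul_cancel₀ hσ0, one_smul]⟩
    have hnc : nrd φ (conj φ n₀) = nrd φ n₀ := nrd_conj φ hO hdim n₀
    obtain ⟨E⟩ := nonempty_quotient_addEquiv φ hM hdim (hprim.conj φ hO hdim)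
      (by rw [hnc]; exact hn₀)
    rw [hnc] at E
    exact ⟨((AddEquiv.addSubgroupCongr hrange).symm.trans
      ((QuotientAddGroup.quotientKerEquivRange θ).symm.trans
        (QuotientAddGroup.quotientAddEquivOfEq hker))).trans E⟩
  · obtain ⟨u, v, huv⟩ := hk
    have hu : IsCoprime u (N : ℤ) := ⟨nrd φ k, v, by linarith⟩
    have hν' : IsCoprime (nrd φ n₀) (N : ℤ) :=
      Int.isCoprime_iff_nat_coprime.mpr (by simpa using hcop)
    refine ⟨u * l * nrd φ n₀, (hu.mul_left hl).mul_left hν', ?_⟩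
    rw [hA.gen_eq, hB.gen_eq, hA.onPoints_torsPoint hB f hfv, zsmul_torsPoint,
      hB.torsPoint_eq_iff hw hN.ne_zero]
    -- `u` inverts `nrd k` modulo `N`, so that `h` is congruent to `u l k n₀`
    have h1 : h * conj φ n₀ - ((u * l * nrd φ n₀ : ℤ) : O) * k =
        (u : O) * (k * (conj φ k * h - l * n₀) * conj φ n₀) +
          (N : ℤ) * ((v : O) * (h * conj φ n₀)) := by
      have e1 : k * (conj φ k * h - l * n₀) * conj φ n₀ =
          (nrd φ k : O) * (h * conj φ n₀) - ((l * nrd φ n₀ : ℤ) : O) * k := by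
        rw [mul_sub, sub_mul, ← mul_assoc k (conj φ k), mul_conj φ hO hdim, mul_assoc]
        congr 1
        rw [← mul_assoc k, ← (Int.cast_commute l k).eq, mul_assoc, mul_assoc, mul_conj φ hO hdim,
          ← (Int.cast_commute _ k).eq, ← mul_assoc]
        push_cast
        rfl
      have e2 : ((u : O) * (nrd φ k : O)) + ((N : ℤ) : O) * (v : O) = 1 := by
        have : ((u * nrd φ k + v * (N : ℤ) : ℤ) : O) = 1 := by rw [huv, Int.cast_one]
        rw [Int.cast_add, Int.cast_mul, Int.cast_mul, (Int.cast_commute v _).eq] at this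
        exact this
      rw [e1, mul_sub, ← mul_assoc, ← mul_assoc ((N : ℤ) : O), ← mul_assoc (u : O) (_ : O) k,
        sub_add_eq_add_sub, ← add_mul, e2, one_mul, mul_assoc u l, Int.cast_mul u]
    rw [h1]
    exact dvd_add (intCast_dvd_mul_left ((intCast_dvd_mul_left hlab k).mul_right _) _)
      (Dvd.intro _ rfl)

end Hecke

/-! ### Nearby Heegner points -/

section Heegner

variable {D : Type*} [Ring D] [Algebra ℚ D]
  (φ : (ℝ ⊗[ℚ] D) ≃ₐ[ℝ] Matrix (Fin 2) (Fin 2) ℝ) {O : Subring D}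

/-- Only finitely many pairs of pairs of elements matter, so the bound for intertwiners can be
chosen uniformly on a bounded set. -/
theorem exists_uniform_intertwiner [Algebra.IsCentral ℚ D] [IsSimpleRing D]
    (hO : IsOrder O) (hdim : Module.finrank ℚ D = 4)
    (hnonsplit : IsEmpty (D ≃ₐ[ℚ] Matrix (Fin 2) (Fin 2) ℚ)) {F : Set O} (hF : F.Finite) :
    ∃ K : ℕ, ∀ a ∈ F, ∀ a₁ ∈ F, ∀ b ∈ F, ∀ b₁ ∈ F, ∀ p : ℕ, p.Prime → K ≤ p → ∀ m : O,
      ¬ ((p : ℤ) : O) ∣ m → ((p : ℤ) : O) ∣ m * a - b * m → ((p : ℤ) : O) ∣ m * a₁ - b₁ * m →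
      ∃ (n₀ : O) (k : ℤ), n₀ * a = b * n₀ ∧ n₀ * a₁ = b₁ * n₀ ∧ n₀ ≠ 0 ∧
        IsCoprime k (p : ℤ) ∧ ((p : ℤ) : O) ∣ m - k * n₀ ∧
        (a * a₁ ≠ a₁ * a → IsPrimitive n₀ ∧ (nrd φ n₀).natAbs < K) := by
  choose K hK using fun a a₁ b b₁ : O =>
    exists_primitive_intertwiner φ hO hdim hnonsplit a a₁ b b₁
  obtain ⟨M, hM⟩ := (((hF.prod (hF.prod (hF.prod hF)))).image
    fun t : O × O × O × O => K t.1 t.2.1 t.2.2.1 t.2.2.2).bddAbove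
  refine ⟨M, fun a ha a₁ ha₁ b hb b₁ hb₁ p hp hMp m h1 h2 h3 => ?_⟩
  have hKM : K a a₁ b b₁ ≤ M := hM ⟨(a, a₁, b, b₁), ⟨ha, ha₁, hb, hb₁⟩, rfl⟩
  obtain ⟨n₀, k, e1, e2, e3, e4, e5, e6⟩ := hK a a₁ b b₁ p hp (hKM.trans hMp) m h1 h2 h3
  exact ⟨n₀, k, e1, e2, e3, e4, e5, fun h => ⟨(e6 h).1, (e6 h).2.trans_le hKM⟩⟩

theorem dvd_unit_mul {R : Type*} [Ring R] {n : ℤ} {γ γ' δ δ' m a b : R} (hγ : γ' * γ = 1)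
    (hδ : δ' * δ = 1) (h : (n : R) ∣ m * a - b * m) :
    (n : R) ∣ (δ * m * γ') * (γ * a * γ') - (δ * b * δ') * (δ * m * γ') := by
  have h1 : (δ * m * γ') * (γ * a * γ') - (δ * b * δ') * (δ * m * γ') =
      δ * (m * a - b * m) * γ' := by
    calc _ = δ * m * (γ' * γ) * a * γ' - δ * b * (δ' * δ) * m * γ' := by simp only [mul_assoc]
      _ = _ := by rw [hγ, hδ]; simp only [mul_sub, sub_mul, mul_assoc, one_mul]
  rw [h1]
  exact (intCast_dvd_mul_left h _).mul_right _

theorem IsPrimitive.unit_mul {D : Type*} [Ring D] {O : Subring D} {n γ γ' δ δ' : O} (hn : IsPrimitive n) (hγ : γ * γ' = 1)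
    (hδ : δ' * δ = 1) : IsPrimitive (δ * n * γ) := by
  intro q hq h
  apply hn q hq
  have h1 := (intCast_dvd_mul_left h δ').mul_right γ'
  have h2 : δ' * (δ * n * γ) * γ' = n := by
    calc _ = (δ' * δ) * n * (γ * γ') := by simp only [mul_assoc]
      _ = n := by rw [hγ, hδ, one_mul, mul_one]
  rwa [h2] at h1

/-- The relation between the labels of `x'` and its fixing element, transported to the label of
`x` along a unit. -/
theorem dvd_transport {R : Type*} [Ring R] {p n : ℤ} {g h h' a γ γ' : R} (hγ : γ * γ' = 1)
    (h1 : (p : R) ∣ h * γ - n * h') (h2 : (p : R) ∣ g * h' - h' * a) :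
    (p : R) ∣ g * h - h * (γ * a * γ') := by
  have h3 : g * h - h * (γ * a * γ') =
      (g * (h * γ - n * h') + n * (g * h' - h' * a) - (h * γ - n * h') * a) * γ' := by
    have e1 : g * ((n : R) * h') = n * (g * h') := by
      rw [← mul_assoc, ← (Int.cast_commute n g).eq, mul_assoc]
    calc g * h - h * (γ * a * γ') = (g * h) * (γ * γ') - h * (γ * a * γ') := by rw [hγ, mul_one]
      _ = _ := by
        simp only [mul_sub, sub_mul, add_mul, e1]
        simp only [mul_assoc]
        abel
  rw [h3]
  exact (dvd_sub (dvd_add (intCast_dvd_mul_left h1 _) (intCast_dvd_mul_left h2 _))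
    (h1.mul_right _)).mul_right _

/-- If `a` fixes `z`, then its conjugate by a unit fixes the image of `z`, with the same
eigenvalue. -/
theorem mulVec_transport {φ : (ℝ ⊗[ℚ] D) ≃ₐ[ℝ] Matrix (Fin 2) (Fin 2) ℝ} {γ γ' a : O} {z z₂ j c : ℂ} (hγ : γ' * γ = 1) (hj : j ≠ 0)
    (h : (complexRep φ γ).mulVec ![z, 1] = j • ![z₂, 1])
    (ha : (complexRep φ a).mulVec ![z, 1] = c • ![z, 1]) :
    (complexRep φ (γ * a * γ')).mulVec ![z₂, 1] = c • ![z₂, 1] := by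
  have h1 : ![z₂, 1] = j⁻¹ • (complexRep φ γ).mulVec ![z, 1] := by
    rw [h, smul_smul, inv_mul_cancel₀ hj, one_smul]
  conv_lhs => rw [h1]
  rw [Matrix.mulVec_smul, Matrix.mulVec_mulVec, ← complexRep_mul, mul_assoc, hγ, mul_one,
    complexRep_mul, ← Matrix.mulVec_mulVec, ha, Matrix.mulVec_smul, h, smul_comm, smul_smul j⁻¹,
    inv_mul_cancel₀ hj, one_smul]

end Heegner

end FakeElliptic

end

open FakeElliptic in
theorem mainTheorem5 {D : Type*} [Ring D] [Algebra ℚ D] [Algebra.IsCentral ℚ D] [IsSimpleRing D]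
    (hdim : Module.finrank ℚ D = 4)
    (hnonsplit : IsEmpty (D ≃ₐ[ℚ] Matrix (Fin 2) (Fin 2) ℚ))
    (φ : (ℝ ⊗[ℚ] D) ≃ₐ[ℝ] Matrix (Fin 2) (Fin 2) ℝ)
    (O : Subring D) (hO : FakeElliptic.IsMaximalOrder O)
    (r : ℝ) (hr : 0 < r) :
    ∃ d : ℕ, 0 < d ∧ ∃ p₀ : ℕ, ∀ p : ℕ, p.Prime → p₀ ≤ p →
      ∀ x y x' y' : FakeElliptic.LevelShimuraCurve O p,
        FakeElliptic.IsHeegnerCM (x, y) → FakeElliptic.IsHeegnerCM (x', y') →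
        (x, y) ≠ (x', y') →
        x.proj = x'.proj → y.proj = y'.proj →
        (FakeElliptic.hypBall φ x r ∩ FakeElliptic.hypBall φ x' r).Nonempty →
        (FakeElliptic.hypBall φ y r ∩ FakeElliptic.hypBall φ y' r).Nonempty →
        ∃ k : ℕ, k < d ∧
          ((x, y) ∈ FakeElliptic.HeckeDivisor O p k ∨
            (x', y') ∈ FakeElliptic.HeckeDivisor O p k) := by
  have hord := hO.isOrder
  obtain ⟨C, hC⟩ := exists_unit_bounded φ hord hdim hnonsplit
  -- `R` bounds the distance of the lifts, and `F` contains all conjugated CM elements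
  set R := Real.cosh (2 * (r + 1)) with hR
  have hR1 : 1 ≤ R := Real.one_le_cosh _
  let F : Set O := {a : O | ∀ i j, |realRep φ (a : D) i j| ≤ 4 * (C * C * (1 + 2 * R))}
  have hF : F.Finite := finite_setOf_abs_le φ hord hdim _
  obtain ⟨K, hK⟩ := exists_uniform_intertwiner φ hord hdim hnonsplit hF
  refine ⟨K + 1, Nat.succ_pos K, K, ?_⟩
  intro p hp hKp x y x' y' hxy hxy' hne _ _ hx hy
  have hpp := Nat.prime_iff_prime_int.mp hp
  obtain ⟨h, h', z, z', z₂, A, A', γ, γ', n, j, rfl, rfl, hA, hA', hz', hγ1, hγ2, hn, hγ, hj, hγz,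
    hzz, hdz⟩ := exists_models_of_hypBall_inter hord hdim hp.ne_zero hr hx
  obtain ⟨k, k', w, w', w₂, B, B', η, η', l, i, rfl, rfl, hB, hB', hw', hη1, hη2, hl, hη, hi, hηw,
    hww, hdw⟩ := exists_models_of_hypBall_inter hord hdim hp.ne_zero hr hy
  have hz : z.im ≠ 0 := fun h => by simp [h] at hzz
  have hw : w.im ≠ 0 := fun h => by simp [h] at hww
  obtain ⟨g, a, b, c, hc, hc1, ha, hb, hga, hgb⟩ :=
    hxy.exists_eigenvectors hord hdim hp hz hw hA hB
  obtain ⟨g', a', b', c', hc', hc1', ha', hb', hga', hgb'⟩ :=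
    hxy'.exists_eigenvectors hord hdim hp hz' hw' hA' hB'
  -- transport the elements that fix `z'` and `w'` to the images `z₂` and `w₂`
  set a₁ := γ * a' * γ'
  set b₁ := η * b' * η'
  have ha₁ : (complexRep φ a₁).mulVec ![z₂, 1] = c' • ![z₂, 1] := mulVec_transport hγ2 hj hγz ha'
  have hb₁ : (complexRep φ b₁).mulVec ![w₂, 1] = c' • ![w₂, 1] := mulVec_transport hη2 hi hηw hb'
  have hga₁ : ((p : ℤ) : O) ∣ g' * h - h * a₁ := dvd_transport hγ1 hγ hga'
  have hgb₁ : ((p : ℤ) : O) ∣ g' * k - k * b₁ := dvd_transport hη1 hη hgb'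
  have hkp : IsCoprime (nrd φ k) (p : ℤ) :=
    ((Prime.coprime_iff_not_dvd hpp).mpr (hB.not_dvd_nrd hord hdim hp hw)).symm
  set m := conj φ k * h with hm
  have hma : ((p : ℤ) : O) ∣ m * a - b * m := dvd_intertwine hord hdim hkp hga hgb
  have hma₁ : ((p : ℤ) : O) ∣ m * a₁ - b₁ * m := dvd_intertwine hord hdim hkp hga₁ hgb₁
  have hmp : ¬ ((p : ℤ) : O) ∣ m := by
    intro hd
    have h1 := (dvd_pow_self (p : ℤ) two_ne_zero).trans (intCast_dvd_nrd φ hord hdim hd)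
    rw [hm, nrd_mul φ hord hdim, nrd_conj φ hord hdim] at h1
    exact (hpp.dvd_or_dvd h1).elim (hB.not_dvd_nrd hord hdim hp hw)
      (hA.not_dvd_nrd hord hdim hp hz)
  -- conjugate everything into the finite set `F`
  obtain ⟨δ, δ', hδ1, hδ2, hδ⟩ := hC z.re z.im hz
  obtain ⟨ε, ε', hε1, hε2, hε⟩ := hC w.re w.im hw
  have hself : ∀ u : ℂ, u.im ≠ 0 → 0 < u.im * u.im ∧ coshDist u u ≤ R := fun u hu => by
    refine ⟨mul_self_pos.mpr hu, ?_⟩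
    have : coshDist u u = 1 := by
      rw [coshDist]
      field_simp
      ring
    rw [this]
    exact hR1
  obtain ⟨n₁, q, e1, e2, e3, hq, e5, e6⟩ := hK (δ * a * δ')
    (abs_conj_le hord hdim hδ1 hδ (hself z hz).1 (hself z hz).2 hc1 ha) (δ * a₁ * δ')
    (abs_conj_le hord hdim hδ1 hδ hzz hdz hc1' ha₁) (ε * b * ε')
    (abs_conj_le hord hdim hε1 hε (hself w hw).1 (hself w hw).2 hc1 hb) (ε * b₁ * ε')
    (abs_conj_le hord hdim hε1 hε hww hdw hc1' hb₁) p hp hKp (ε * m * δ') (by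
      intro hd
      have h1 := (intCast_dvd_mul_left hd ε').mul_right δ
      have h2 : ε' * (ε * m * δ') * δ = m := by
        calc _ = (ε' * ε) * m * (δ' * δ) := by simp only [mul_assoc]
          _ = m := by rw [hε2, hδ2, one_mul, mul_one]
      rw [h2] at h1
      exact hmp h1) (dvd_unit_mul hδ2 hε2 hma) (dvd_unit_mul hδ2 hε2 hma₁)
  -- undo the conjugation by the units
  set n₀ := ε' * n₁ * δ with hn₀
  have hback : ∀ s t : O, n₁ * (δ * s * δ') = (ε * t * ε') * n₁ → n₀ * s = t * n₀ := by
    intro s t hst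
    calc n₀ * s = ε' * (n₁ * (δ * s * δ')) * δ := by
          rw [hn₀]
          calc _ = ε' * n₁ * δ * s * 1 := by rw [mul_one]
            _ = _ := by rw [← hδ2]; simp only [mul_assoc]
      _ = (ε' * ε) * t * (ε' * n₁ * δ) := by rw [hst]; simp only [mul_assoc]
      _ = t * n₀ := by rw [hε2, one_mul]
  have hna := hback a b e1
  have hna₁ := hback a₁ b₁ e2
  have hn₁ : n₁ = ε * n₀ * δ' := by
    calc n₁ = (ε * ε') * n₁ * (δ * δ') := by rw [hε1, hδ1, one_mul, mul_one]
      _ = _ := by rw [hn₀]; simp only [mul_assoc]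
  have hn₀0 : n₀ ≠ 0 := by
    intro h0
    exact e3 (by rw [hn₁, h0, mul_zero, zero_mul])
  have hν := nrd_ne_zero φ hord hdim hnonsplit hn₀0
  have hmap : ∀ s t : O, realRep φ ((s * t : O) : D) = realRep φ (s : D) * realRep φ (t : D) :=
    fun s t => by rw [Subring.coe_mul, map_mul]
  by_cases hcomm : a * a₁ = a₁ * a
  · -- commuting elements have a common fixed point, and the two points coincide
    exfalso
    have hz₂ : z = z₂ := eq_of_commute (X := realRep φ (a : D)) (Y := realRep φ (a₁ : D)) hzz
      hc hc' ha ha₁ (by rw [← hmap, hcomm, hmap])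
    have hcommb : b * b₁ = b₁ * b := by
      have h1 : (b * b₁) * n₀ = (b₁ * b) * n₀ := by
        calc (b * b₁) * n₀ = n₀ * (a * a₁) := by
              rw [mul_assoc, ← hna₁, ← mul_assoc, ← hna, mul_assoc]
          _ = (b₁ * b) * n₀ := by
              rw [hcomm, ← mul_assoc, hna₁, mul_assoc, hna, ← mul_assoc]
      have h2 := congrArg (· * conj φ n₀) h1
      simp only [mul_assoc _ n₀, mul_conj φ hord hdim, ← (Int.cast_commute (nrd φ n₀) _).eq] at h2
      exact intCast_mul_cancel hν h2
    have hw₂ : w = w₂ := eq_of_commute (X := realRep φ (b : D)) (Y := realRep φ (b₁ : D)) hww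
      hc hc' hb hb₁ (by rw [← hmap, hcommb, hmap])
    rw [← hz₂] at hγz
    rw [← hw₂] at hηw
    apply hne
    rw [hA.mk_eq_of_unit hp.ne_zero hz' hA' hγ2 hn hγz hγ,
      hB.mk_eq_of_unit hp.ne_zero hw' hB' hη2 hl hηw hη]
  · -- otherwise the intertwiner is rigid and defines a Hecke correspondence
    have hcomm' : (δ * a * δ') * (δ * a₁ * δ') ≠ (δ * a₁ * δ') * (δ * a * δ') := by
      intro h1
      apply hcomm
      have h2 : ∀ s t : O, δ' * ((δ * s * δ') * (δ * t * δ')) * δ = s * t := fun s t => by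
        calc _ = (δ' * δ) * s * (δ' * δ) * t * (δ' * δ) := by simp only [mul_assoc]
          _ = _ := by rw [hδ2, one_mul, mul_one, mul_one]
      rw [← h2 a a₁, h1, h2]
    obtain ⟨hprim, hlt⟩ := e6 hcomm'
    have hnrd : (nrd φ n₀).natAbs = (nrd φ n₁).natAbs := by
      have h1 : (nrd φ ε').natAbs = 1 := by
        have := nrd_unit φ hord hdim hε2
        rw [Int.abs_eq_natAbs] at this
        exact_mod_cast this
      have h2 : (nrd φ δ).natAbs = 1 := by
        have := nrd_unit φ hord hdim hδ1
        rw [Int.abs_eq_natAbs] at this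
        exact_mod_cast this
      rw [hn₀, nrd_mul φ hord hdim, nrd_mul φ hord hdim, Int.natAbs_mul, Int.natAbs_mul, h1, h2,
        one_mul, mul_one]
    have hlab : ((p : ℤ) : O) ∣ m - q * n₀ := by
      have h1 := (intCast_dvd_mul_left e5 ε').mul_right δ
      have h2 : ε' * (ε * m * δ' - q * n₁) * δ = m - q * n₀ := by
        rw [mul_sub, sub_mul, ← mul_assoc ε' (q : O), ← (Int.cast_commute q ε').eq, hn₀]
        congr 1
        · calc _ = (ε' * ε) * m * (δ' * δ) := by simp only [mul_assoc]
            _ = m := by rw [hε2, hδ2, one_mul, mul_one]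
        · simp only [mul_assoc]
      rwa [h2] at h1
    have hcop : (nrd φ n₀).natAbs.Coprime p := by
      refine ((Nat.Prime.coprime_iff_not_dvd hp).mpr fun hd => ?_).symm
      have h1 := Nat.le_of_dvd (Int.natAbs_pos.mpr hν) hd
      omega
    obtain ⟨s, hs⟩ : ∃ s : ℂ, (complexRep φ n₀).mulVec ![z, 1] = s • ![w, 1] := by
      refine ⟨_, (map_mulVec (realRep φ (n₀ : D)) z 1).trans
        (eq_mul_of_eigenvector (X := realRep φ (b : D)) hw hc hb ?_)⟩
      rw [← map_mulVec, ← complexRep_eq, ← complexRep_eq, Matrix.mulVec_mulVec, ← complexRep_mul,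
        ← hna, complexRep_mul, ← Matrix.mulVec_mulVec, ha, Matrix.mulVec_smul]
    refine ⟨(nrd φ n₀).natAbs, by omega, Or.inl ?_⟩
    exact hA.mem_heckeDivisor hO hdim hp hw hB hs (hprim.unit_mul hδ1 hε1) hν hcop hkp hq hlab
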